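/- Let $N\in\{2,3,4,5\}$ and put $n(2)=3$, $n(3)=4$, $n(4)=6$, $n(5)=12$. There are polynomials $R_m$, $m\ge 2$, with constant complex coefficients depending only on $N$ and $m$, in the indeterminates $$\mathfrak B,\quad \overline{\mathfrak B},\quad \mathfrak f,\quad \frac{\mathfrak f^{\,s}\,\overline{\mathfrak f}^{\,m-s}}{\log^{j}|\mathfrak f|}\qquad (s,j=0,1,\dots,m),$$ with the following property. Let $a_1=0,a_2,\dots,a_{n(N)}$ be distinct points of $\mathbb{CP}^1$ and let $f_N:\mathbb H\to\mathbb{CP}^1\setminus\{a_1,\dots,a_{n(N)}\}$ be a holomorphic universal covering map whose deck transformation group is (the image in $\mathrm{PSL}_2(\mathbb Z)$ of) the principal congruence subgroup $\Gamma(N)$ and which vanishes at infinity, that is, $f_N(\tau)\to 0$ as $\operatorname{Im}\tau\to\infty$. Then there are constants $A\neq 0$, $B$ and $c_m$ ($m\ge 3$) with $$f_N(\tau)=A\,q+B\,q^2+\sum_{m\ge 3}c_m q^m,\qquad q=\exp\{2\pi i\tau/N\},$$ for all $\tau$ with sufficiently large imaginary part, and the complete Kähler–Einstein metric $|ds|$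 on $\mathbb{CP}^1\setminus\{a_1,\dots,a_{n(N)}\}$ (the complete smooth conformal metric of Gauss curvature $-1$) has at the cusp $a_1=0$ the expansion $$|ds|=\frac{1}{|f|\,\bigl|\log|\tfrac fA|\bigr|}\left|1-\left(\mathfrak B\,\mathfrak f-\frac{\operatorname{Re}(\mathfrak B\,\mathfrak f)}{\log|\mathfrak f|}\right)+\sum_{m=2}^{\infty}R_m\right||df|,\qquad \mathfrak B=\frac BA,\quad \mathfrak f=\frac fA,$$ where $f$ is the standard coordinate of $\mathbb C\subset\mathbb{CP}^1$ and $R_m$ is evaluated at the indicated values of its indeterminates. The series converges and the identity holds for all $f\neq 0$ in a neighbourhood of $0$, and for every $M\ge 2$ the remainder satisfies $\sum_{m\ge M}R_m=O(|f|^{M})$ as $f\to 0$. In particular $\mathfrak B=B/A$ is the only free parameter of the polynomials $R_m$. -/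

import Mathlib

open Filter Topology Asymptotics MeasureTheory
open scoped ContDiff MatrixGroups ComplexConjugate

noncomputable section

namespace PuncturedSphere

/-! The Riemann sphere is the one-point compactification `OnePoint ℂ`, with the two charts `z` and
`w = 1 / z`. -/

/-- The parametrization of the sphere minus the origin by the coordinate `w = 1 / z`; it sends `0`
to `∞`. -/
def ofInv (w : ℂ) : OnePoint ℂ := if w = 0 then OnePoint.infty else ((w⁻¹ : ℂ) : OnePoint ℂ)

/-- `f` is a holomorphic map from the upper half plane to the Riemann sphere: near every point, `f`
or `1 / f` is a holomorphic function. -/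
def IsHolomorphic (f : UpperHalfPlane → OnePoint ℂ) : Prop :=
  ∀ τ : UpperHalfPlane, ∃ g : ℂ → ℂ, AnalyticAt ℂ g (τ : ℂ) ∧
    ((∀ᶠ σ : UpperHalfPlane in 𝓝 τ, f σ = ((g (σ : ℂ) : ℂ) : OnePoint ℂ)) ∨
      (∀ᶠ σ : UpperHalfPlane in 𝓝 τ, f σ = ofInv (g (σ : ℂ))))

/-- The deck transformations of `f` (the homeomorphisms `h` of the upper half plane with
`f ∘ h = f`) are exactly the transformations given by the elements of `Γ`. As only the
transformations matter, `Γ` and its image in `PSL(2, ℤ)` are not distinguished. -/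
def HasDeckGroup {Y : Type*} (f : UpperHalfPlane → Y) (Γ : Subgroup SL(2, ℤ)) : Prop :=
  ∀ h : UpperHalfPlane ≃ₜ UpperHalfPlane,
    (∀ τ, f (h τ) = f τ) ↔ ∃ γ ∈ Γ, ∀ τ, h τ = γ • τ

/-- The number of cusps of `Γ(N)`, for `N = 2, 3, 4, 5` (the value elsewhere is not used). -/
def cuspCount : ℕ → ℕ
  | 2 => 3
  | 3 => 4
  | 4 => 6
  | 5 => 12
  | _ => 0

/-- `f : ℍ → ℂP¹ ∖ P` is a (holomorphic) universal covering with deck transformation group `Γ(N)`,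
which vanishes at infinity. (The upper half plane is simply connected, so every covering by it is
universal.) -/
structure IsGammaCovering (N : ℕ) (P : Set (OnePoint ℂ))
    (f : UpperHalfPlane → {x : OnePoint ℂ // x ∉ P}) : Prop where
  holomorphic : IsHolomorphic fun τ => (f τ : OnePoint ℂ)
  covering : IsCoveringMap f
  deck : HasDeckGroup f (CongruenceSubgroup.Gamma N)
  vanishes : Tendsto (fun τ => (f τ : OnePoint ℂ)) UpperHalfPlane.atImInfty
    (𝓝 ((0 : ℂ) : OnePoint ℂ))

/-- `f = ∑ₘ cₘ qᵐ` with `q = exp (2πiτ / N)`, for all `τ` of large imaginary part. -/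
def HasCuspExpansion (N : ℕ) (f : UpperHalfPlane → OnePoint ℂ) (c : ℕ → ℂ) : Prop :=
  ∀ᶠ τ : UpperHalfPlane in UpperHalfPlane.atImInfty, ∃ z : ℂ,
    f τ = (z : OnePoint ℂ) ∧ HasSum (fun m => c m * Function.Periodic.qParam N (τ : ℂ) ^ m) z

/-- A smooth conformal (equivalently, in complex dimension one, Kähler) metric `ds = ρ |dz|` on
`ℂP¹ ∖ P`, given by its densities `ρ` in the coordinate `z` and `ρInv` in the coordinate
`w = 1 / z`. -/
structure ConformalMetric (P : Set (OnePoint ℂ)) where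
  ρ : ℂ → ℝ
  ρInv : ℂ → ℝ
  pos : ∀ z : ℂ, (z : OnePoint ℂ) ∉ P → 0 < ρ z
  pos_inv : ∀ w : ℂ, ofInv w ∉ P → 0 < ρInv w
  smooth : ContDiffOn ℝ ∞ ρ {z : ℂ | (z : OnePoint ℂ) ∉ P}
  smooth_inv : ContDiffOn ℝ ∞ ρInv {w : ℂ | ofInv w ∉ P}
  compat : ∀ w : ℂ, w ≠ 0 → ofInv w ∉ P → ρInv w = ρ w⁻¹ / ‖w‖ ^ 2

/-- The Gauss curvature `- Δ (log ρ) / ρ²` of the metric `ρ |dz|` at `z`. -/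
def gaussCurvature (ρ : ℂ → ℝ) (z : ℂ) : ℝ :=
  - Laplacian.laplacian (fun x : ℂ => Real.log (ρ x)) z / ρ z ^ 2

/-- Completeness: every divergent curve (one that eventually leaves each compact subset of
`ℂP¹ ∖ P`) has infinite length; by the Hopf-Rinow theorem this is equivalent to the other usual
definitions. It is enough to consider curves in the domain of the coordinate `z`: if `∞ ∉ P`, a
divergent curve eventually avoids a neighbourhood of `∞`. -/
def ConformalMetric.IsComplete {P : Set (OnePoint ℂ)} (g : ConformalMetric P) : Prop :=
  ∀ γ : ℝ → ℂ, ContDiffOn ℝ 1 γ (Set.Ici 0) →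
    (∀ t ∈ Set.Ici (0 : ℝ), (γ t : OnePoint ℂ) ∉ P) →
    (∀ K : Set (OnePoint ℂ), IsCompact K → K ⊆ Pᶜ → ∀ᶠ t in atTop, (γ t : OnePoint ℂ) ∉ K) →
    ∫⁻ t in Set.Ioi (0 : ℝ), ENNReal.ofReal (g.ρ (γ t) * ‖deriv γ t‖) = ⊤

/-- `g` is a complete Kähler-Einstein metric, normalized to have Gauss curvature `-1` like the
Poincaré metric `|dτ| / Im τ`. -/
structure ConformalMetric.IsCompleteKahlerEinstein {P : Set (OnePoint ℂ)} (g : ConformalMetric P) :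
    Prop where
  curvature : ∀ z : ℂ, (z : OnePoint ℂ) ∉ P → gaussCurvature g.ρ z = -1
  curvature_inv : ∀ w : ℂ, ofInv w ∉ P → gaussCurvature g.ρInv w = -1
  complete : g.IsComplete

/-- The indeterminates of the `m`-th term of the expansion: `𝔟` for `B/A`, `𝔟bar` for its complex
conjugate, `𝔣` for `f/A`, and `mon s j` for `𝔣 ^ s * conj 𝔣 ^ (m - s) / log ^ j |𝔣|`. -/
inductive ExpVar (m : ℕ) : Type
  | 𝔟 : ExpVar m
  | 𝔟bar : ExpVar m
  | 𝔣 : ExpVar m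
  | mon (s j : Fin (m + 1)) : ExpVar m

/-- The values of the indeterminates. -/
def expVal (m : ℕ) (b x : ℂ) : ExpVar m → ℂ
  | .𝔟 => b
  | .𝔟bar => conj b
  | .𝔣 => x
  | .mon s j => x ^ (s : ℕ) * conj x ^ (m - (s : ℕ)) / ((Real.log ‖x‖ ^ (j : ℕ) : ℝ) : ℂ)

/-- The value of the term `R m` of the expansion at `B/A = b` and `f/A = x`. -/
def term (R : (m : ℕ) → MvPolynomial (ExpVar m) ℂ) (b x : ℂ) (m : ℕ) : ℂ :=
  MvPolynomial.eval (expVal m b x) (R m)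

/-- The principal part `1 - (b x - Re (b x) / log |x|)` of the expansion. -/
def principalPart (b x : ℂ) : ℂ :=
  1 - (b * x - (((b * x).re / Real.log ‖x‖ : ℝ) : ℂ))

end PuncturedSphere

end

namespace PuncturedSphere

open InnerProductSpace Laplacian

/-! ### The Laplacian on the complex plane -/

/-! The metric is the image of `|dτ| / Im τ` under the covering. With `q = exp (2πiτ / N)` the
latter becomes `|dq| / (|q| |log |q||)`, so if `G` is the local inverse of `q ↦ f` at the cusp, the
density is `|G'| / (|G| |log |G||)`. Writing `G (A x) = x exp (h x)` with `x = f / A` turns this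
into `1 / (|f| |log |x||)` times `|1 + x h'(x)| / |1 + Re h(x) / log |x||`. The expansion is the
quotient of these two series, computed recursively (`expTerm`) and sorted by homogeneous degree in
`x` and its conjugate. Two points carry the weight.

Uniqueness of the metric. The logarithm `φ` of a density of curvature `-1` satisfies `Δ φ = exp (2
φ)`. The Ahlfors lemma bounds its pullback to the half plane from above by the hyperbolic metric
(`IsLiouvilleOn.le_neg_log_im`). Conversely a complete `φ₂` dominates every other solution `φ₁`
(`le_of_hasInfiniteEnds`): at a minimum of `φ₂ - φ₁` the equation gives `φ₁ ≤ φ₂`, and a negative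
infimum is attained because in each cusp the difference is controlled by a horocycle
(`cusp_comparison`, a barrier argument in which completeness along one ray spreads to a whole
horocycle by a Harnack inequality). Together they give `IsCuspCovering.exp_mul_norm_deriv_mul_im`.

Dependence on one parameter. In the coordinate `1 / f` the cusp lies at infinity. Two coverings `U`,
`U₀` with the group `Γ(N)` differ by an injective holomorphic map of the bases with a simple pole at
infinity, hence by an affine map `α U₀ + β` (`IsCuspCovering.exists_eq_mul_add`). The scaling `α` is
absorbed in `A` and the translation `β` is determined by `B / A`. So `h` arises from one fixed
series `H` by a substitution, and its coefficients are polynomials in `B / A` (`hasSum_shiftedLog`).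
-/

theorem laplacian_eq_fderiv_fderiv (u : ℂ → ℝ) (z : ℂ) :
    Δ u z = fderiv ℝ (fderiv ℝ u) z 1 1 + fderiv ℝ (fderiv ℝ u) z Complex.I Complex.I := by
  rw [laplacian_eq_iteratedFDeriv_complexPlane]
  simp [iteratedFDeriv_two_apply]

theorem hasDerivAt_line {u : ℂ → ℝ} {z v : ℂ} {t : ℝ}
    (hu : DifferentiableAt ℝ u (z + t * v)) :
    HasDerivAt (fun s : ℝ => u (z + s * v)) (fderiv ℝ u (z + t * v) v) t := by
  have h : HasDerivAt (fun s : ℝ => z + s * v) v t := by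
    simpa using ((Complex.ofRealCLM.hasDerivAt (x := t)).mul_const v).const_add z
  exact hu.hasFDerivAt.comp_hasDerivAt t h

theorem eventually_line {p : ℂ → Prop} {z : ℂ} (v : ℂ) (h : ∀ᶠ w in 𝓝 z, p w) :
    ∀ᶠ t : ℝ in 𝓝 0, p (z + t * v) := by
  have : Tendsto (fun t : ℝ => z + t * v) (𝓝 0) (𝓝 z) := by
    have : Continuous fun t : ℝ => z + t * v := by fun_prop
    simpa using this.tendsto 0
  exact this.eventually h

theorem ContDiffAt.hasDerivAt_deriv_line {u : ℂ → ℝ} {z : ℂ} (hu : ContDiffAt ℝ 2 u z) (v : ℂ) :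
    HasDerivAt (deriv fun s : ℝ => u (z + s * v)) (fderiv ℝ (fderiv ℝ u) z v v) 0 := by
  have h1 : ∀ᶠ w in 𝓝 z, DifferentiableAt ℝ u w :=
    (hu.eventually (by simp)).mono fun w hw => hw.differentiableAt (by simp)
  have h2 : deriv (fun s : ℝ => u (z + s * v)) =ᶠ[𝓝 0] fun t => fderiv ℝ u (z + t * v) v := by
    filter_upwards [eventually_line v h1] with t ht
    exact (hasDerivAt_line ht).deriv
  have h3 : DifferentiableAt ℝ (fderiv ℝ u) z :=
    (hu.fderiv_right (m := 1) (by norm_num)).differentiableAt (by simp)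
  have h4 : HasDerivAt (fun s : ℝ => z + s * v) v 0 := by
    simpa using ((Complex.ofRealCLM.hasDerivAt (x := 0)).mul_const v).const_add z
  have h5 : HasDerivAt (fun s : ℝ => fderiv ℝ u (z + s * v)) (fderiv ℝ (fderiv ℝ u) z v) 0 := by
    have : HasFDerivAt (fderiv ℝ u) (fderiv ℝ (fderiv ℝ u) z) (z + (0 : ℝ) * v) := by
      simpa using h3.hasFDerivAt
    exact this.comp_hasDerivAt 0 h4
  have h6 : HasDerivAt (fun s : ℝ => fderiv ℝ u (z + s * v) v) (fderiv ℝ (fderiv ℝ u) z v v) 0 := by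
    simpa using h5.clm_apply (hasDerivAt_const 0 v)
  exact h6.congr_of_eventuallyEq h2

theorem laplacian_eq_of_lines {u : ℂ → ℝ} {z : ℂ} (hu : ContDiffAt ℝ 2 u z) {a b : ℝ}
    (ha : HasDerivAt (deriv fun s : ℝ => u (z + s)) a 0)
    (hb : HasDerivAt (deriv fun s : ℝ => u (z + s * Complex.I)) b 0) : Δ u z = a + b := by
  have h1 := ContDiffAt.hasDerivAt_deriv_line hu 1
  have h2 := ContDiffAt.hasDerivAt_deriv_line hu Complex.I
  simp only [mul_one] at h1
  rw [laplacian_eq_fderiv_fderiv, h1.unique ha, h2.unique hb]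

/-- A negative second derivative would make the point a local maximum as well, hence `f` locally
constant and the second derivative zero. -/
theorem nonneg_of_isLocalMin_of_hasDerivAt_deriv {f : ℝ → ℝ} {a x : ℝ} (hmin : IsLocalMin f x)
    (hc : ContinuousAt f x) (hd : HasDerivAt (deriv f) a x) : 0 ≤ a := by
  by_contra! ha
  have h0 : deriv f x = 0 := hmin.deriv_eq_zero
  have hmax : IsLocalMax f x := isLocalMax_of_deriv_deriv_neg (by rwa [hd.deriv]) h0 hc
  have hconst : f =ᶠ[𝓝 x] fun _ => f x := by
    filter_upwards [hmin, hmax] with y h1 h2 using le_antisymm h2 h1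
  have : deriv f =ᶠ[𝓝 x] fun _ => 0 := by
    filter_upwards [hconst.eventuallyEq_nhds] with y hy
    rw [hy.deriv_eq, deriv_const]
  have h := (hd.congr_of_eventuallyEq this.symm).unique (hasDerivAt_const x 0)
  exact ha.ne h

theorem laplacian_nonneg_of_isLocalMin {u : ℂ → ℝ} {z : ℂ} (hu : ContDiffAt ℝ 2 u z)
    (hmin : IsLocalMin u z) : 0 ≤ Δ u z := by
  have key : ∀ v : ℂ, 0 ≤ fderiv ℝ (fderiv ℝ u) z v v := by
    intro v
    refine nonneg_of_isLocalMin_of_hasDerivAt_deriv (f := fun s : ℝ => u (z + s * v)) (x := 0)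
      ?_ ?_ (ContDiffAt.hasDerivAt_deriv_line hu v)
    · have := eventually_line v hmin
      simpa [IsLocalMin, IsMinFilter] using this
    · refine ContinuousAt.comp (f := fun s : ℝ => z + s * v) (g := u) ?_ (by fun_prop)
      simpa using hu.continuousAt
  rw [laplacian_eq_fderiv_fderiv]
  exact add_nonneg (key _) (key _)

theorem laplacian_nonpos_of_isLocalMax {u : ℂ → ℝ} {z : ℂ} (hu : ContDiffAt ℝ 2 u z)
    (hmax : IsLocalMax u z) : Δ u z ≤ 0 := by
  have h := laplacian_nonneg_of_isLocalMin hu.neg hmax.neg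
  rw [show (fun x => -u x) = -u from rfl, laplacian_neg] at h
  simpa using h

theorem AnalyticAt.hasFDerivAt_real {k : ℂ → ℂ} {z : ℂ} (hk : AnalyticAt ℂ k z) :
    HasFDerivAt k ((ContinuousLinearMap.toSpanSingleton ℂ (deriv k z)).restrictScalars ℝ) z :=
  hk.differentiableAt.hasDerivAt.hasFDerivAt.restrictScalars ℝ

/-- The Laplacian of a function precomposed with a holomorphic map. -/
theorem laplacian_comp_analyticAt {u : ℂ → ℝ} {h : ℂ → ℂ} {z : ℂ} (hu : ContDiffAt ℝ 2 u (h z))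
    (hh : AnalyticAt ℂ h z) : Δ (u ∘ h) z = ‖deriv h z‖ ^ 2 * Δ u (h z) := by
  have hu1 : ∀ᶠ w in 𝓝 (h z), DifferentiableAt ℝ u w :=
    (hu.eventually (by simp)).mono fun w hw => hw.differentiableAt (by simp)
  have hh1 : ∀ᶠ w in 𝓝 z, AnalyticAt ℂ h w := hh.eventually_analyticAt
  have hfd : ∀ᶠ w in 𝓝 z, ∀ v, fderiv ℝ (u ∘ h) w v = fderiv ℝ u (h w) (deriv h w * v) := by
    filter_upwards [hh1, hh.continuousAt.eventually hu1] with w h1 h2 v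
    rw [(h2.hasFDerivAt.comp w (AnalyticAt.hasFDerivAt_real h1)).fderiv]
    simp [mul_comm]
  have huh : ContDiffAt ℝ 2 (u ∘ h) z := hu.comp z (hh.contDiffAt.restrict_scalars ℝ)
  have hsecond : ∀ v, fderiv ℝ (fderiv ℝ (u ∘ h)) z v v =
      fderiv ℝ (fderiv ℝ u) (h z) (deriv h z * v) (deriv h z * v) +
        fderiv ℝ u (h z) (deriv (deriv h) z * v * v) := by
    intro v
    have h3 : DifferentiableAt ℝ (fderiv ℝ (u ∘ h)) z :=
      (huh.fderiv_right (m := 1) (by norm_num)).differentiableAt (by simp)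
    have h4 : HasFDerivAt (fun w => fderiv ℝ (u ∘ h) w v)
        ((ContinuousLinearMap.apply ℝ ℝ v).comp (fderiv ℝ (fderiv ℝ (u ∘ h)) z)) z :=
      (ContinuousLinearMap.apply ℝ ℝ v).hasFDerivAt.comp z h3.hasFDerivAt
    have h5 : DifferentiableAt ℝ (fderiv ℝ u) (h z) :=
      (hu.fderiv_right (m := 1) (by norm_num)).differentiableAt (by simp)
    have h6 := h5.hasFDerivAt.comp z (AnalyticAt.hasFDerivAt_real hh)
    have h7 : HasFDerivAt (fun w => deriv h w * v) _ z := (AnalyticAt.hasFDerivAt_real hh.deriv).mul_const v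
    have h8 := h6.clm_apply h7
    have h9 := h4.unique (h8.congr_of_eventuallyEq (hfd.mono fun w hw => hw v))
    have h10 := congrArg (fun L => L v) h9
    simp only [ContinuousLinearMap.comp_apply, ContinuousLinearMap.apply_apply] at h10
    rw [h10]
    simp
    ring_nf
  rw [laplacian_eq_fderiv_fderiv, laplacian_eq_fderiv_fderiv, hsecond, hsecond]
  set B := fderiv ℝ (fderiv ℝ u) (h z)
  set L := fderiv ℝ u (h z)
  -- Multiplication by `h'` is a rotation and scaling: expanding the Hessian in the basis `1, I`,
  -- the mixed terms of the two directions cancel. The first-order terms, with `h'' v²`, cancel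
  -- because `1² + I² = 0`.
  have e1 : deriv h z * 1 = (deriv h z).re • (1 : ℂ) + (deriv h z).im • Complex.I := by
    apply Complex.ext <;> simp
  have e2 : deriv h z * Complex.I = (deriv h z).re • Complex.I - (deriv h z).im • (1 : ℂ) := by
    apply Complex.ext <;> simp
  have e3 : deriv (deriv h) z * Complex.I * Complex.I = -(deriv (deriv h) z * 1 * 1) := by
    rw [mul_assoc, Complex.I_mul_I]; ring
  rw [e1, e2, e3, map_neg, ← Complex.normSq_eq_norm_sq, Complex.normSq_apply]
  simp only [map_add, map_sub, map_smul, add_apply, sub_apply,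
    smul_apply, smul_eq_mul]
  ring

/-! ### The Liouville equation -/

/-- `φ` is the logarithm of the density of a conformal metric of curvature `-1` on `U`. -/
structure IsLiouvilleOn (φ : ℂ → ℝ) (U : Set ℂ) : Prop where
  contDiffAt : ∀ z ∈ U, ContDiffAt ℝ 2 φ z
  laplacian_eq : ∀ z ∈ U, Δ φ z = Real.exp (2 * φ z)

theorem IsLiouvilleOn.mono {φ : ℂ → ℝ} {U V : Set ℂ} (h : IsLiouvilleOn φ U) (hV : V ⊆ U) :
    IsLiouvilleOn φ V :=
  ⟨fun z hz => h.1 z (hV hz), fun z hz => h.2 z (hV hz)⟩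

theorem IsLiouvilleOn.congr {φ ψ : ℂ → ℝ} {U : Set ℂ} (h : IsLiouvilleOn φ U) (hU : IsOpen U)
    (he : ∀ z ∈ U, ψ z = φ z) : IsLiouvilleOn ψ U := by
  have he' : ∀ z ∈ U, ψ =ᶠ[𝓝 z] φ := fun z hz =>
    eventually_of_mem (hU.mem_nhds hz) he
  refine ⟨fun z hz => (h.1 z hz).congr_of_eventuallyEq (he' z hz), fun z hz => ?_⟩
  rw [(laplacian_congr_nhds (he' z hz)).eq_of_nhds, he z hz, h.2 z hz]

theorem IsLiouvilleOn.comp {φ : ℂ → ℝ} {U V : Set ℂ} {h : ℂ → ℂ} (hφ : IsLiouvilleOn φ U)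
    (hh : ∀ z ∈ V, AnalyticAt ℂ h z) (hV : ∀ z ∈ V, h z ∈ U) (hh' : ∀ z ∈ V, deriv h z ≠ 0) :
    IsLiouvilleOn (fun z => φ (h z) + Real.log ‖deriv h z‖) V := by
  have h1 : ∀ z ∈ V, ContDiffAt ℝ 2 (φ ∘ h) z := fun z hz =>
    (hφ.1 _ (hV z hz)).comp z ((hh z hz).contDiffAt.restrict_scalars ℝ)
  have h2 : ∀ z ∈ V, HarmonicAt (Real.log ‖deriv h ·‖) z := fun z hz =>
    (hh z hz).deriv.harmonicAt_log_norm (hh' z hz)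
  have e : (fun z => φ (h z) + Real.log ‖deriv h z‖) = (φ ∘ h) + (Real.log ‖deriv h ·‖) := rfl
  refine ⟨fun z hz => ?_, fun z hz => ?_⟩
  · rw [e]; exact (h1 z hz).add (h2 z hz).1
  · rw [e, (h1 z hz).laplacian_add (h2 z hz).1, (h2 z hz).2.eq_of_nhds,
      laplacian_comp_analyticAt (hφ.1 _ (hV z hz)) (hh z hz), hφ.2 _ (hV z hz)]
    have : 0 < ‖deriv h z‖ := norm_pos_iff.2 (hh' z hz)
    simp only [Pi.zero_apply, add_zero]
    rw [mul_add, Real.exp_add, mul_comm, ← Real.log_rpow this, Real.exp_log (by positivity)]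
    norm_num

theorem isOpen_upperHalf : IsOpen {z : ℂ | 0 < z.im} :=
  isOpen_lt continuous_const Complex.continuous_im

/-- The hyperbolic metric of the upper half plane. -/
theorem isLiouvilleOn_upperHalf : IsLiouvilleOn (fun z => -Real.log z.im) {z | 0 < z.im} := by
  have hc : ∀ z ∈ {z : ℂ | 0 < z.im}, ContDiffAt ℝ 2 (fun z : ℂ => -Real.log z.im) z := by
    intro z hz
    exact ((Complex.imCLM.contDiff.contDiffAt).log (ne_of_gt hz)).neg
  refine ⟨hc, fun z hz => ?_⟩
  have hz' : 0 < z.im := hz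
  have ha : HasDerivAt (deriv fun s : ℝ => -Real.log (z + s : ℂ).im) 0 0 := by
    simpa using hasDerivAt_const (0 : ℝ) (0 : ℝ)
  have hb : HasDerivAt (deriv fun s : ℝ => -Real.log (z + s * Complex.I : ℂ).im)
      (1 / z.im ^ 2) 0 := by
    have h1 : (deriv fun s : ℝ => -Real.log (z + s * Complex.I : ℂ).im) =ᶠ[𝓝 0]
        fun s => -(z.im + s)⁻¹ := by
      have : ∀ᶠ s : ℝ in 𝓝 0, z.im + s ≠ 0 := by
        have : ContinuousAt (fun s : ℝ => z.im + s) 0 := by fun_prop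
        exact this.eventually_ne (by simpa using hz'.ne')
      filter_upwards [this] with s hs
      have : HasDerivAt (fun s : ℝ => z.im + s) 1 s := by
        simpa using (hasDerivAt_id s).const_add z.im
      simpa using (this.log hs).neg.deriv
    refine HasDerivAt.congr_of_eventuallyEq ?_ h1
    have h2 : HasDerivAt (fun s : ℝ => z.im + s) 1 0 := by
      simpa using (hasDerivAt_id (0 : ℝ)).const_add z.im
    have := (h2.inv (by simpa using hz'.ne')).neg
    refine (this.congr_deriv (by simp [neg_div])).congr_of_eventuallyEq (Eventually.of_forall fun s => ?_)
    simp
  rw [laplacian_eq_of_lines (hc z hz) ha hb, zero_add,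
    show 2 * -Real.log z.im = -Real.log (z.im ^ 2) by rw [Real.log_pow]; push_cast; ring,
    Real.exp_neg, Real.exp_log (by positivity), one_div]

/-! ### The Ahlfors lemma -/

/-- The restriction of `log (R² - |z - c|²)` to a horizontal or vertical line: `A` is the value of
`R² - |z - c|²` at the base point and `b` the real or imaginary part of `z - c`. -/
theorem hasDerivAt_deriv_log_quadratic {A : ℝ} (hA : 0 < A) (b : ℝ) :
    HasDerivAt (deriv fun s : ℝ => Real.log (A - 2 * b * s - s ^ 2))
      (-(2 * A + 4 * b ^ 2) / A ^ 2) 0 := by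
  have hg : ∀ s : ℝ, HasDerivAt (fun s : ℝ => A - 2 * b * s - s ^ 2) (-(2 * b) - 2 * s) s := by
    intro s
    have h1 := ((hasDerivAt_id s).const_mul (2 * b)).const_sub A
    have h2 := h1.sub (hasDerivAt_pow 2 s)
    refine (h2.congr_deriv (by simp)).congr_of_eventuallyEq (Eventually.of_forall fun t => ?_)
    simp
  have hne : ∀ᶠ s : ℝ in 𝓝 0, A - 2 * b * s - s ^ 2 ≠ 0 := by
    have : ContinuousAt (fun s : ℝ => A - 2 * b * s - s ^ 2) 0 := by fun_prop
    exact this.eventually_ne (by simpa using hA.ne')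
  have h1 : (deriv fun s : ℝ => Real.log (A - 2 * b * s - s ^ 2)) =ᶠ[𝓝 0]
      fun s => (-(2 * b) - 2 * s) / (A - 2 * b * s - s ^ 2) := by
    filter_upwards [hne] with s hs using ((hg s).log hs).deriv
  refine HasDerivAt.congr_of_eventuallyEq ?_ h1
  have h2 : HasDerivAt (fun s : ℝ => -(2 * b) - 2 * s) (-2) 0 := by
    simpa using ((hasDerivAt_id (0 : ℝ)).const_mul 2).const_sub (-(2 * b))
  have h3 := h2.div (hg 0) (by simpa using hA.ne')
  refine h3.congr_deriv ?_
  simp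
  ring_nf

theorem contDiffAt_log_disc {c z : ℂ} {R : ℝ} (hz : z ∈ Metric.ball c R) :
    ContDiffAt ℝ 2 (fun z : ℂ => Real.log (R ^ 2 - ‖z - c‖ ^ 2)) z := by
  have hpos : 0 < R ^ 2 - ‖z - c‖ ^ 2 := by
    have := mem_ball_iff_norm.1 hz
    nlinarith [norm_nonneg (z - c)]
  refine ContDiffAt.log ?_ hpos.ne'
  exact contDiffAt_const.sub ((contDiffAt_id.sub contDiffAt_const).norm_sq ℝ)

theorem laplacian_log_disc {c z : ℂ} {R : ℝ} (hz : z ∈ Metric.ball c R) :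
    Δ (fun z : ℂ => Real.log (R ^ 2 - ‖z - c‖ ^ 2)) z =
      -(4 * R ^ 2) / (R ^ 2 - ‖z - c‖ ^ 2) ^ 2 := by
  have hpos : 0 < R ^ 2 - ‖z - c‖ ^ 2 := by
    have := mem_ball_iff_norm.1 hz
    nlinarith [norm_nonneg (z - c)]
  have h1 := hasDerivAt_deriv_log_quadratic hpos (z - c).re
  have h2 := hasDerivAt_deriv_log_quadratic hpos (z - c).im
  have e1 : (fun s : ℝ => Real.log (R ^ 2 - ‖z - c‖ ^ 2 - 2 * (z - c).re * s - s ^ 2)) =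
      fun s : ℝ => Real.log (R ^ 2 - ‖z + s - c‖ ^ 2) := by
    funext s
    rw [← Complex.normSq_eq_norm_sq, ← Complex.normSq_eq_norm_sq, Complex.normSq_apply,
      Complex.normSq_apply]
    simp
    ring_nf
  have e2 : (fun s : ℝ => Real.log (R ^ 2 - ‖z - c‖ ^ 2 - 2 * (z - c).im * s - s ^ 2)) =
      fun s : ℝ => Real.log (R ^ 2 - ‖z + s * Complex.I - c‖ ^ 2) := by
    funext s
    rw [← Complex.normSq_eq_norm_sq, ← Complex.normSq_eq_norm_sq, Complex.normSq_apply,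
      Complex.normSq_apply]
    simp
    ring_nf
  rw [e1] at h1
  rw [e2] at h2
  rw [laplacian_eq_of_lines (contDiffAt_log_disc hz) h1 h2]
  have : ‖z - c‖ ^ 2 = (z - c).re ^ 2 + (z - c).im ^ 2 := by
    rw [← Complex.normSq_eq_norm_sq, Complex.normSq_apply]; ring
  field_simp
  linarith

/-- The Ahlfors lemma on a disc. -/
theorem IsLiouvilleOn.exp_mul_le {φ : ℂ → ℝ} {c : ℂ} {R : ℝ} (hR : 0 < R)
    (hφ : IsLiouvilleOn φ (Metric.closedBall c R)) {z : ℂ} (hz : z ∈ Metric.ball c R) :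
    Real.exp (φ z) * (R ^ 2 - ‖z - c‖ ^ 2) ≤ 2 * R := by
  have hpos : ∀ z ∈ Metric.ball c R, 0 < R ^ 2 - ‖z - c‖ ^ 2 := by
    intro z hz
    have := mem_ball_iff_norm.1 hz
    nlinarith [norm_nonneg (z - c)]
  have hcont : ContinuousOn (fun z => Real.exp (φ z) * (R ^ 2 - ‖z - c‖ ^ 2))
      (Metric.closedBall c R) := by
    intro w hw
    refine ContinuousAt.continuousWithinAt ?_
    have := (hφ.1 w hw).continuousAt
    fun_prop
  obtain ⟨w, hw, hmax⟩ := (isCompact_closedBall c R).exists_isMaxOn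
    ⟨c, Metric.mem_closedBall_self hR.le⟩ hcont
  have hzw : Real.exp (φ z) * (R ^ 2 - ‖z - c‖ ^ 2) ≤ Real.exp (φ w) * (R ^ 2 - ‖w - c‖ ^ 2) :=
    hmax (Metric.ball_subset_closedBall hz)
  refine hzw.trans ?_
  -- The product vanishes on the boundary circle and is positive at `z`, so its maximum is interior.
  have hwb : w ∈ Metric.ball c R := by
    have h1 : 0 < Real.exp (φ w) * (R ^ 2 - ‖w - c‖ ^ 2) :=
      (mul_pos (Real.exp_pos _) (hpos z hz)).trans_le hzw
    have h2 : 0 < R ^ 2 - ‖w - c‖ ^ 2 := pos_of_mul_pos_right h1 (Real.exp_pos _).le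
    rw [mem_ball_iff_norm]
    nlinarith [norm_nonneg (w - c)]
  have hlog : ∀ y ∈ Metric.ball c R, φ y + Real.log (R ^ 2 - ‖y - c‖ ^ 2) =
      Real.log (Real.exp (φ y) * (R ^ 2 - ‖y - c‖ ^ 2)) := by
    intro y hy
    rw [Real.log_mul (Real.exp_pos _).ne' (hpos y hy).ne', Real.log_exp]
  have hloc : IsLocalMax (φ + fun y : ℂ => Real.log (R ^ 2 - ‖y - c‖ ^ 2)) w := by
    filter_upwards [Metric.isOpen_ball.mem_nhds hwb] with y hy
    simp only [Pi.add_apply]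
    rw [hlog y hy, hlog w hwb]
    exact Real.log_le_log (mul_pos (Real.exp_pos _) (hpos y hy))
      (hmax (Metric.ball_subset_closedBall hy))
  have h1 : Δ (φ + fun y : ℂ => Real.log (R ^ 2 - ‖y - c‖ ^ 2)) w ≤ 0 :=
    laplacian_nonpos_of_isLocalMax ((hφ.1 w hw).add (contDiffAt_log_disc hwb)) hloc
  rw [(hφ.1 w hw).laplacian_add (contDiffAt_log_disc hwb), hφ.2 w hw, laplacian_log_disc hwb] at h1
  have hA := hpos w hwb
  have h2 : (Real.exp (φ w) * (R ^ 2 - ‖w - c‖ ^ 2)) ^ 2 ≤ (2 * R) ^ 2 := by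
    rw [mul_pow, ← Real.exp_nat_mul]
    push_cast
    rw [neg_div, ← sub_eq_add_neg, sub_nonpos, le_div_iff₀ (by positivity)] at h1
    linarith
  exact (abs_le_of_sq_le_sq' h2 (by positivity)).2

/-- The Ahlfors lemma on the upper half plane. -/
theorem IsLiouvilleOn.le_neg_log_im {φ : ℂ → ℝ} (hφ : IsLiouvilleOn φ {z | 0 < z.im}) {z : ℂ}
    (hz : 0 < z.im) : φ z ≤ -Real.log z.im := by
  -- The discs with centre `Re z + iK` and radius `K - 1/K` have closures in the half plane and
  -- exhaust it. Their disc bounds, divided by `K`, tend to the bound `exp (φ z) * 2 Im z ≤ 2`.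
  have key : ∀ᶠ K : ℝ in atTop,
      Real.exp (φ z) * (2 * z.im - (z.im ^ 2 + 2) / K) ≤ 2 := by
    filter_upwards [eventually_gt_atTop (1 : ℝ), eventually_gt_atTop z.im,
      eventually_gt_atTop (1 / z.im)] with K hK1 hK2 hK3
    have hK0 : 0 < K := by linarith
    have hKi : 0 < 1 / K := by positivity
    have hKi' : 1 / K < 1 := by rw [div_lt_one hK0]; exact hK1
    have hKz : 1 / K < z.im := by rw [div_lt_iff₀ hK0]; rw [div_lt_iff₀ hz] at hK3; linarith
    have hsub : Metric.closedBall (⟨z.re, K⟩ : ℂ) (K - 1 / K) ⊆ {z : ℂ | 0 < z.im} := by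
      intro w hw
      have h1 := (Complex.abs_im_le_norm (w - ⟨z.re, K⟩)).trans (mem_closedBall_iff_norm.1 hw)
      rw [Complex.sub_im, abs_le] at h1
      simp only [Set.mem_ofPred_eq]
      linarith [h1.1]
    have hnorm : ‖z - ⟨z.re, K⟩‖ = K - z.im := by
      have : z - ⟨z.re, K⟩ = ((z.im - K : ℝ) : ℂ) * Complex.I := by
        apply Complex.ext <;> simp
      rw [this, norm_mul, Complex.norm_I, Complex.norm_real, mul_one, Real.norm_eq_abs,
        abs_of_neg (by linarith)]
      ring
    have h := (hφ.mono hsub).exp_mul_le (by linarith) (z := z)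
      (by rw [mem_ball_iff_norm, hnorm]; linarith)
    rw [hnorm] at h
    have e : (K - 1 / K) ^ 2 - (K - z.im) ^ 2 = K * (2 * z.im - (z.im ^ 2 + 2) / K) + (1 / K) ^ 2 := by
      field_simp
      ring
    rw [e] at h
    have h3 : K * (Real.exp (φ z) * (2 * z.im - (z.im ^ 2 + 2) / K)) ≤ K * 2 := by
      have := mul_nonneg (Real.exp_pos (φ z)).le (sq_nonneg (1 / K))
      linarith
    exact le_of_mul_le_mul_left h3 hK0
  have hlim : Tendsto (fun K : ℝ => Real.exp (φ z) * (2 * z.im - (z.im ^ 2 + 2) / K)) atTop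
      (𝓝 (Real.exp (φ z) * (2 * z.im - 0))) :=
    (tendsto_const_nhds.sub (tendsto_const_nhds.div_atTop tendsto_id)).const_mul _
  have h := le_of_tendsto hlim key
  rw [← Real.log_inv, Real.le_log_iff_exp_le (by positivity), ← one_div, le_div_iff₀ hz]
  linarith

end PuncturedSphere

namespace PuncturedSphere

open InnerProductSpace Laplacian

/-! ### Mean value inequalities and a Harnack inequality -/

/-- The sum of the `n` rotates of `u` about `c` again has positive Laplacian, so its maximum over
the disc lies on the circle and is at least its value `n * u c` at the centre. The right-hand side
is a Riemann sum for the circle average, which gives the sub-mean value property without Green's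
formula. -/
theorem exists_mem_sphere_le_sum_rotations {u : ℂ → ℝ} {c : ℂ} {r : ℝ} (hr : 0 < r)
    (hu : ∀ z ∈ Metric.closedBall c r, ContDiffAt ℝ 2 u z)
    (hpos : ∀ z ∈ Metric.closedBall c r, 0 < Δ u z) {n : ℕ} (hn : 0 < n) :
    ∃ θ : ℝ, n * u c ≤
      ∑ k ∈ Finset.range n, u (circleMap c r (θ + k * (2 * Real.pi / n))) := by
  set η : ℕ → ℂ := fun k => Complex.exp ((k * (2 * Real.pi / n) : ℝ) * Complex.I)
  have hη : ∀ k, ‖η k‖ = 1 := fun k => Complex.norm_exp_ofReal_mul_I _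
  set h : ℕ → ℂ → ℂ := fun k z => c + η k * z
  have hmem : ∀ k, ∀ z ∈ Metric.closedBall (0 : ℂ) r, h k z ∈ Metric.closedBall c r := by
    intro k z hz
    rw [mem_closedBall_zero_iff] at hz
    simpa [h, hη] using hz
  have han : ∀ k z, AnalyticAt ℂ (h k) z := fun k z => by fun_prop
  have hder : ∀ k z, deriv (h k) z = η k := by
    intro k z
    have h1 : HasDerivAt (h k) (η k * 1) z := ((hasDerivAt_id z).const_mul (η k)).const_add c
    simpa using h1.deriv
  have hsm : ∀ k, ∀ z ∈ Metric.closedBall (0 : ℂ) r, ContDiffAt ℝ 2 (u ∘ h k) z := fun k z hz =>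
    (hu _ (hmem k z hz)).comp z ((han k z).contDiffAt.restrict_scalars ℝ)
  have hΔ : ∀ m : ℕ, ∀ z ∈ Metric.closedBall (0 : ℂ) r,
      ContDiffAt ℝ 2 (fun z => ∑ k ∈ Finset.range m, u (h k z)) z ∧
      Δ (fun z => ∑ k ∈ Finset.range m, u (h k z)) z =
        ∑ k ∈ Finset.range m, Δ u (h k z) := by
    intro m z hz
    induction m with
    | zero => exact ⟨by simp [contDiffAt_const], by simp⟩
    | succ m ih =>
      have e : (fun z => ∑ k ∈ Finset.range (m + 1), u (h k z)) =
          (fun z => ∑ k ∈ Finset.range m, u (h k z)) + (u ∘ h m) := by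
        funext z; simp [Finset.sum_range_succ]
      rw [e, Finset.sum_range_succ]
      refine ⟨ih.1.add (hsm m z hz), ?_⟩
      rw [ih.1.laplacian_add (hsm m z hz), ih.2,
        laplacian_comp_analyticAt (hu _ (hmem m z hz)) (han m z), hder, hη]
      simp
  obtain ⟨w, hw, hmax⟩ := (isCompact_closedBall (0 : ℂ) r).exists_isMaxOn
    ⟨0, Metric.mem_closedBall_self hr.le⟩
    (f := fun z => ∑ k ∈ Finset.range n, u (h k z))
    (fun z hz => (hΔ n z hz).1.continuousAt.continuousWithinAt)
  have hwr : ‖w‖ = r := by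
    refine le_antisymm (mem_closedBall_zero_iff.1 hw) ?_
    by_contra! hlt
    have hloc : IsLocalMax (fun z => ∑ k ∈ Finset.range n, u (h k z)) w :=
      hmax.isLocalMax (mem_of_superset (Metric.isOpen_ball.mem_nhds (mem_ball_zero_iff.2 hlt))
        Metric.ball_subset_closedBall)
    have h1 := laplacian_nonpos_of_isLocalMax (hΔ n w hw).1 hloc
    rw [(hΔ n w hw).2] at h1
    exact absurd h1 (not_le.2 (Finset.sum_pos (fun k _ => hpos _ (hmem k w hw))
      ⟨0, Finset.mem_range.2 hn⟩))
  refine ⟨w.arg, ?_⟩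
  have h0 : ∑ k ∈ Finset.range n, u (h k 0) ≤ ∑ k ∈ Finset.range n, u (h k w) :=
    hmax (Metric.mem_closedBall_self hr.le : (0 : ℂ) ∈ Metric.closedBall 0 r)
  have e0 : ∑ k ∈ Finset.range n, u (h k 0) = n * u c := by simp [h]
  have e1 : ∀ k : ℕ, h k w = circleMap c r (w.arg + k * (2 * Real.pi / n)) := by
    intro k
    have : w = r * Complex.exp (w.arg * Complex.I) := by
      rw [← hwr, Complex.norm_mul_exp_arg_mul_I]
    simp only [h, circleMap, η]
    conv_lhs => rw [this]
    rw [mul_left_comm, ← Complex.exp_add]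
    push_cast
    ring_nf
  rw [← e0]
  simpa only [e1] using h0

/-- The sub-mean value property. -/
theorem le_circleAverage_of_laplacian_pos {u : ℂ → ℝ} {c : ℂ} {r : ℝ} (hr : 0 < r)
    (hu : ∀ z ∈ Metric.closedBall c r, ContDiffAt ℝ 2 u z)
    (hpos : ∀ z ∈ Metric.closedBall c r, 0 < Δ u z) : u c ≤ Real.circleAverage u c r := by
  refine le_of_forall_pos_sub_le fun ε hε => ?_
  have hmem : ∀ θ, circleMap c r θ ∈ Metric.closedBall c r :=
    fun θ => circleMap_mem_closedBall c hr.le θ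
  have hcont : Continuous fun θ : ℝ => u (circleMap c r θ) :=
    continuous_iff_continuousAt.2 fun θ =>
      ((hu _ (hmem θ)).continuousAt).comp (continuous_circleMap c r).continuousAt
  have huc : UniformContinuousOn u (Metric.closedBall c r) :=
    (isCompact_closedBall c r).uniformContinuousOn_of_continuous
      fun z hz => (hu z hz).continuousAt.continuousWithinAt
  obtain ⟨δ, hδ, hδu⟩ := Metric.uniformContinuousOn_iff.1 huc ε hε
  obtain ⟨n, hn⟩ := exists_nat_gt (r * (2 * Real.pi) / δ)
  have hn0 : 0 < n := by
    have : (0 : ℝ) < n := lt_of_le_of_lt (by positivity) hn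
    exact_mod_cast this
  have hn0' : (0 : ℝ) < n := by exact_mod_cast hn0
  obtain ⟨θ, hθ⟩ := exists_mem_sphere_le_sum_rotations hr hu hpos hn0
  set a : ℕ → ℝ := fun k => θ + k * (2 * Real.pi / n) with ha
  have hstep : ∀ k, a (k + 1) - a k = 2 * Real.pi / n := by
    intro k; simp only [ha]; push_cast; ring
  have hpiece : ∀ k, 2 * Real.pi / n * (u (circleMap c r (a k)) - ε) ≤
      ∫ t in a k..a (k + 1), u (circleMap c r t) := by
    intro k
    have hle : a k ≤ a (k + 1) := by
      have := hstep k
      have h2 : 0 < 2 * Real.pi / n := by positivity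
      linarith
    have h1 : ∫ _ in a k..a (k + 1), (u (circleMap c r (a k)) - ε) =
        2 * Real.pi / n * (u (circleMap c r (a k)) - ε) := by
      rw [intervalIntegral.integral_const, hstep, smul_eq_mul]
    rw [← h1]
    refine intervalIntegral.integral_mono_on hle (by simp) (hcont.intervalIntegrable _ _) ?_
    intro t ht
    have hd : dist (circleMap c r t) (circleMap c r (a k)) < δ := by
      have h3 := (lipschitzWith_circleMap c r).dist_le_mul t (a k)
      refine h3.trans_lt ?_
      have h4 : dist t (a k) ≤ 2 * Real.pi / n := by
        rw [Real.dist_eq, abs_of_nonneg (by linarith [ht.1]), ← hstep k]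
        linarith [ht.2]
      have h5 : ((Real.nnabs r : NNReal) : ℝ) = r := by simp [abs_of_pos hr]
      rw [h5]
      calc r * dist t (a k) ≤ r * (2 * Real.pi / n) := by gcongr
        _ < δ := by
          rw [div_lt_iff₀ hδ] at hn
          rw [← mul_div_assoc, div_lt_iff₀ hn0']
          linarith
    have h6 := hδu _ (hmem t) _ (hmem (a k)) hd
    rw [Real.dist_eq, abs_lt] at h6
    linarith [h6.1]
  have hsum : ∑ k ∈ Finset.range n, ∫ t in a k..a (k + 1), u (circleMap c r t) =
      ∫ t in a 0..a n, u (circleMap c r t) :=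
    intervalIntegral.sum_integral_adjacent_intervals fun k _ => hcont.intervalIntegrable _ _
  have hper : ∫ t in a 0..a n, u (circleMap c r t) = ∫ t in (0 : ℝ)..2 * Real.pi,
      u (circleMap c r t) := by
    have hp : Function.Periodic (fun t => u (circleMap c r t)) (2 * Real.pi) :=
      fun t => by simp [periodic_circleMap c r t]
    have h7 := hp.intervalIntegral_add_eq θ 0
    have h8 : a n = θ + 2 * Real.pi := by
      simp only [ha]; field_simp
    rw [h8]
    simpa [ha] using h7
  have htot := Finset.sum_le_sum fun k (_ : k ∈ Finset.range n) => hpiece k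
  rw [hsum, hper, ← Finset.mul_sum, Finset.sum_sub_distrib] at htot
  have h9 : 2 * Real.pi * (u c - ε) ≤ ∫ t in (0 : ℝ)..2 * Real.pi, u (circleMap c r t) := by
    refine le_trans ?_ htot
    rw [Finset.sum_const, Finset.card_range, nsmul_eq_mul]
    have h10 : 2 * Real.pi * (u c - ε) = 2 * Real.pi / n * (n * u c - n * ε) := by
      field_simp
    rw [h10]
    gcongr
  rw [Real.circleAverage_def, smul_eq_mul, ← div_eq_inv_mul, le_div_iff₀ (by positivity)]
  linarith

/-- Polar coordinates: the integral over the disc is the integral of `2π r` times the circle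
average. Area means, unlike circle means, can be compared between nested discs with different
centres. -/
theorem mul_le_integral_ball {u : ℂ → ℝ} {c : ℂ} {R a : ℝ} (hR : 0 < R)
    (hu : ContinuousOn u (Metric.closedBall c R))
    (ha : ∀ r ∈ Set.Ioo 0 R, a ≤ Real.circleAverage u c r) :
    Real.pi * R ^ 2 * a ≤ ∫ z in Metric.ball c R, u z := by
  set F : ℝ × ℝ → ℝ := fun p => p.1 * u (circleMap c p.1 p.2) with hF
  have hFc : ContinuousOn F (Set.Icc 0 R ×ˢ Set.Icc (-Real.pi) Real.pi) := by
    refine continuousOn_fst.mul (hu.comp ?_ ?_)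
    · simp only [circleMap]; fun_prop
    · rintro ⟨r, θ⟩ ⟨h1, -⟩
      exact Metric.closedBall_subset_closedBall h1.2 (circleMap_mem_closedBall c h1.1 θ)
  have hFi : IntegrableOn F (Set.Ioo 0 R ×ˢ Set.Ioo (-Real.pi) Real.pi) (volume.prod volume) :=
    (hFc.integrableOn_compact (isCompact_Icc.prod isCompact_Icc)).mono_set
      (Set.prod_mono Set.Ioo_subset_Icc_self Set.Ioo_subset_Icc_self)
  have h1 : ∫ z in Metric.ball c R, u z =
      ∫ p in Set.Ioo 0 R ×ˢ Set.Ioo (-Real.pi) Real.pi, F p ∂(volume.prod volume) := by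
    rw [← integral_indicator Metric.isOpen_ball.measurableSet,
      ← integral_add_left_eq_self _ c, ← Complex.integral_comp_polarCoord_symm]
    rw [← integral_indicator polarCoord.open_target.measurableSet,
      ← integral_indicator (measurableSet_Ioo.prod measurableSet_Ioo)]
    refine integral_congr_ae (Eventually.of_forall fun p => ?_)
    have hsymm : Complex.polarCoord.symm p = p.1 * Complex.exp (p.2 * Complex.I) := by
      rw [Complex.polarCoord_symm_apply, Complex.exp_mul_I]
      push_cast
      rfl
    by_cases hp : p ∈ Set.Ioo 0 R ×ˢ Set.Ioo (-Real.pi) Real.pi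
    · have hp' : p ∈ polarCoord.target := by
        rw [polarCoord_target]; exact ⟨hp.1.1, hp.2⟩
      rw [Set.indicator_of_mem hp, Set.indicator_of_mem hp', hsymm, Set.indicator_of_mem]
      · simp [F, circleMap]
      · have := hp.1
        rw [mem_ball_iff_norm, add_sub_cancel_left, norm_mul, Complex.norm_exp_ofReal_mul_I,
          mul_one, Complex.norm_real, Real.norm_eq_abs, abs_of_pos this.1]
        exact this.2
    · rw [Set.indicator_of_notMem hp]
      by_cases hp' : p ∈ polarCoord.target
      · rw [Set.indicator_of_mem hp', hsymm, Set.indicator_of_notMem, smul_zero]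
        rw [polarCoord_target] at hp'
        intro hb
        rw [mem_ball_iff_norm, add_sub_cancel_left, norm_mul, Complex.norm_exp_ofReal_mul_I,
          mul_one, Complex.norm_real, Real.norm_eq_abs, abs_of_pos hp'.1] at hb
        exact hp ⟨⟨hp'.1, hb⟩, hp'.2⟩
      · rw [Set.indicator_of_notMem hp']
  rw [h1, setIntegral_prod _ hFi]
  have hFi' : Integrable F ((volume.restrict (Set.Ioo 0 R)).prod
      (volume.restrict (Set.Ioo (-Real.pi) Real.pi))) := by
    rw [Measure.prod_restrict]; exact hFi
  have h2 : ∀ r ∈ Set.Ioo 0 R, 2 * Real.pi * a * r ≤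
      ∫ θ in Set.Ioo (-Real.pi) Real.pi, F (r, θ) := by
    intro r hr
    have h3 := ha r hr
    have h4 : Real.circleAverage u c r =
        (2 * Real.pi)⁻¹ * ∫ θ in Set.Ioo (-Real.pi) Real.pi, u (circleMap c r θ) := by
      have hp : Function.Periodic (fun t => u (circleMap c r t)) (2 * Real.pi) :=
        fun t => by simp [periodic_circleMap c r t]
      have h7 := hp.intervalIntegral_add_eq (-Real.pi) 0
      rw [zero_add, show -Real.pi + 2 * Real.pi = Real.pi by ring] at h7
      rw [Real.circleAverage_def, ← h7, intervalIntegral.integral_of_le (by linarith [Real.pi_pos]),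
        integral_Ioc_eq_integral_Ioo, smul_eq_mul]
    rw [h4, ← div_eq_inv_mul, le_div_iff₀ (by positivity)] at h3
    simp only [F]
    rw [integral_const_mul]
    nlinarith [hr.1]
  have h5 : ∫ r in Set.Ioo 0 R, 2 * Real.pi * a * r = Real.pi * R ^ 2 * a := by
    rw [← integral_Ioc_eq_integral_Ioo, ← intervalIntegral.integral_of_le hR.le,
      intervalIntegral.integral_const_mul, integral_id]
    ring
  rw [← h5]
  refine setIntegral_mono_on ?_ hFi'.integral_prod_left measurableSet_Ioo h2
  exact ((continuous_const.mul continuous_id).integrableOn_Icc (a := 0) (b := R)).mono_set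
    Set.Ioo_subset_Icc_self

/-- A Harnack inequality for positive functions with bounded negative Laplacian. -/
theorem harnack_of_laplacian_bounds {s : ℂ → ℝ} {c₀ c₁ : ℂ} {R₀ R₁ : ℝ} (hR₁ : 0 < R₁)
    (hsub : Metric.closedBall c₁ R₁ ⊆ Metric.closedBall c₀ R₀) (hR₀ : 0 < R₀)
    (hs : ∀ z ∈ Metric.closedBall c₀ R₀, ContDiffAt ℝ 2 s z)
    (hs0 : ∀ z ∈ Metric.closedBall c₀ R₀, 0 ≤ s z)
    (hΔ : ∀ z ∈ Metric.closedBall c₀ R₀, Δ s z < 0)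
    (hΔ' : ∀ z ∈ Metric.closedBall c₀ R₀, -2 < Δ s z) :
    R₁ ^ 2 * s c₁ ≤ R₀ ^ 2 * s c₀ + R₁ ^ 4 / 2 := by
  have hcont : ContinuousOn s (Metric.closedBall c₀ R₀) :=
    fun z hz => (hs z hz).continuousAt.continuousWithinAt
  -- `s` is superharmonic, so its mean over the large disc is at most `s c₀`.
  have hupper : Real.pi * R₀ ^ 2 * (-s c₀) ≤ ∫ z in Metric.ball c₀ R₀, -s z := by
    refine mul_le_integral_ball hR₀ hcont.neg fun r hr => ?_
    have hsub' := Metric.closedBall_subset_closedBall (x := c₀) hr.2.le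
    refine le_circleAverage_of_laplacian_pos (u := fun z => -s z) hr.1
      (fun z hz => (hs z (hsub' hz)).neg) fun z hz => ?_
    rw [show (fun z => -s z) = -s from rfl, laplacian_neg]
    simpa using hΔ z (hsub' hz)
  -- Adding `|z - c₁|² / 2`, whose Laplacian is `2`, makes `s` subharmonic; the correction is at
  -- most `R₁² / 2` on each circle.
  have hlower : Real.pi * R₁ ^ 2 * (s c₁ - R₁ ^ 2 / 2) ≤ ∫ z in Metric.ball c₁ R₁, s z := by
    refine mul_le_integral_ball hR₁ (hcont.mono hsub) fun r hr => ?_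
    have hsub' := (Metric.closedBall_subset_closedBall (x := c₁) hr.2.le).trans hsub
    set q : ℂ → ℝ := fun z => ‖z - c₁‖ ^ 2 / 2 with hqdef
    have hq : ∀ z : ℂ, ContDiffAt ℝ 2 q z := fun z =>
      ((contDiffAt_id.sub contDiffAt_const).norm_sq ℝ).div_const 2
    have hqΔ : ∀ z : ℂ, Δ q z = 2 := by
      intro z
      have hline : ∀ b d : ℝ, HasDerivAt (deriv fun s : ℝ => (d + 2 * b * s + s ^ 2) / 2) 1 0 := by
        intro b d
        have h1 : (deriv fun s : ℝ => (d + 2 * b * s + s ^ 2) / 2) = fun s => b + s := by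
          funext s
          have h2 := ((((hasDerivAt_id s).const_mul (2 * b)).const_add d).add
            (hasDerivAt_pow 2 s)).div_const 2
          have h3 : HasDerivAt (fun s : ℝ => (d + 2 * b * s + s ^ 2) / 2) (b + s) s := by
            refine (h2.congr_deriv (by simp; ring)).congr_of_eventuallyEq
              (Eventually.of_forall fun t => by simp)
          exact h3.deriv
        rw [h1]
        simpa using (hasDerivAt_id (0 : ℝ)).const_add b
      have h1 := hline (z - c₁).re (‖z - c₁‖ ^ 2)
      have h2 := hline (z - c₁).im (‖z - c₁‖ ^ 2)
      have e1 : (fun s : ℝ => (‖z - c₁‖ ^ 2 + 2 * (z - c₁).re * s + s ^ 2) / 2) =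
          fun s : ℝ => ‖z + s - c₁‖ ^ 2 / 2 := by
        funext s
        rw [← Complex.normSq_eq_norm_sq, ← Complex.normSq_eq_norm_sq, Complex.normSq_apply,
          Complex.normSq_apply]
        simp
        ring_nf
      have e2 : (fun s : ℝ => (‖z - c₁‖ ^ 2 + 2 * (z - c₁).im * s + s ^ 2) / 2) =
          fun s : ℝ => ‖z + s * Complex.I - c₁‖ ^ 2 / 2 := by
        funext s
        rw [← Complex.normSq_eq_norm_sq, ← Complex.normSq_eq_norm_sq, Complex.normSq_apply,
          Complex.normSq_apply]
        simp
        ring_nf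
      rw [e1] at h1
      rw [e2] at h2
      rw [laplacian_eq_of_lines (hq z) h1 h2]
      norm_num
    have h1 : s c₁ + ‖c₁ - c₁‖ ^ 2 / 2 ≤
        Real.circleAverage (s + q) c₁ r := by
      refine le_circleAverage_of_laplacian_pos (u := s + q) hr.1
        (fun z hz => (hs z (hsub' hz)).add (hq z)) fun z hz => ?_
      rw [(hs z (hsub' hz)).laplacian_add (hq z), hqΔ]
      linarith [hΔ' z (hsub' hz)]
    have hci : CircleIntegrable s c₁ r :=
      ContinuousOn.circleIntegrable hr.1.le
        (hcont.mono (Metric.sphere_subset_closedBall.trans hsub'))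
    have hci' : CircleIntegrable q c₁ r :=
      ContinuousOn.circleIntegrable hr.1.le (by fun_prop)
    rw [Real.circleAverage_add hci hci', Real.circleAverage_const_on_circle (f := q) (a := r ^ 2 / 2)
      (fun z hz => by
        rw [abs_of_pos hr.1] at hz
        simp only [q]
        rw [mem_sphere_iff_norm.1 hz])] at h1
    have h2 : r ^ 2 ≤ R₁ ^ 2 := by
      have := hr.1; have := hr.2; gcongr
    simp at h1
    linarith
  have hball : Metric.ball c₁ R₁ ⊆ Metric.ball c₀ R₀ := by
    have := interior_mono hsub
    rwa [interior_closedBall _ hR₁.ne', interior_closedBall _ hR₀.ne'] at this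
  have hmono : ∫ z in Metric.ball c₁ R₁, s z ≤ ∫ z in Metric.ball c₀ R₀, s z := by
    refine setIntegral_mono_set ((hcont.integrableOn_compact (isCompact_closedBall _ _)).mono_set
      Metric.ball_subset_closedBall) ?_ hball.eventuallyLE
    exact (ae_restrict_mem Metric.isOpen_ball.measurableSet).mono
      fun z hz => hs0 z (Metric.ball_subset_closedBall hz)
  rw [integral_neg] at hupper
  have h := hlower.trans hmono
  have : Real.pi * (R₁ ^ 2 * s c₁) ≤ Real.pi * (R₀ ^ 2 * s c₀ + R₁ ^ 4 / 2) := by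
    nlinarith
  exact le_of_mul_le_mul_left this Real.pi_pos

end PuncturedSphere

namespace PuncturedSphere

open InnerProductSpace Laplacian

/-! ### Comparison of conformal metrics of curvature `-1` -/

theorem IsLiouvilleOn.nonpos_of_one_le_im {φ : ℂ → ℝ} (hφ : IsLiouvilleOn φ {z | 0 < z.im}) {z : ℂ}
    (hz : 1 ≤ z.im) : φ z ≤ 0 := by
  have h1 := hφ.le_neg_log_im (lt_of_lt_of_le one_pos hz)
  have h2 := Real.log_nonneg hz
  linarith

/-- If `-φ` exceeded `δ t` for all large `t`, the length of the vertical ray would be dominated by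
an integral of `exp (-δ t)`. On the initial segment, where nothing is assumed, `φ ≤ 0` suffices
after multiplying the majorant by `exp (δ S)`. -/
theorem exists_gt_neg_le_of_lintegral_eq_top {φ : ℂ → ℝ} (hφ : IsLiouvilleOn φ {z | 0 < z.im})
    (hinf : ∫⁻ t in Set.Ioi (1 : ℝ), ENNReal.ofReal (Real.exp (φ (t * Complex.I))) = ⊤)
    {δ : ℝ} (hδ : 0 < δ) (T : ℝ) : ∃ t > T, -φ (t * Complex.I) ≤ δ * t := by
  by_contra! hcon
  set S := max T 0
  have hle : ∀ t ∈ Set.Ioi (1 : ℝ), ENNReal.ofReal (Real.exp (φ (t * Complex.I))) ≤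
      ENNReal.ofReal (Real.exp (δ * S) * Real.exp (-δ * t)) := by
    intro t ht
    refine ENNReal.ofReal_le_ofReal ?_
    rw [← Real.exp_add]
    refine Real.exp_le_exp.2 ?_
    rcases le_or_gt t S with h | h
    · have h1 : φ (t * Complex.I) ≤ 0 := hφ.nonpos_of_one_le_im (by simpa using (le_of_lt ht))
      nlinarith
    · have h1 := hcon t ((le_max_left _ _).trans_lt h)
      have h2 : 0 ≤ δ * S := mul_nonneg hδ.le (le_max_right _ _)
      linarith
  have hint : IntegrableOn (fun t : ℝ => Real.exp (δ * S) * Real.exp (-δ * t)) (Set.Ioi 1) :=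
    (exp_neg_integrableOn_Ioi 1 hδ).const_mul _
  have hlt : ∫⁻ t in Set.Ioi (1 : ℝ), ENNReal.ofReal (Real.exp (δ * S) * Real.exp (-δ * t)) < ⊤ :=
    (hasFiniteIntegral_iff_ofReal (Eventually.of_forall fun t => by positivity)).1 hint.2
  exact absurd hinf ((setLIntegral_mono' measurableSet_Ioi hle).trans_lt hlt).ne

/-- In a cusp, a complete metric of curvature `-1` dominates every other one, up to the minimum of
their quotient on a horocycle. -/
theorem cusp_comparison {φ₁ φ₂ : ℂ → ℝ} (h₁ : IsLiouvilleOn φ₁ {z | 0 < z.im})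
    (h₂ : IsLiouvilleOn φ₂ {z | 0 < z.im}) (p₁ : Function.Periodic φ₁ (2 * Real.pi : ℝ))
    (p₂ : Function.Periodic φ₂ (2 * Real.pi : ℝ))
    (hinf : ∫⁻ t in Set.Ioi (1 : ℝ), ENNReal.ofReal (Real.exp (φ₂ (t * Complex.I))) = ⊤)
    {m : ℝ} (hm : m ≤ 0) (hm' : ∀ z : ℂ, z.im = 1 → m ≤ φ₂ z - φ₁ z) {z : ℂ} (hz : 1 ≤ z.im) :
    m ≤ φ₂ z - φ₁ z := by
  by_contra! hlt
  obtain ⟨κ, hκ, hκz⟩ : ∃ κ > 0, φ₂ z - φ₁ z < m - κ * (z.im - 1) := by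
    have hc : Tendsto (fun κ : ℝ => m - κ * (z.im - 1)) (𝓝[>] 0) (𝓝 (m - 0 * (z.im - 1))) := by
      refine Tendsto.mono_left ?_ nhdsWithin_le_nhds
      exact Continuous.tendsto (by fun_prop) 0
    have := (hc.eventually_const_lt (u := φ₂ z - φ₁ z) (by linarith)).and self_mem_nhdsWithin
    obtain ⟨κ, h1, h2⟩ := this.exists
    exact ⟨κ, h2, h1⟩
  -- The Harnack inequality with radii `8` and `4` yields `-φ₂ w ≤ 4 (-φ₂ (it)) + 8 ≤ κ t / 2 + 8`
  -- on one period of the horocycle. The last threshold on `t` makes this at most `κ (t - 1)`; `t >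
  -- 9` keeps the disc of radius `8` in `Im ≥ 1`, where `φ₂ ≤ 0`.
  obtain ⟨t, ht, hts⟩ := exists_gt_neg_le_of_lintegral_eq_top h₂ hinf (δ := κ / 8) (by positivity)
    (max (max 9 z.im) ((8 + κ) * 2 / κ))
  have ht9 : 9 < t := (le_max_left _ _).trans_lt ((le_max_left _ _).trans_lt ht)
  have htz : z.im < t := (le_max_right _ _).trans_lt ((le_max_left _ _).trans_lt ht)
  have htκ : (8 + κ) * 2 < t * κ := by
    have := (le_max_right _ _).trans_lt ht
    rwa [div_lt_iff₀ hκ] at this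
  have hharnack : ∀ w : ℂ, w.im = t → |w.re| ≤ Real.pi → -φ₂ w ≤ κ * (t - 1) := by
    intro w hwt hwr
    have hbig : ∀ y ∈ Metric.closedBall (t * Complex.I : ℂ) 8, 1 ≤ y.im := by
      intro y hy
      have h1 := (Complex.abs_im_le_norm (y - t * Complex.I)).trans (mem_closedBall_iff_norm.1 hy)
      rw [abs_le] at h1
      simp at h1
      linarith [h1.1]
    have hbig' : ∀ y ∈ Metric.closedBall (t * Complex.I : ℂ) 8, y ∈ {z : ℂ | 0 < z.im} :=
      fun y hy => lt_of_lt_of_le one_pos (hbig y hy)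
    have hsub : Metric.closedBall w 4 ⊆ Metric.closedBall (t * Complex.I : ℂ) 8 := by
      refine Metric.closedBall_subset_closedBall' ?_
      have : w - t * Complex.I = (w.re : ℂ) := by apply Complex.ext <;> simp [hwt]
      rw [dist_eq_norm, this, Complex.norm_real, Real.norm_eq_abs]
      linarith [Real.pi_le_four]
    have hΔ : ∀ y ∈ Metric.closedBall (t * Complex.I : ℂ) 8,
        Δ (-φ₂) y = -Real.exp (2 * φ₂ y) := by
      intro y hy
      rw [laplacian_neg, Pi.neg_apply, h₂.2 y (hbig' y hy)]
    have h := harnack_of_laplacian_bounds (s := -φ₂) (by norm_num) hsub (by norm_num)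
      (fun y hy => (h₂.1 y (hbig' y hy)).neg)
      (fun y hy => neg_nonneg.2 (h₂.nonpos_of_one_le_im (hbig y hy)))
      (fun y hy => by rw [hΔ y hy]; exact neg_lt_zero.2 (Real.exp_pos _))
      (fun y hy => by
        have : Real.exp (2 * φ₂ y) ≤ 1 :=
          Real.exp_le_one_iff.2 (by linarith [h₂.nonpos_of_one_le_im (hbig y hy)])
        rw [hΔ y hy]; linarith)
    simp only [Pi.neg_apply] at h
    nlinarith
  -- A harmonic barrier. `W = φ₂ - φ₁ + ℓ` is nonnegative on the line `Im = 1` by the choice of `m`,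
  -- and on the line `Im = t` by the Harnack bound together with `φ₁ ≤ 0` and `m ≤ 0`. A negative
  -- minimum would thus be interior, where `Δ W = exp (2 φ₂) - exp (2 φ₁) ≥ 0` forces `φ₁ ≤ φ₂` and
  -- hence `W ≥ 0`.
  set ℓ : ℂ → ℝ := fun y => (κ * (y - Complex.I) - m * Complex.I : ℂ).im with hℓ
  have hℓ' : ∀ y, ℓ y = κ * (y.im - 1) - m := by intro y; simp [ℓ]
  have hℓharm : ∀ y, HarmonicAt ℓ y := fun y =>
    AnalyticAt.harmonicAt_im (f := fun y : ℂ => κ * (y - Complex.I) - m * Complex.I) (by fun_prop)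
  set W : ℂ → ℝ := (φ₂ - φ₁) + ℓ with hW
  have hW' : ∀ y, W y = φ₂ y - φ₁ y + (κ * (y.im - 1) - m) := fun y => by
    simp only [W, Pi.add_apply, Pi.sub_apply, hℓ']
  have hsmooth : ∀ y : ℂ, 0 < y.im → ContDiffAt ℝ 2 W y := fun y hy =>
    ((h₂.1 y hy).sub (h₁.1 y hy)).add (hℓharm y).1
  set K : Set ℂ := Set.Icc (-Real.pi) Real.pi ×ℂ Set.Icc 1 t with hK
  have hKc : IsCompact K := isCompact_Icc.reProdIm isCompact_Icc
  -- By periodicity a minimum over the compact rectangle `K` is a minimum over the whole strip, so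
  -- the vertical sides of `K` need no separate treatment.
  have hmove : ∀ y : ℂ, 1 ≤ y.im → y.im ≤ t → ∃ y' ∈ K, W y' = W y := by
    intro y hy1 hy2
    set n : ℤ := toIcoDiv Real.two_pi_pos (-Real.pi) y.re
    have hmod := toIcoMod_mem_Ico Real.two_pi_pos (-Real.pi) y.re
    rw [toIcoMod, zsmul_eq_mul] at hmod
    refine ⟨y - n * (2 * Real.pi : ℝ), ⟨?_, ?_⟩, ?_⟩
    · simp only [Set.mem_preimage]
      have : (y - n * (2 * Real.pi : ℝ) : ℂ).re = y.re - n * (2 * Real.pi) := by simp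
      rw [this]
      exact ⟨hmod.1, by linarith [hmod.2]⟩
    · simp only [Set.mem_preimage]
      have : (y - n * (2 * Real.pi : ℝ) : ℂ).im = y.im := by simp
      rw [this]
      exact ⟨hy1, hy2⟩
    · rw [hW', hW', p₁.sub_int_mul_eq, p₂.sub_int_mul_eq]
      simp
  obtain ⟨z', hz'K, hz'W⟩ := hmove z hz htz.le
  obtain ⟨y, hyK, hymin⟩ := hKc.exists_isMinOn ⟨z', hz'K⟩
    (f := W) fun y hy => (hsmooth y (lt_of_lt_of_le one_pos hy.2.1)).continuousAt.continuousWithinAt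
  have hWz : W z < 0 := by rw [hW']; linarith
  have hWy : W y < 0 := lt_of_le_of_lt (hymin hz'K) (hz'W ▸ hWz)
  have hyim : 1 ≤ y.im ∧ y.im ≤ t := hyK.2
  have hyre : |y.re| ≤ Real.pi := abs_le.2 hyK.1
  have hy1 : 1 < y.im := by
    refine lt_of_le_of_ne hyim.1 fun h => ?_
    have := hm' y h.symm
    rw [hW', ← h] at hWy
    linarith
  have hφ₁y : φ₁ y ≤ 0 := h₁.nonpos_of_one_le_im hy1.le
  have hy2 : y.im < t := by
    refine lt_of_le_of_ne hyim.2 fun h => ?_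
    have := hharnack y h hyre
    rw [hW', h] at hWy
    linarith
  have hy0 : 0 < y.im := one_pos.trans hy1
  have hloc : IsLocalMin W y := by
    have hopen : IsOpen {w : ℂ | 1 < w.im ∧ w.im < t} :=
      (isOpen_lt continuous_const Complex.continuous_im).inter
        (isOpen_lt Complex.continuous_im continuous_const)
    filter_upwards [hopen.mem_nhds ⟨hy1, hy2⟩] with w hw
    obtain ⟨w', hw'K, hw'W⟩ := hmove w hw.1.le hw.2.le
    rw [← hw'W]
    exact hymin hw'K
  have hlap := laplacian_nonneg_of_isLocalMin (hsmooth y hy0) hloc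
  have hsub : ContDiffAt ℝ 2 (φ₂ - φ₁) y := (h₂.1 y hy0).sub (h₁.1 y hy0)
  rw [hW, hsub.laplacian_add (hℓharm y).1,
    (h₂.1 y hy0).laplacian_sub (h₁.1 y hy0), (hℓharm y).2.eq_of_nhds, h₁.2 y hy0, h₂.2 y hy0] at hlap
  have hle : 2 * φ₁ y ≤ 2 * φ₂ y := Real.exp_le_exp.1 (by simpa using hlap)
  rw [hW'] at hWy
  have : 0 ≤ κ * (y.im - 1) := mul_nonneg hκ.le (by linarith)
  linarith

/-- The comparison in a cusp parametrized by the upper half plane. -/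
theorem exists_isCompact_lower_bound_of_cusp {φ₁ φ₂ : ℂ → ℝ} {U : Set ℂ} {h : ℂ → ℂ}
    (h₁ : IsLiouvilleOn φ₁ U) (h₂ : IsLiouvilleOn φ₂ U) (hh : ∀ z, AnalyticAt ℂ h z)
    (hh' : ∀ z, deriv h z ≠ 0) (hU : ∀ z : ℂ, 0 < z.im → h z ∈ U)
    (hp : Function.Periodic h (2 * Real.pi : ℝ))
    (hinf : ∫⁻ t in Set.Ioi (1 : ℝ),
      ENNReal.ofReal (Real.exp (φ₂ (h (t * Complex.I))) * ‖deriv h (t * Complex.I)‖) = ⊤) :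
    ∃ C : Set ℂ, IsCompact C ∧ C ⊆ U ∧ ∀ z : ℂ, 1 ≤ z.im →
      0 ≤ φ₂ (h z) - φ₁ (h z) ∨ ∃ c ∈ C, φ₂ c - φ₁ c ≤ φ₂ (h z) - φ₁ (h z) := by
  set S : Set ℂ := Set.Icc (-Real.pi) Real.pi ×ℂ Set.Icc 1 1
  have hS : IsCompact S := isCompact_Icc.reProdIm isCompact_Icc
  have hSU : h '' S ⊆ U := by
    rintro _ ⟨z, hz, rfl⟩
    exact hU z (lt_of_lt_of_le one_pos hz.2.1)
  have hcont : Continuous h := continuous_iff_continuousAt.2 fun z => (hh z).continuousAt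
  have hC : IsCompact (h '' S) := hS.image hcont
  obtain ⟨c, hc, hmin⟩ := hC.exists_isMinOn (f := fun w => φ₂ w - φ₁ w)
    ⟨h Complex.I, Complex.I, by
      simp [S, Complex.mem_reProdIm, Real.pi_pos.le], rfl⟩
    fun w hw => ((h₂.1 w (hSU hw)).sub (h₁.1 w (hSU hw))).continuousAt.continuousWithinAt
  refine ⟨h '' S, hC, hSU, fun z hz => ?_⟩
  have hder : Function.Periodic (fun z => Real.log ‖deriv h z‖) (2 * Real.pi : ℝ) := by
    intro z
    have : deriv h (z + (2 * Real.pi : ℝ)) = deriv h z := by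
      rw [← deriv_comp_add_const]
      congr 1
      exact funext hp
    simp only [this]
  have hper : ∀ φ : ℂ → ℝ,
      Function.Periodic (fun z => φ (h z) + Real.log ‖deriv h z‖) (2 * Real.pi : ℝ) := by
    intro φ z
    have := hder z
    simp only at this
    simp only [hp z, this]
  have hl : ∀ {φ : ℂ → ℝ}, IsLiouvilleOn φ U →
      IsLiouvilleOn (fun z => φ (h z) + Real.log ‖deriv h z‖) {z | 0 < z.im} := fun hφ =>
    hφ.comp (fun z _ => hh z) hU fun z _ => hh' z
  have hkey := cusp_comparison (hl h₁) (hl h₂) (hper φ₁) (hper φ₂) (m := min 0 (φ₂ c - φ₁ c))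
    (z := z) ?_ (min_le_left _ _) ?_ hz
  · simp only [add_sub_add_right_eq_sub] at hkey
    rcases min_le_iff.1 hkey with h | h
    · exact Or.inl h
    · exact Or.inr ⟨c, hc, h⟩
  · rw [← hinf]
    refine lintegral_congr fun t => ?_
    rw [Real.exp_add, Real.exp_log (norm_pos_iff.2 (hh' _))]
  · intro w hw
    simp only [add_sub_add_right_eq_sub]
    refine (min_le_right _ _).trans ?_
    set n : ℤ := toIcoDiv Real.two_pi_pos (-Real.pi) w.re
    have hmod := toIcoMod_mem_Ico Real.two_pi_pos (-Real.pi) w.re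
    rw [toIcoMod, zsmul_eq_mul] at hmod
    rw [← hp.sub_int_mul_eq n (x := w)]
    refine hmin ⟨_, ⟨?_, ?_⟩, rfl⟩
    · simp only [Set.mem_preimage]
      have : (w - n * (2 * Real.pi : ℝ) : ℂ).re = w.re - n * (2 * Real.pi) := by simp
      rw [this]
      exact ⟨hmod.1, by linarith [hmod.2]⟩
    · simp [hw]

theorem lintegral_Ioi_one_eq_Ioi_zero (f : ℝ → ENNReal) :
    ∫⁻ t in Set.Ioi (1 : ℝ), f t = ∫⁻ t in Set.Ioi (0 : ℝ), f (t + 1) := by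
  rw [← lintegral_indicator measurableSet_Ioi, ← lintegral_indicator measurableSet_Ioi,
    ← lintegral_add_right_eq_self _ (1 : ℝ)]
  refine lintegral_congr fun t => ?_
  simp [Set.indicator_apply]

/-- Every curve in the complement of `E ∪ {0}` that converges to a point of `E` or to infinity has
infinite length for the metric `exp φ |dw|`. -/
def HasInfiniteEnds (E : Set ℂ) (φ : ℂ → ℝ) : Prop :=
  ∀ γ : ℝ → ℂ, ContDiff ℝ 1 γ → (∀ t, 0 ≤ t → γ t ∉ E ∧ γ t ≠ 0) →
    ((∃ p ∈ E, Tendsto γ atTop (𝓝 p)) ∨ Tendsto γ atTop (Bornology.cobounded ℂ)) →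
    ∫⁻ t in Set.Ioi (0 : ℝ), ENNReal.ofReal (Real.exp (φ (γ t)) * ‖deriv γ t‖) = ⊤

/-- Both kinds of ends are covered by the half plane through an exponential: `ε = 1` gives a
punctured disc about `a`, `ε = -1` the exterior of a disc. The vertical ray maps to a radial curve
running into the puncture or to infinity, whose length is infinite by hypothesis. -/
theorem exists_isCompact_lower_bound_of_ends {φ₁ φ₂ : ℂ → ℝ} {E : Set ℂ}
    (h₁ : IsLiouvilleOn φ₁ Eᶜ) (h₂ : IsLiouvilleOn φ₂ Eᶜ) (hc : HasInfiniteEnds E φ₂)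
    {a : ℂ} {r : ℝ} (hr : 0 < r) {ε : ℂ} (hε : ε = 1 ∨ ε = -1)
    (hU : ∀ z : ℂ, 0 < z.im → a + r * Complex.exp (ε * (z * Complex.I)) ∉ E ∧
      a + r * Complex.exp (ε * (z * Complex.I)) ≠ 0)
    (hlim : (ε = 1 ∧ a ∈ E) ∨ ε = -1) :
    ∃ C : Set ℂ, IsCompact C ∧ C ⊆ Eᶜ ∧
      ∀ z : ℂ, 1 ≤ z.im → ∀ w, w = a + r * Complex.exp (ε * (z * Complex.I)) →
        0 ≤ φ₂ w - φ₁ w ∨ ∃ c ∈ C, φ₂ c - φ₁ c ≤ φ₂ w - φ₁ w := by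
  have hε0 : ε ≠ 0 := by rcases hε with rfl | rfl <;> simp
  set h : ℂ → ℂ := fun z => a + r * Complex.exp (ε * (z * Complex.I)) with hh
  have hd : ∀ z, HasDerivAt h (r * (Complex.exp (ε * (z * Complex.I)) * (ε * (1 * Complex.I)))) z :=
    fun z => ((((hasDerivAt_id z).mul_const Complex.I).const_mul ε).cexp.const_mul (r : ℂ)).const_add a
  have hp : Function.Periodic h (2 * Real.pi : ℝ) := by
    intro z
    simp only [h]
    have : ε * ((z + (2 * Real.pi : ℝ)) * Complex.I) =
        ε * (z * Complex.I) + ε * (2 * Real.pi * Complex.I) := by push_cast; ring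
    rw [this, Complex.exp_add]
    have : Complex.exp (ε * (2 * Real.pi * Complex.I)) = 1 := by
      rcases hε with rfl | rfl
      · simp
      · rw [neg_one_mul, Complex.exp_neg, Complex.exp_two_pi_mul_I, inv_one]
    rw [this, mul_one]
  have hinf : ∫⁻ t in Set.Ioi (1 : ℝ),
      ENNReal.ofReal (Real.exp (φ₂ (h (t * Complex.I))) * ‖deriv h (t * Complex.I)‖) = ⊤ := by
    rw [lintegral_Ioi_one_eq_Ioi_zero]
    set γ : ℝ → ℂ := fun t => h ((t + 1 : ℝ) * Complex.I) with hγ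
    have hγd : ∀ t, HasDerivAt γ (deriv h ((t + 1 : ℝ) * Complex.I) * Complex.I) t := by
      intro t
      have h1 : HasDerivAt (fun t : ℝ => ((t + 1 : ℝ) : ℂ) * Complex.I) (1 * Complex.I) t :=
        (((hasDerivAt_id t).add_const (1 : ℝ)).ofReal_comp).mul_const Complex.I
      rw [one_mul] at h1
      have h2 : HasDerivAt h (deriv h ((t + 1 : ℝ) * Complex.I)) ((t + 1 : ℝ) * Complex.I) := by
        rw [(hd _).deriv]; exact hd _
      exact HasDerivAt.comp (h₂ := h) (h := fun t : ℝ => ((t + 1 : ℝ) : ℂ) * Complex.I) t h2 h1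
    have hγn : ∀ t, ‖deriv γ t‖ = ‖deriv h ((t + 1 : ℝ) * Complex.I)‖ := by
      intro t
      rw [(hγd t).deriv, norm_mul, Complex.norm_I, mul_one]
    have hγe : ∀ t : ℝ, γ t = a + r * Complex.exp ((-ε) * ((t + 1 : ℝ) : ℂ)) := by
      intro t
      have : ε * (((t + 1 : ℝ) : ℂ) * Complex.I * Complex.I) = -ε * ((t + 1 : ℝ) : ℂ) := by
        rw [mul_assoc, Complex.I_mul_I]; ring
      simp only [γ, h, this]
    have hγc : ContDiff ℝ 1 γ := by
      rw [show γ = fun t : ℝ => a + r * Complex.exp ((-ε) * ((t + 1 : ℝ) : ℂ)) from funext hγe]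
      have h1 : ContDiff ℝ 1 fun t : ℝ => ((t + 1 : ℝ) : ℂ) :=
        Complex.ofRealCLM.contDiff.comp (contDiff_id.add contDiff_const)
      exact contDiff_const.add (contDiff_const.mul ((contDiff_const.mul h1).cexp))
    have hres := hc γ hγc (fun t ht => hU _ (by simp; linarith)) ?_
    · rw [← hres]
      refine lintegral_congr fun t => ?_
      rw [hγn t]
    · have hnorm : ∀ t, ‖γ t - a‖ = r * Real.exp ((-ε).re * (t + 1)) := by
        intro t
        rw [hγe, add_sub_cancel_left, norm_mul, Complex.norm_exp, Complex.re_mul_ofReal,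
          Complex.norm_real, Real.norm_eq_abs, abs_of_pos hr]
      have hto : Tendsto (fun t : ℝ => t + 1) atTop atTop := tendsto_atTop_add_const_right _ _ tendsto_id
      rcases hlim with ⟨rfl, ha⟩ | rfl
      · left
        refine ⟨a, ha, tendsto_iff_norm_sub_tendsto_zero.2 ?_⟩
        simp only [hnorm]
        have h1 := (Real.tendsto_exp_neg_atTop_nhds_zero.comp hto).const_mul r
        simpa [Function.comp_def] using h1
      · right
        have h1 : Tendsto (fun t => ‖γ t - a‖) atTop atTop := by
          simp only [hnorm]
          simpa using (Real.tendsto_exp_atTop.comp hto).const_mul_atTop hr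
        have h2 : Tendsto (fun t => γ t - a) atTop (Bornology.cobounded ℂ) :=
          tendsto_norm_atTop_iff_cobounded.1 h1
        have h3 := (tendsto_add_const_cobounded a).comp h2
        simpa [Function.comp_def] using h3
  obtain ⟨C, hC, hCE, hb⟩ := exists_isCompact_lower_bound_of_cusp h₁ h₂ (h := h)
    (fun z => by fun_prop) (fun z => by
      rw [(hd z).deriv]
      simp [hr.ne', hε0, Complex.exp_ne_zero])
    (fun z hz => (hU z hz).1) hp hinf
  exact ⟨C, hC, hCE, fun z hz w hw => by rw [hw]; exact hb z hz⟩

/-- A metric of curvature `-1` on the complement of a finite set, complete at all punctures,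
dominates every metric of curvature `-1`. -/
theorem le_of_hasInfiniteEnds {φ₁ φ₂ : ℂ → ℝ} {E : Set ℂ} (hE : E.Finite)
    (h₁ : IsLiouvilleOn φ₁ Eᶜ) (h₂ : IsLiouvilleOn φ₂ Eᶜ) (hc : HasInfiniteEnds E φ₂) {w : ℂ}
    (hw : w ∉ E) : φ₁ w ≤ φ₂ w := by
  have hpunct : ∀ p ∈ E, ∃ ρ > 0, ∃ C : Set ℂ, IsCompact C ∧ C ⊆ Eᶜ ∧
      ∀ w ∈ Metric.ball p ρ, w ≠ p →
        0 ≤ φ₂ w - φ₁ w ∨ ∃ c ∈ C, φ₂ c - φ₁ c ≤ φ₂ w - φ₁ w := by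
    intro p hp
    have hfin : ((E ∪ {0}) \ {p}).Finite := (hE.union (Set.finite_singleton 0)).sdiff
    obtain ⟨r, hr, hball⟩ := Metric.isOpen_iff.1 hfin.isClosed.isOpen_compl p (by simp)
    have hU : ∀ z : ℂ, 0 < z.im → p + r * Complex.exp (1 * (z * Complex.I)) ∉ E ∧
        p + r * Complex.exp (1 * (z * Complex.I)) ≠ 0 := by
      intro z hz
      set y := p + r * Complex.exp (1 * (z * Complex.I)) with hy
      have hn : ‖y - p‖ = r * Real.exp (-z.im) := by
        rw [hy, add_sub_cancel_left, norm_mul, Complex.norm_exp, Complex.norm_real,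
          Real.norm_eq_abs, abs_of_pos hr]
        simp
      have hlt : y ∈ Metric.ball p r := by
        rw [mem_ball_iff_norm, hn]
        have : Real.exp (-z.im) < 1 := Real.exp_lt_one_iff.2 (by linarith)
        nlinarith
      have hyp : y ≠ p := by
        intro h
        rw [h, sub_self, norm_zero] at hn
        exact (mul_pos hr (Real.exp_pos _)).ne hn
      have := hball hlt
      simp only [Set.mem_compl_iff, Set.mem_sdiff, Set.mem_union, Set.mem_singleton_iff, not_and,
        not_not] at this
      exact ⟨fun h => hyp (this (Or.inl h)), fun h => hyp (this (Or.inr h))⟩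
    obtain ⟨C, hC, hCE, hb⟩ := exists_isCompact_lower_bound_of_ends h₁ h₂ hc (a := p) hr
      (ε := 1) (Or.inl rfl) hU (Or.inl ⟨rfl, hp⟩)
    refine ⟨r * Real.exp (-1), by positivity, C, hC, hCE, fun w hw hwp => ?_⟩
    have hne : (w - p) / r ≠ 0 := div_ne_zero (sub_ne_zero.2 hwp) (by simpa using hr.ne')
    refine hb (-Complex.I * Complex.log ((w - p) / r)) ?_ w ?_
    · have h1 : ‖(w - p) / r‖ < Real.exp (-1) := by
        rw [norm_div, Complex.norm_real, Real.norm_eq_abs, abs_of_pos hr, div_lt_iff₀ hr, mul_comm]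
        exact mem_ball_iff_norm.1 hw
      have h2 := (Real.log_lt_iff_lt_exp (norm_pos_iff.2 hne)).2 h1
      have h3 : (-Complex.I * Complex.log ((w - p) / r)).im = -Real.log ‖(w - p) / r‖ := by
        simp [Complex.log_re]
      rw [h3]; linarith
    · have h1 : (1 : ℂ) * (-Complex.I * Complex.log ((w - p) / r) * Complex.I) =
          Complex.log ((w - p) / r) := by
        linear_combination (-Complex.log ((w - p) / r)) * Complex.I_mul_I
      rw [h1, Complex.exp_log hne, mul_div_cancel₀ _ (by simpa using hr.ne')]
      ring
  have hinfty : ∃ R > 0, ∃ C : Set ℂ, IsCompact C ∧ C ⊆ Eᶜ ∧ ∀ w : ℂ, R < ‖w‖ →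
      0 ≤ φ₂ w - φ₁ w ∨ ∃ c ∈ C, φ₂ c - φ₁ c ≤ φ₂ w - φ₁ w := by
    obtain ⟨r₀, hr₀⟩ := hE.isBounded.exists_norm_le
    set r := max r₀ 1
    have hr : 0 < r := lt_of_lt_of_le one_pos (le_max_right _ _)
    have hU : ∀ z : ℂ, 0 < z.im → 0 + r * Complex.exp (-1 * (z * Complex.I)) ∉ E ∧
        0 + r * Complex.exp (-1 * (z * Complex.I)) ≠ 0 := by
      intro z hz
      set y : ℂ := 0 + r * Complex.exp (-1 * (z * Complex.I)) with hy
      have hn : ‖y‖ = r * Real.exp z.im := by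
        rw [hy, zero_add, norm_mul, Complex.norm_exp, Complex.norm_real,
          Real.norm_eq_abs, abs_of_pos hr]
        simp
      have hlt : r < ‖y‖ := by
        rw [hn]
        have : 1 < Real.exp z.im := Real.one_lt_exp_iff.2 hz
        nlinarith
      refine ⟨fun h => ?_, fun h => ?_⟩
      · exact absurd (hr₀ y h) (not_le.2 ((le_max_left _ _).trans_lt hlt))
      · rw [h, norm_zero] at hlt
        linarith
    obtain ⟨C, hC, hCE, hb⟩ := exists_isCompact_lower_bound_of_ends h₁ h₂ hc (a := 0) hr
      (ε := -1) (Or.inr rfl) hU (Or.inr rfl)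
    refine ⟨r * Real.exp 1, by positivity, C, hC, hCE, fun w hw => ?_⟩
    have hw0 : w ≠ 0 := by
      rintro rfl
      rw [norm_zero] at hw
      exact absurd hw (not_lt.2 (by positivity))
    have hne : w / r ≠ 0 := div_ne_zero hw0 (by simpa using hr.ne')
    refine hb (Complex.I * Complex.log (w / r)) ?_ w ?_
    · have h1 : Real.exp 1 < ‖w / r‖ := by
        rw [norm_div, Complex.norm_real, Real.norm_eq_abs, abs_of_pos hr, lt_div_iff₀ hr, mul_comm]
        exact hw
      have h2 := (Real.lt_log_iff_exp_lt (norm_pos_iff.2 hne)).2 h1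
      have h3 : (Complex.I * Complex.log (w / r)).im = Real.log ‖w / r‖ := by
        simp [Complex.log_re]
      rw [h3]; exact h2.le
    · have h1 : (-1 : ℂ) * (Complex.I * Complex.log (w / r) * Complex.I) =
          Complex.log (w / r) := by
        linear_combination (-Complex.log (w / r)) * Complex.I_mul_I
      rw [h1, Complex.exp_log hne, mul_div_cancel₀ _ (by simpa using hr.ne')]
      ring
  choose! ρ hρ C hC hCE hb using hpunct
  obtain ⟨R, hR, C₀, hC₀, hC₀E, hb₀⟩ := hinfty
  -- What remains after removing all cusp neighbourhoods, together with the compact sets controlling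
  -- them. Every value of `φ₂ - φ₁` off `E` is either nonnegative or at least some value on `K`, so
  -- a negative infimum is attained.
  set K : Set ℂ := (Metric.closedBall 0 R \ ⋃ p ∈ E, Metric.ball p (ρ p)) ∪ C₀ ∪ ⋃ p ∈ E, C p
  have hK : IsCompact K := by
    refine (IsCompact.union ?_ hC₀).union (hE.isCompact_biUnion hC)
    exact (isCompact_closedBall (0 : ℂ) R).diff (isOpen_biUnion fun p _ => Metric.isOpen_ball)
  have hKE : K ⊆ Eᶜ := by
    rintro y ((hy | hy) | hy)
    · intro hyE
      exact hy.2 (Set.mem_biUnion hyE (Metric.mem_ball_self (hρ y hyE)))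
    · exact hC₀E hy
    · obtain ⟨p, hp, hyp⟩ := Set.mem_iUnion₂.1 hy
      exact hCE p hp hyp
  have hall : ∀ y, y ∉ E → 0 ≤ φ₂ y - φ₁ y ∨ ∃ c ∈ K, φ₂ c - φ₁ c ≤ φ₂ y - φ₁ y := by
    intro y hy
    by_cases hyR : R < ‖y‖
    · rcases hb₀ y hyR with h | ⟨c, hc, h⟩
      · exact Or.inl h
      · exact Or.inr ⟨c, Or.inl (Or.inr hc), h⟩
    by_cases hyU : y ∈ ⋃ p ∈ E, Metric.ball p (ρ p)
    · obtain ⟨p, hp, hyp⟩ := Set.mem_iUnion₂.1 hyU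
      rcases hb p hp y hyp (fun h => hy (h ▸ hp)) with h | ⟨c, hc, h⟩
      · exact Or.inl h
      · exact Or.inr ⟨c, Or.inr (Set.mem_biUnion hp hc), h⟩
    · exact Or.inr ⟨y, Or.inl (Or.inl ⟨mem_closedBall_zero_iff.2 (not_lt.1 hyR), hyU⟩), le_rfl⟩
  by_contra! hlt
  have hKne : K.Nonempty := by
    rcases hall w hw with h | ⟨c, hc, -⟩
    · linarith
    · exact ⟨c, hc⟩
  have hsm : ∀ y, y ∉ E → ContDiffAt ℝ 2 (φ₂ - φ₁) y := fun y hy => (h₂.1 y hy).sub (h₁.1 y hy)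
  obtain ⟨y, hyK, hymin⟩ := hK.exists_isMinOn hKne (f := φ₂ - φ₁)
    fun y hy => (hsm y (hKE hy)).continuousAt.continuousWithinAt
  have hy : y ∉ E := hKE hyK
  have hyw : φ₂ y - φ₁ y < 0 := by
    rcases hall w hw with h | ⟨c, hc, h⟩
    · linarith
    · have : φ₂ y - φ₁ y ≤ φ₂ c - φ₁ c := hymin hc
      linarith
  have hloc : IsLocalMin (φ₂ - φ₁) y := by
    filter_upwards [hE.isClosed.isOpen_compl.mem_nhds hy] with x hx
    simp only [Pi.sub_apply]
    rcases hall x hx with h | ⟨c, hc, h⟩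
    · linarith
    · have : φ₂ y - φ₁ y ≤ φ₂ c - φ₁ c := hymin hc
      linarith
  have hlap := laplacian_nonneg_of_isLocalMin (hsm y hy) hloc
  rw [(h₂.1 y hy).laplacian_sub (h₁.1 y hy), h₁.2 y hy, h₂.2 y hy, sub_nonneg] at hlap
  have := Real.exp_le_exp.1 hlap
  linarith

end PuncturedSphere

namespace PuncturedSphere

/-! ### Local inverses of holomorphic functions -/

theorem AnalyticAt.exists_local_inverse {F : ℂ → ℂ} {a : ℂ} (hF : AnalyticAt ℂ F a)
    (hF' : deriv F a ≠ 0) : ∃ G : ℂ → ℂ, AnalyticAt ℂ G (F a) ∧ G (F a) = a ∧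
      (∀ᶠ w in 𝓝 (F a), F (G w) = w) ∧ ∀ᶠ z in 𝓝 a, G (F z) = z := by
  have hs : HasStrictFDerivAt F
      ((ContinuousLinearEquiv.unitsEquivAut ℂ (Units.mk0 _ hF') : ℂ ≃L[ℂ] ℂ) : ℂ →L[ℂ] ℂ) a :=
    hF.hasStrictDerivAt.hasStrictFDerivAt_equiv hF'
  refine ⟨hF.hasStrictDerivAt.localInverse _ _ _ hF', hF.analyticAt_localInverse hF',
    hs.localInverse_apply_image, hs.eventually_right_inverse, hs.eventually_left_inverse⟩

/-- If `g - g a` vanishes to order `n ≥ 2`, it equals a constant times `W ^ n` for a local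
coordinate `W`, and two points whose `W`-coordinates differ by a primitive `n`-th root of unity have
the same image. -/
theorem AnalyticAt.deriv_ne_zero_of_injOn {g : ℂ → ℂ} {a : ℂ} (hg : AnalyticAt ℂ g a) {s : Set ℂ}
    (hs : s ∈ 𝓝 a) (hinj : Set.InjOn g s) : deriv g a ≠ 0 := by
  intro hd
  set h : ℂ → ℂ := fun z => g z - g a with hh
  have hhan : AnalyticAt ℂ h a := hg.sub analyticAt_const
  have htop : analyticOrderAt h a ≠ ⊤ := by
    intro htop
    rw [analyticOrderAt_eq_top] at htop
    have h1 : ∀ᶠ z in 𝓝[≠] a, z ∈ s ∧ h z = 0 ∧ z ≠ a :=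
      (eventually_nhdsWithin_of_eventually_nhds hs).and
        ((eventually_nhdsWithin_of_eventually_nhds htop).and self_mem_nhdsWithin)
    obtain ⟨z, hz, hz0, hza⟩ := h1.exists
    exact hza (hinj hz (mem_of_mem_nhds hs) (sub_eq_zero.1 hz0))
  obtain ⟨v, hv, hva, hev⟩ := (hhan.analyticOrderAt_ne_top).1 htop
  set n := analyticOrderNatAt h a
  simp only [smul_eq_mul] at hev
  have hn0 : n ≠ 0 := by
    intro hn
    have := hev.self_of_nhds
    simp [hn, h] at this
    exact hva this.symm
  have hn1 : n ≠ 1 := by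
    intro hn
    have h1 : HasDerivAt (fun z => (z - a) * v z) (1 * v a + (a - a) * deriv v a) a :=
      ((hasDerivAt_id a).sub_const a).mul hv.differentiableAt.hasDerivAt
    have h2 : h =ᶠ[𝓝 a] fun z => (z - a) * v z := by
      filter_upwards [hev] with z hz
      rw [hz, hn, pow_one]
    have h3 : HasDerivAt h 0 a := by
      have := hg.differentiableAt.hasDerivAt.sub_const (g a)
      rwa [hd] at this
    have h4 := h3.unique (h1.congr_of_eventuallyEq h2)
    simp at h4
    exact hva h4.symm
  have hn0' : (n : ℂ) ≠ 0 := Nat.cast_ne_zero.2 hn0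
  -- An `n`-th root of `v / v a`, holomorphic since the quotient is near `1`, where the principal
  -- logarithm is.
  set k : ℂ → ℂ := fun z => Complex.exp (Complex.log (v z / v a) / n) with hk
  have hkan : AnalyticAt ℂ k a := by
    refine AnalyticAt.cexp (AnalyticAt.div_const (AnalyticAt.clog (hv.div_const) ?_))
    simp [div_self hva]
  have hka : k a = 1 := by simp [k, div_self hva]
  have hkn : ∀ᶠ z in 𝓝 a, k z ^ n * v a = v z := by
    filter_upwards [hv.continuousAt.eventually_ne hva] with z hz
    rw [hk]
    simp only
    rw [← Complex.exp_nat_mul, mul_div_cancel₀ _ hn0', Complex.exp_log (div_ne_zero hz hva),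
      div_mul_cancel₀ _ hva]
  set W : ℂ → ℂ := fun z => (z - a) * k z with hW
  have hWan : AnalyticAt ℂ W a := (analyticAt_id.sub analyticAt_const).mul hkan
  have hWd : deriv W a ≠ 0 := by
    have h1 : HasDerivAt W (1 * k a + (a - a) * deriv k a) a :=
      ((hasDerivAt_id a).sub_const a).mul hkan.differentiableAt.hasDerivAt
    rw [h1.deriv]
    simp [hka]
  have hWa : W a = 0 := by simp [W]
  obtain ⟨G, hG, hGa, hGr, -⟩ := AnalyticAt.exists_local_inverse hWan hWd
  rw [hWa] at hG hGa hGr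
  set ζ : ℂ := Complex.exp (2 * Real.pi * Complex.I / n)
  have hprim : IsPrimitiveRoot ζ n := Complex.isPrimitiveRoot_exp n hn0
  have hgood : ∀ᶠ y in 𝓝 (0 : ℂ), G y ∈ s ∧ h (G y) = y ^ n * v a ∧ W (G y) = y := by
    have hGt : Tendsto G (𝓝 0) (𝓝 a) := by
      have := hG.continuousAt.tendsto
      rwa [hGa] at this
    filter_upwards [hGt.eventually hs, hGt.eventually hev, hGt.eventually hkn, hGr]
      with y h1 h2 h3 h4
    refine ⟨h1, ?_, h4⟩
    rw [h2, ← h3, ← mul_assoc, ← mul_pow]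
    congr 2
  have hgood' : ∀ᶠ y in 𝓝 (0 : ℂ), G (ζ * y) ∈ s ∧ h (G (ζ * y)) = (ζ * y) ^ n * v a ∧
      W (G (ζ * y)) = ζ * y := by
    have : Tendsto (fun y => ζ * y) (𝓝 0) (𝓝 0) := by
      simpa using (continuous_const_mul ζ).tendsto 0
    exact this.eventually hgood
  have hne : ∀ᶠ y in 𝓝[≠] (0 : ℂ), y ≠ 0 := self_mem_nhdsWithin
  obtain ⟨y, ⟨⟨h1, h2, h3⟩, h4, h5, h6⟩, hy⟩ :=
    ((eventually_nhdsWithin_of_eventually_nhds (hgood.and hgood')).and hne).exists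
  have h7 : h (G y) = h (G (ζ * y)) := by
    rw [h2, h5, mul_pow, hprim.pow_eq_one, one_mul]
  have h8 : G y = G (ζ * y) := hinj h1 h4 (sub_left_injective h7)
  have h9 : y = ζ * y := by rw [← h6, ← h8, h3]
  have h10 : ζ = 1 := by
    have := mul_right_cancel₀ hy (show ζ * y = 1 * y by rw [one_mul, ← h9])
    exact this
  exact hprim.ne_one (by omega) h10

/-! ### The coordinate `1 / z` on the Riemann sphere -/

/-- The coordinate `w = 1 / z`, left inverse to `ofInv`. -/
noncomputable def invCoord (x : OnePoint ℂ) : ℂ := x.elim 0 (·⁻¹)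

@[simp]
theorem invCoord_coe (z : ℂ) : invCoord (z : OnePoint ℂ) = z⁻¹ := rfl

@[simp]
theorem invCoord_infty : invCoord OnePoint.infty = 0 := rfl

@[simp]
theorem invCoord_ofInv (w : ℂ) : invCoord (ofInv w) = w := by
  by_cases hw : w = 0 <;> simp [ofInv, hw]

theorem ofInv_of_ne_zero {w : ℂ} (hw : w ≠ 0) : ofInv w = ((w⁻¹ : ℂ) : OnePoint ℂ) := by
  simp [ofInv, hw]

theorem ofInv_invCoord {x : OnePoint ℂ} (hx : x ≠ ((0 : ℂ) : OnePoint ℂ)) :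
    ofInv (invCoord x) = x := by
  induction x using OnePoint.rec with
  | infty => simp [ofInv]
  | coe z =>
    have : z ≠ 0 := fun h => hx (by rw [h])
    simp [ofInv, this]

theorem ofInv_injective : Function.Injective ofInv :=
  Function.LeftInverse.injective invCoord_ofInv

theorem continuous_ofInv : Continuous ofInv := by
  refine continuous_iff_continuousAt.2 fun w => ?_
  by_cases hw : w = 0
  · subst hw
    rw [continuousAt_iff_punctured_nhds]
    have h1 : Tendsto (fun w : ℂ => ((w⁻¹ : ℂ) : OnePoint ℂ)) (𝓝[≠] 0) (𝓝 OnePoint.infty) := by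
      refine OnePoint.tendsto_coe_infty.comp ?_
      rw [coclosedCompact_eq_cocompact, ← Metric.cobounded_eq_cocompact]
      exact tendsto_inv₀_nhdsNE_zero
    rw [show ofInv 0 = OnePoint.infty by simp [ofInv]]
    refine h1.congr' ?_
    filter_upwards [self_mem_nhdsWithin] with w hw
    exact (ofInv_of_ne_zero hw).symm
  · have h1 : ContinuousAt (fun w : ℂ => ((w⁻¹ : ℂ) : OnePoint ℂ)) w :=
      OnePoint.continuous_coe.continuousAt.comp (continuousAt_inv₀ hw)
    refine h1.congr ?_
    filter_upwards [isOpen_ne.mem_nhds hw] with y hy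
    exact (ofInv_of_ne_zero hy).symm

/-! ### Coverings of punctured spheres by the upper half plane -/

open UpperHalfPlane in
/-- `U` is a holomorphic covering of `ℂ ∖ E` by the upper half plane, with deck transformation group
`Γ(N)` and a pole at the cusp `i∞`. -/
structure IsCuspCovering (N : ℕ) (E : Set ℂ) (U : ℂ → ℂ) : Prop where
  analyticAt : ∀ z : ℂ, 0 < z.im → AnalyticAt ℂ U z
  deriv_ne_zero : ∀ z : ℂ, 0 < z.im → deriv U z ≠ 0
  notMem : ∀ z : ℂ, 0 < z.im → U z ∉ E
  surj : ∀ w, w ∉ E → ∃ τ : ℍ, U τ = w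
  periodic : Function.Periodic U N
  exists_smul_eq : ∀ τ τ' : ℍ, U τ = U τ' → ∃ γ ∈ CongruenceSubgroup.Gamma N, τ' = γ • τ
  smul : ∀ γ ∈ CongruenceSubgroup.Gamma N, ∀ τ : ℍ, U (γ • τ : ℍ) = U τ
  tendsto : Tendsto U (comap Complex.im atTop) (Bornology.cobounded ℂ)

open UpperHalfPlane in
theorem eventually_ofComplex {p : ℍ → Prop} {τ : ℍ} (h : ∀ᶠ σ in 𝓝 τ, p σ) :
    ∀ᶠ z in 𝓝 (τ : ℂ), p (ofComplex z) ∧ ((ofComplex z : ℍ) : ℂ) = z := by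
  rw [← isOpenEmbedding_coe.map_nhds_eq, eventually_map]
  filter_upwards [h] with σ hσ
  rw [ofComplex_apply]
  exact ⟨hσ, rfl⟩

section

open UpperHalfPlane

variable {N : ℕ} {P : Finset (OnePoint ℂ)} {f : ℍ → {x : OnePoint ℂ // x ∉ (P : Set (OnePoint ℂ))}}

/-- The half plane is simply connected, so `p` lifts through itself with any prescribed base point
in the fibre; uniqueness of lifts makes the two lifts exchanging `τ` and `τ'` inverse to each other.
This turns the hypothesis on deck transformations into a description of the fibres. -/
theorem IsCoveringMap.exists_homeomorph_of_eq {Y : Type*} [TopologicalSpace Y] {p : ℍ → Y}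
    (hp : IsCoveringMap p) {τ τ' : ℍ} (h : p τ = p τ') :
    ∃ e : ℍ ≃ₜ ℍ, (∀ σ, p (e σ) = p σ) ∧ e τ = τ' := by
  let q : C(ℍ, Y) := ⟨p, hp.continuous⟩
  obtain ⟨F, ⟨hF, hFp⟩, -⟩ := hp.existsUnique_continuousMap_lifts q τ τ' h.symm
  obtain ⟨G, ⟨hG, hGp⟩, -⟩ := hp.existsUnique_continuousMap_lifts q τ' τ h
  have hF' : ∀ σ, p (F σ) = p σ := congrFun hFp
  have hG' : ∀ σ, p (G σ) = p σ := congrFun hGp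
  have hGF : ∀ σ, G (F σ) = σ := by
    have := hp.existsUnique_continuousMap_lifts q τ τ rfl
    have h1 := this.unique (y₁ := G.comp F) (y₂ := ContinuousMap.id ℍ)
      ⟨by simp [hF, hG], by funext σ; simp [hF', hG', q]⟩ ⟨rfl, by funext σ; simp [q]⟩
    exact fun σ => congrArg (fun k : C(ℍ, ℍ) => k σ) h1
  have hFG : ∀ σ, F (G σ) = σ := by
    have := hp.existsUnique_continuousMap_lifts q τ' τ' rfl
    have h1 := this.unique (y₁ := F.comp G) (y₂ := ContinuousMap.id ℍ)
      ⟨by simp [hF, hG], by funext σ; simp [hF', hG', q]⟩ ⟨rfl, by funext σ; simp [q]⟩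
    exact fun σ => congrArg (fun k : C(ℍ, ℍ) => k σ) h1
  exact ⟨⟨⟨F, G, hGF, hFG⟩, F.continuous, G.continuous⟩, hF', hF⟩

/-- The coordinate `1 / f` of a covering of the punctured sphere, as a function on `ℂ`. -/
noncomputable def invMap (f : ℍ → {x : OnePoint ℂ // x ∉ (P : Set (OnePoint ℂ))}) (z : ℂ) : ℂ :=
  invCoord (f (ofComplex z))

theorem ofInv_invMap (h0 : ((0 : ℂ) : OnePoint ℂ) ∈ P) (z : ℂ) :
    ofInv (invMap f z) = f (ofComplex z) :=
  ofInv_invCoord fun h => (f (ofComplex z)).2 (by rw [h]; exact_mod_cast h0)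

theorem invMap_eq_iff (h0 : ((0 : ℂ) : OnePoint ℂ) ∈ P) (z z' : ℂ) :
    invMap f z = invMap f z' ↔ f (ofComplex z) = f (ofComplex z') := by
  rw [← ofInv_injective.eq_iff, ofInv_invMap h0, ofInv_invMap h0, Subtype.coe_inj]

/-- Since `0 ∈ P`, the coordinate `w = 1 / z` maps the punctured sphere onto `ℂ` minus a finite set,
so a single chart suffices, and vanishing at `i∞` becomes a pole. -/
theorem IsGammaCovering.isCuspCovering (h0 : ((0 : ℂ) : OnePoint ℂ) ∈ P)
    (hf : IsGammaCovering N (P : Set (OnePoint ℂ)) f) :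
    IsCuspCovering N {w | ofInv w ∈ P} (invMap f) := by
  have han : ∀ z : ℂ, 0 < z.im → AnalyticAt ℂ (invMap f) z := by
    intro z hz
    obtain ⟨g, hg, h | h⟩ := hf.holomorphic ⟨z, hz⟩
    · have hgz : g z ≠ 0 := by
        intro hgz
        have := h.self_of_nhds
        simp only [hgz] at this
        exact (f ⟨z, hz⟩).2 (by rw [this]; exact_mod_cast h0)
      refine (hg.inv hgz).congr ?_
      filter_upwards [eventually_ofComplex h] with y hy
      simp only [invMap, hy.1, hy.2, invCoord_coe, Pi.inv_apply]
    · refine hg.congr ?_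
      filter_upwards [eventually_ofComplex h] with y hy
      simp only [invMap, hy.1, hy.2, invCoord_ofInv]
  have hder : ∀ z : ℂ, 0 < z.im → deriv (invMap f) z ≠ 0 := by
    intro z hz
    obtain ⟨e, he, hfe⟩ := hf.covering.isLocalHomeomorph ⟨z, hz⟩
    refine AnalyticAt.deriv_ne_zero_of_injOn (han z hz)
      (s := {y | ofComplex y ∈ e.source ∧ ((ofComplex y : ℍ) : ℂ) = y})
      (eventually_ofComplex (τ := ⟨z, hz⟩) (e.open_source.mem_nhds he)) ?_
    intro x hx y hy hxy
    rw [invMap_eq_iff h0, hfe] at hxy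
    rw [← hx.2, ← hy.2, e.injOn hx.1 hy.1 hxy]
  have hmem : ∀ z : ℂ, invMap f z ∉ {w | ofInv w ∈ P} := by
    intro z hz
    have hz' : ofInv (invMap f z) ∈ P := hz
    rw [ofInv_invMap h0] at hz'
    exact (f (ofComplex z)).2 (by exact_mod_cast hz')
  have hfin : {w | ofInv w ∈ P}.Finite := P.finite_toSet.preimage ofInv_injective.injOn
  have hsmul : ∀ γ ∈ CongruenceSubgroup.Gamma N, ∀ τ : ℍ, f (γ • τ) = f τ := by
    intro γ hγ τ
    exact ((hf.deck (Homeomorph.smul (γ : GL (Fin 2) ℝ))).2 ⟨γ, hγ, fun τ => rfl⟩) τ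
  refine ⟨han, hder, fun z _ => hmem z, ?_, ?_, ?_, ?_, ?_⟩
  -- Surjectivity by connectedness: the image is open as the derivative does not vanish, and the set
  -- of omitted points is open because an empty fibre makes all fibres over an evenly covered
  -- neighbourhood empty.
  · set V : Set ℂ := invMap f '' {z | 0 < z.im} with hV
    set W : Set ℂ := {w | ofInv w ∉ P ∧ ∀ τ : ℍ, invMap f τ ≠ w} with hW
    have hVo : IsOpen V := by
      rw [isOpen_iff_mem_nhds]
      rintro _ ⟨z, hz, rfl⟩
      rw [← ((han z hz).hasStrictDerivAt).map_nhds_eq (hder z hz)]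
      exact image_mem_map (isOpen_upperHalf.mem_nhds hz)
    have hWo : IsOpen W := by
      rw [isOpen_iff_mem_nhds]
      rintro w ⟨hwP, hw⟩
      have hwP' : ofInv w ∉ (P : Set (OnePoint ℂ)) := by exact_mod_cast hwP
      have hempty : IsEmpty (f ⁻¹' {⟨ofInv w, hwP'⟩}) := by
        refine ⟨fun ⟨τ, hτ⟩ => hw τ ?_⟩
        have hτ' : f τ = ⟨ofInv w, hwP'⟩ := hτ
        rw [invMap, ofComplex_apply, hτ', invCoord_ofInv]
      obtain ⟨-, S, hwS, hSo, -, H, -⟩ := hf.covering ⟨ofInv w, hwP'⟩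
      obtain ⟨O, hO, rfl⟩ := isOpen_induced_iff.1 hSo
      have h1 : ofInv ⁻¹' O ∈ 𝓝 w := (hO.preimage continuous_ofInv).mem_nhds hwS
      have h2 : {w | ofInv w ∈ P}ᶜ ∈ 𝓝 w := hfin.isClosed.isOpen_compl.mem_nhds hwP
      filter_upwards [h1, h2] with y hy1 hy2
      refine ⟨hy2, fun τ hτ => ?_⟩
      have h3 : (f τ : OnePoint ℂ) = ofInv y := by
        rw [← hτ, ofInv_invMap h0, ofComplex_apply]
      have h4 : τ ∈ f ⁻¹' (Subtype.val ⁻¹' O) := by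
        simp only [Set.mem_preimage, h3]
        exact hy1
      exact hempty.elim (H ⟨τ, h4⟩).2
    have hconn : IsPreconnected {w | ofInv w ∈ P}ᶜ :=
      (hfin.countable.isConnected_compl_of_one_lt_rank
        (by rw [Complex.rank_real_complex]; norm_num)).isPreconnected
    have hsub : {w | ofInv w ∈ P}ᶜ ⊆ V := by
      refine hconn.subset_left_of_subset_union hVo hWo ?_ ?_ ?_
      · rw [Set.disjoint_left]
        rintro _ ⟨z, hz, rfl⟩ ⟨-, hz'⟩
        exact hz' ⟨z, hz⟩ rfl
      · intro w hw
        by_cases h : ∃ τ : ℍ, invMap f τ = w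
        · obtain ⟨τ, hτ⟩ := h
          exact Or.inl ⟨τ, τ.im_pos, hτ⟩
        · exact Or.inr ⟨hw, not_exists.1 h⟩
      · exact ⟨invMap f Complex.I, hmem _, Complex.I, by simp, rfl⟩
    intro w hw
    obtain ⟨z, hz, hzw⟩ := hsub hw
    exact ⟨⟨z, hz⟩, hzw⟩
  · intro z
    -- Outside the half plane `ofComplex` is constant, so periodicity holds there trivially.
    rcases le_or_gt z.im 0 with hz | hz
    · have h1 : (z + (N : ℂ)).im ≤ 0 := by simpa using hz
      simp only [invMap, ofComplex_apply_eq_of_im_nonpos h1 hz]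
    · rw [invMap_eq_iff h0]
      have h1 : (z + (N : ℂ)).im = z.im := by simp
      have h2 : ofComplex (z + N) = ModularGroup.T ^ (N : ℤ) • ofComplex z := by
        rw [modular_T_zpow_smul, ofComplex_apply_of_im_pos hz,
          ofComplex_apply_of_im_pos (by rw [h1]; exact hz)]
        apply UpperHalfPlane.ext
        simp [add_comm]
      rw [h2]
      exact hsmul _ (CongruenceSubgroup.ModularGroup_T_pow_mem_Gamma N N dvd_rfl) _
  · intro τ τ' h
    rw [invMap_eq_iff h0, ofComplex_apply, ofComplex_apply] at h
    obtain ⟨e, he, heτ⟩ := IsCoveringMap.exists_homeomorph_of_eq hf.covering h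
    obtain ⟨γ, hγ, hγe⟩ := (hf.deck e).1 he
    exact ⟨γ, hγ, by rw [← heτ, hγe]⟩
  · intro γ hγ τ
    rw [invMap_eq_iff h0, ofComplex_apply, ofComplex_apply]
    exact hsmul γ hγ τ
  · have h1 : Tendsto (fun z : ℂ => (f (ofComplex z) : OnePoint ℂ)) (comap Complex.im atTop)
        (𝓝 ((0 : ℂ) : OnePoint ℂ)) := hf.vanishes.comp tendsto_comap_im_ofComplex
    have h2 : Tendsto invCoord (𝓝[≠] ((0 : ℂ) : OnePoint ℂ)) (Bornology.cobounded ℂ) := by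
      rw [OnePoint.nhdsWithin_coe, tendsto_map'_iff]
      have : ((↑) : ℂ → OnePoint ℂ) ⁻¹' {((0 : ℂ) : OnePoint ℂ)}ᶜ = {0}ᶜ := by
        ext z; simp
      rw [this]
      exact tendsto_inv₀_nhdsNE_zero
    refine h2.comp (tendsto_nhdsWithin_iff.2 ⟨h1, Eventually.of_forall fun z hz => ?_⟩)
    have hz' : (f (ofComplex z) : OnePoint ℂ) = ((0 : ℂ) : OnePoint ℂ) := hz
    exact (f (ofComplex z)).2 (by rw [hz']; exact_mod_cast h0)

end

end PuncturedSphere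

namespace PuncturedSphere

/-! ### The complete metric of curvature `-1` -/

section

open UpperHalfPlane

variable {N : ℕ} {E : Set ℂ} {U : ℂ → ℂ}

/-- Differentiate `U ∘ γ = U` and use `Im (γ τ) = Im τ * |γ'(τ)|`. The invariance is what lets `|dτ|
/ Im τ` descend. -/
theorem IsCuspCovering.norm_deriv_smul_mul_im (hU : IsCuspCovering N E U) {γ : SL(2, ℤ)}
    (hγ : γ ∈ CongruenceSubgroup.Gamma N) (τ : ℍ) :
    ‖deriv U (γ • τ : ℍ)‖ * (γ • τ).im = ‖deriv U τ‖ * τ.im := by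
  set g : GL (Fin 2) ℝ := (γ : GL (Fin 2) ℝ) with hg
  have hdet : g.val.det = 1 := ((Matrix.SpecialLinearGroup.map (Int.castRingHom ℝ)) γ).2
  have hsm : γ • τ = g • τ := rfl
  have h1 := hasStrictDerivAt_smul (g := g) (by rw [hdet]; exact one_pos) τ
  have h2 : HasDerivAt U (deriv U (g • τ : ℍ)) ((fun z : ℂ => ((g • ofComplex z : ℍ) : ℂ)) τ) := by
    simp only [ofComplex_apply]
    exact (hU.analyticAt _ (g • τ).im_pos).differentiableAt.hasDerivAt
  have h3 := h2.comp (τ : ℂ) h1.hasDerivAt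
  have h4 : (U ∘ fun z : ℂ => ((g • ofComplex z : ℍ) : ℂ)) =ᶠ[𝓝 (τ : ℂ)] U := by
    filter_upwards [isOpen_upperHalf.mem_nhds τ.im_pos] with z hz
    have := hU.smul γ hγ (ofComplex z)
    simp only [Function.comp_apply]
    rw [show g • ofComplex z = γ • ofComplex z from rfl, this,
      ofComplex_apply_of_im_pos hz]
  have h5 := h3.unique
    ((hU.analyticAt _ τ.im_pos).differentiableAt.hasDerivAt.congr_of_eventuallyEq h4)
  rw [hdet] at h5
  rw [hsm, ← h5, im_smul_eq_div_normSq, Complex.normSq_eq_norm_sq]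
  have hd : ‖denom g τ‖ ≠ 0 := norm_ne_zero_iff.2 (denom_ne_zero g τ)
  have hdet' : |(g.det.val : ℝ)| = 1 := by
    have : (g.det.val : ℝ) = g.val.det := rfl
    rw [this, hdet, abs_one]
  rw [hdet']
  simp
  field_simp

/-- The hyperbolic metric of the upper half plane descends to the base of the covering. -/
theorem IsCuspCovering.exists_isLiouvilleOn (hU : IsCuspCovering N E U) :
    ∃ φ : ℂ → ℝ, IsLiouvilleOn φ Eᶜ ∧
      ∀ τ : ℍ, φ (U τ) = -Real.log (‖deriv U τ‖ * τ.im) := by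
  have hsurj := hU.surj
  -- An arbitrary section, with no continuity. Smoothness of `φ` comes from `hφU`, which allows `σ`
  -- to be replaced near each point by a holomorphic local inverse of `U`.
  choose! σ hσ using hsurj
  set φ : ℂ → ℝ := fun w => -Real.log (‖deriv U (σ w)‖ * (σ w).im) with hφ
  have hφU : ∀ τ : ℍ, φ (U τ) = -Real.log (‖deriv U τ‖ * τ.im) := by
    intro τ
    obtain ⟨γ, hγ, h⟩ := hU.exists_smul_eq τ (σ (U τ)) (hσ _ (hU.notMem _ τ.im_pos)).symm
    simp only [φ]
    rw [h, hU.norm_deriv_smul_mul_im hγ]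
  refine ⟨φ, ?_, hφU⟩
  have hloc : ∀ w ∈ Eᶜ, ∃ V, IsOpen V ∧ w ∈ V ∧ IsLiouvilleOn φ V := by
    intro w hw
    obtain ⟨τ, rfl⟩ := hU.surj w hw
    obtain ⟨G, hG, hGτ, hGr, -⟩ := AnalyticAt.exists_local_inverse (hU.analyticAt _ τ.im_pos)
      (hU.deriv_ne_zero _ τ.im_pos)
    have him : ∀ᶠ y in 𝓝 (U τ), 0 < (G y).im := by
      have := hG.continuousAt.eventually (isOpen_upperHalf.mem_nhds (x := G (U τ))
        (by rw [hGτ]; exact τ.im_pos))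
      exact this
    obtain ⟨V, hV, hVo, hVw⟩ := eventually_nhds_iff.1
      (hG.eventually_analyticAt.and (him.and hGr.eventually_nhds))
    have hderiv : ∀ y ∈ V, deriv U (G y) * deriv G y = 1 := by
      intro y hy
      obtain ⟨h1, h2, h3⟩ := hV y hy
      have h4 := (hU.analyticAt _ h2).differentiableAt.hasDerivAt.comp y
        h1.differentiableAt.hasDerivAt
      have h5 : (U ∘ G) =ᶠ[𝓝 y] id := h3
      exact h4.unique ((hasDerivAt_id y).congr_of_eventuallyEq h5)
    refine ⟨V, hVo, hVw, ?_⟩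
    have hl := isLiouvilleOn_upperHalf.comp (h := G) (V := V) (fun y hy => (hV y hy).1)
      (fun y hy => (hV y hy).2.1) (fun y hy => right_ne_zero_of_mul_eq_one (hderiv y hy))
    refine hl.congr hVo fun y hy => ?_
    obtain ⟨h1, h2, h3⟩ := hV y hy
    have h4 := hφU ⟨G y, h2⟩
    have h5 : U (G y) = y := h3.self_of_nhds
    simp only [mk_im] at h4
    rw [h5] at h4
    have h6 : ‖deriv G y‖ = ‖deriv U (G y)‖⁻¹ := by
      rw [← norm_inv, ← eq_inv_of_mul_eq_one_right (hderiv y hy)]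
    rw [h4, h6, Real.log_inv, Real.log_mul (norm_ne_zero_iff.2 (hU.deriv_ne_zero _ h2)) h2.ne']
    ring
  refine ⟨fun w hw => ?_, fun w hw => ?_⟩
  · obtain ⟨V, -, hwV, hV⟩ := hloc w hw
    exact hV.1 w hwV
  · obtain ⟨V, -, hwV, hV⟩ := hloc w hw
    exact hV.2 w hwV

/-- A complete metric of curvature `-1` is the image of the hyperbolic metric. -/
theorem IsCuspCovering.exp_mul_norm_deriv_mul_im (hU : IsCuspCovering N E U) (hE : E.Finite)
    {φ : ℂ → ℝ} (hφ : IsLiouvilleOn φ Eᶜ) (hc : HasInfiniteEnds E φ) (τ : ℍ) :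
    Real.exp (φ (U τ)) * (‖deriv U τ‖ * τ.im) = 1 := by
  obtain ⟨ψ, hψ, hψU⟩ := hU.exists_isLiouvilleOn
  -- Completeness of `φ` gives this inequality, the Ahlfors lemma for the pullback of `φ` the
  -- opposite one.
  have h1 : -Real.log (‖deriv U τ‖ * τ.im) ≤ φ (U τ) := by
    rw [← hψU]
    exact le_of_hasInfiniteEnds hE hψ hφ hc (hU.notMem _ τ.im_pos)
  have h2 : φ (U τ) + Real.log ‖deriv U τ‖ ≤ -Real.log τ.im := by
    have := (hφ.comp (h := U) (V := {z | 0 < z.im}) hU.analyticAt hU.notMem hU.deriv_ne_zero)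
    exact this.le_neg_log_im τ.im_pos
  have hd : 0 < ‖deriv U τ‖ := norm_pos_iff.2 (hU.deriv_ne_zero _ τ.im_pos)
  have h3 : φ (U τ) = -Real.log (‖deriv U τ‖ * τ.im) := by
    refine le_antisymm ?_ h1
    rw [Real.log_mul hd.ne' τ.im_pos.ne']
    linarith
  have h4 : 0 < ‖deriv U τ‖ * τ.im := mul_pos hd τ.im_pos
  rw [h3, Real.exp_neg, Real.exp_log h4, inv_mul_cancel₀ h4.ne']

end

/-! ### From conformal metrics on the punctured sphere to the Liouville equation in the coordinate
`1 / z` -/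

section

variable {P : Finset (OnePoint ℂ)}

theorem finite_setOf_ofInv_mem : {w | ofInv w ∈ P}.Finite :=
  P.finite_toSet.preimage ofInv_injective.injOn

theorem ConformalMetric.IsCompleteKahlerEinstein.isLiouvilleOn
    {g : ConformalMetric (P : Set (OnePoint ℂ))} (hg : g.IsCompleteKahlerEinstein) :
    IsLiouvilleOn (fun w => Real.log (g.ρInv w)) {w | ofInv w ∈ P}ᶜ := by
  have hopen : IsOpen {w | ofInv w ∈ P}ᶜ := finite_setOf_ofInv_mem.isClosed.isOpen_compl
  have hmem : ∀ w ∈ {w | ofInv w ∈ P}ᶜ, ofInv w ∉ (P : Set (OnePoint ℂ)) := fun w hw => by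
    simpa using hw
  refine ⟨fun w hw => ?_, fun w hw => ?_⟩
  · have h1 : ContDiffAt ℝ ∞ g.ρInv w := (g.smooth_inv w (hmem w hw)).contDiffAt (by
      have := hopen.mem_nhds hw
      simpa [Set.compl_def] using this)
    exact (h1.of_le (WithTop.coe_le_coe.2 (le_top : (2 : ℕ∞) ≤ ⊤))).log (g.pos_inv w (hmem w hw)).ne'
  · have h1 := hg.curvature_inv w (hmem w hw)
    have hpos := g.pos_inv w (hmem w hw)
    rw [gaussCurvature, neg_div, neg_inj, div_eq_one_iff_eq (by positivity)] at h1
    rw [h1, two_mul, Real.exp_add, Real.exp_log hpos, sq]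

/-- Completeness is applied to the curve `1 / γ`, which has the same length. It converges to a point
of `P`, so it leaves every compact subset of the complement. The curves in `HasInfiniteEnds` avoid
`0` because `w = 0` is the point at infinity of the chart `z`. -/
theorem ConformalMetric.IsComplete.hasInfiniteEnds (h0 : ((0 : ℂ) : OnePoint ℂ) ∈ P)
    {g : ConformalMetric (P : Set (OnePoint ℂ))} (hg : g.IsComplete) :
    HasInfiniteEnds {w | ofInv w ∈ P} (fun w => Real.log (g.ρInv w)) := by
  intro γ hγ hmem hend
  have hnot : ∀ t, 0 ≤ t → ofInv (γ t) ∉ (P : Set (OnePoint ℂ)) := fun t ht => by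
    simpa using (hmem t ht).1
  have hcoe : ∀ t, 0 ≤ t → (((γ t)⁻¹ : ℂ) : OnePoint ℂ) = ofInv (γ t) := fun t ht =>
    (ofInv_of_ne_zero (hmem t ht).2).symm
  have hlim : ∃ x ∈ (P : Set (OnePoint ℂ)),
      Tendsto (fun t => (((γ t)⁻¹ : ℂ) : OnePoint ℂ)) atTop (𝓝 x) := by
    rcases hend with ⟨p, hp, hlim⟩ | hlim
    · refine ⟨ofInv p, by simpa using hp, ?_⟩
      refine ((continuous_ofInv.tendsto p).comp hlim).congr' ?_
      filter_upwards [eventually_ge_atTop 0] with t ht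
      exact (hcoe t ht).symm
    · refine ⟨((0 : ℂ) : OnePoint ℂ), by simpa using h0, ?_⟩
      exact (OnePoint.continuous_coe.tendsto 0).comp (tendsto_inv₀_cobounded.comp hlim)
  obtain ⟨x, hxP, hx⟩ := hlim
  have h := hg (fun t => (γ t)⁻¹) ?_ ?_ ?_
  · rw [← h]
    refine setLIntegral_congr_fun measurableSet_Ioi fun t ht => ?_
    have ht0 : (0 : ℝ) ≤ t := le_of_lt ht
    have hne := (hmem t ht0).2
    have hd : HasDerivAt (fun t => (γ t)⁻¹) (-deriv γ t / γ t ^ 2) t :=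
      ((hγ.differentiable (by simp)) t).hasDerivAt.fun_inv hne
    simp only
    rw [Real.exp_log (g.pos_inv _ (hnot t ht0)), g.compat _ hne (hnot t ht0), hd.deriv, norm_div,
      norm_neg, norm_pow]
    congr 1
    ring
  · exact hγ.contDiffOn.inv fun t ht => (hmem t ht).2
  · intro t ht
    rw [hcoe t ht]
    exact hnot t ht
  · intro K hK hKP
    have : Kᶜ ∈ 𝓝 x := hK.isClosed.isOpen_compl.mem_nhds fun hxK => hKP hxK hxP
    exact hx.eventually this

end

end PuncturedSphere

namespace PuncturedSphere

/-! ### The expansion of a covering at the cusp -/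

open Function.Periodic

/-- `F` is the expression of `1 / U` in the local parameter `q = exp (2πiτ / N)` at the cusp, and
`G` is its local inverse. -/
structure IsCuspMap (N : ℕ) (U F G : ℂ → ℂ) : Prop where
  analyticAt : AnalyticAt ℂ F 0
  analyticAt_inv : AnalyticAt ℂ G 0
  map_zero : F 0 = 0
  inv_zero : G 0 = 0
  left_inv : ∀ᶠ q in 𝓝 0, G (F q) = q
  right_inv : ∀ᶠ z in 𝓝 0, F (G z) = z
  mul_eq_one : ∀ᶠ z in comap Complex.im atTop, F (qParam N z) * U z = 1

section

open UpperHalfPlane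

variable {N : ℕ} {E : Set ℂ} {U : ℂ → ℂ}

/-- If the lower left entry of `γ` were nonzero, `Im (γ τ) ≤ 1 / Im τ < 1`. So `γ` is, up to sign, a
translation by a multiple of `N`. This makes the covering injective in the parameter `q` near the
cusp. -/
theorem IsCuspCovering.qParam_eq (hN : N ≠ 0) (hU : IsCuspCovering N E U) {τ τ' : ℍ}
    (h : U τ = U τ') (hτ : 1 < τ.im) (hτ' : 1 < τ'.im) : qParam N (τ : ℂ) = qParam N (τ' : ℂ) := by
  obtain ⟨γ, hγ, rfl⟩ := hU.exists_smul_eq τ τ' h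
  have hc : γ 1 0 = 0 := by
    by_contra hc
    have h1 := ModularGroup.im_smul_eq_div_normSq γ τ
    have h2 : τ.im ^ 2 ≤ Complex.normSq (denom γ τ) := by
      rw [Complex.normSq_apply, ModularGroup.denom_apply]
      have h3 : (1 : ℝ) ≤ (γ 1 0 : ℝ) ^ 2 := by
        have : (1 : ℤ) ≤ (γ 1 0) ^ 2 := by
          have := sq_pos_of_ne_zero hc
          omega
        exact_mod_cast this
      simp
      nlinarith [sq_nonneg ((γ 1 0 : ℝ) * τ.re + γ 1 1), mul_le_mul_of_nonneg_right h3
        (sq_nonneg τ.im)]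
    rw [h1, lt_div_iff₀ (lt_of_lt_of_le (by positivity) h2), one_mul] at hτ'
    nlinarith
  have hdet : γ 0 0 * γ 1 1 = 1 := by
    have := γ.det_coe
    rw [Matrix.det_fin_two, hc, mul_zero, sub_zero] at this
    exact this
  have hb : ((γ 0 1 : ℤ) : ZMod N) = 0 := ((CongruenceSubgroup.Gamma_mem).1 hγ).2.1
  obtain ⟨k, hk⟩ := (ZMod.intCast_zmod_eq_zero_iff_dvd _ _).1 hb |>.imp fun _ h => h
  have hN' : (N : ℂ) ≠ 0 := Nat.cast_ne_zero.2 hN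
  have key : ∃ l : ℤ, ((γ • τ : ℍ) : ℂ) = τ + l * N := by
    rw [UpperHalfPlane.specialLinearGroup_apply]
    rcases Int.eq_one_or_neg_one_of_mul_eq_one' hdet with ⟨h1, h2⟩ | ⟨h1, h2⟩
    · refine ⟨k, ?_⟩
      simp [hc, h1, h2, hk, mul_comm]
    · refine ⟨-k, ?_⟩
      simp [hc, h1, h2, hk]
      ring
  obtain ⟨l, hl⟩ := key
  rw [hl, qParam, qParam, Complex.exp_eq_exp_iff_exists_int]
  refine ⟨-l, ?_⟩
  push_cast
  field_simp
  ring

/-- `1 / U` is periodic and tends to `0`, so it extends holomorphically across `q = 0`. The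
extension is injective near `0` by `IsCuspCovering.qParam_eq`, hence has nonzero derivative there
and a local inverse. -/
theorem IsCuspCovering.exists_isCuspMap (hN : N ≠ 0) (hU : IsCuspCovering N E U) :
    ∃ F G, IsCuspMap N U F G := by
  have hN0 : (0 : ℝ) < N := Nat.cast_pos.2 (Nat.pos_of_ne_zero hN)
  set V : ℂ → ℂ := fun z => (U z)⁻¹ with hV
  set F := cuspFunction (N : ℝ) V with hF
  have hne : ∀ᶠ z in comap Complex.im atTop, U z ≠ 0 := hU.tendsto.eventually_ne_cobounded 0
  have him : ∀ᶠ z : ℂ in comap Complex.im atTop, 1 < z.im :=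
    tendsto_comap.eventually (eventually_gt_atTop 1)
  have hper : Function.Periodic V ((N : ℝ) : ℂ) := by
    intro z
    simp only [V, Complex.ofReal_natCast, hU.periodic z]
  have hzero : ZeroAtFilter (comap Complex.im atTop) V := tendsto_inv₀_cobounded.comp hU.tendsto
  have hhol : ∀ᶠ z in comap Complex.im atTop, DifferentiableAt ℂ V z := by
    filter_upwards [hne, him] with z h1 h2
    exact (hU.analyticAt z (by linarith)).differentiableAt.inv h1
  have hF0 : F 0 = 0 := cuspFunction_zero_of_zero_at_inf hN0 hzero
  have hFan : AnalyticAt ℂ F 0 := by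
    rw [Complex.analyticAt_iff_eventually_differentiableAt]
    have h1 := eventually_differentiableAt_cuspFunction_nhds_ne_zero hN0 hper hhol
    have h2 := differentiableAt_cuspFunction_zero hN0 hper hhol hzero.boundedAtFilter
    rw [eventually_nhdsWithin_iff] at h1
    filter_upwards [h1] with q hq
    by_cases h : q = 0
    · rw [h]; exact h2
    · exact hq h
  have hinj : ∀ᶠ q in 𝓝 (0 : ℂ), q ≠ 0 → U (invQParam N q) ≠ 0 ∧ 1 < (invQParam N q).im := by
    have := (invQParam_tendsto hN0).eventually (hne.and him)
    rwa [eventually_nhdsWithin_iff] at this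
  have hFq : ∀ q, q ≠ 0 → F q = (U (invQParam N q))⁻¹ := fun q hq =>
    cuspFunction_eq_of_nonzero _ _ hq
  have hFd : deriv F 0 ≠ 0 := by
    refine AnalyticAt.deriv_ne_zero_of_injOn hFan hinj fun q hq q' hq' h => ?_
    by_cases h0 : q = 0
    · by_cases h0' : q' = 0
      · rw [h0, h0']
      · rw [h0, hF0, hFq _ h0'] at h
        exact absurd h.symm (inv_ne_zero (hq' h0').1)
    · by_cases h0' : q' = 0
      · rw [h0', hF0, hFq _ h0] at h
        exact absurd h (inv_ne_zero (hq h0).1)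
      · rw [hFq _ h0, hFq _ h0', inv_inj] at h
        have h1 := (hq h0).2
        have h2 := (hq' h0').2
        have := hU.qParam_eq hN (τ := ⟨invQParam N q, by linarith⟩)
          (τ' := ⟨invQParam N q', by linarith⟩) h h1 h2
        simp only at this
        rwa [qParam_right_inv hN0.ne' h0, qParam_right_inv hN0.ne' h0'] at this
  obtain ⟨G, hG, hG0, hr, hl⟩ := AnalyticAt.exists_local_inverse hFan hFd
  rw [hF0] at hG hG0 hr
  refine ⟨F, G, hFan, hG, hF0, hG0, hl, hr, ?_⟩
  filter_upwards [hne] with z hz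
  rw [hF, eq_cuspFunction hN0.ne' hper, inv_mul_cancel₀ hz]

theorem IsCuspMap.tendsto_inv {F G : ℂ → ℂ} (h : IsCuspMap N U F G) :
    Tendsto G (𝓝[≠] 0) (𝓝[≠] 0) := by
  refine tendsto_nhdsWithin_iff.2 ⟨?_, ?_⟩
  · have := h.analyticAt_inv.continuousAt.tendsto
    rw [h.inv_zero] at this
    exact this.mono_left nhdsWithin_le_nhds
  · filter_upwards [eventually_nhdsWithin_of_eventually_nhds h.right_inv, self_mem_nhdsWithin]
      with z hz hz0 hG
    have hG' : G z = 0 := hG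
    rw [hG', h.map_zero] at hz
    exact hz0 hz.symm

theorem IsCuspMap.deriv_mul_deriv {F G : ℂ → ℂ} (h : IsCuspMap N U F G) :
    ∀ᶠ z in 𝓝 0, deriv F (G z) * deriv G z = 1 := by
  have h1 : Tendsto G (𝓝 0) (𝓝 0) := by
    have := h.analyticAt_inv.continuousAt.tendsto
    rwa [h.inv_zero] at this
  filter_upwards [h.right_inv.eventually_nhds, h.analyticAt_inv.eventually_analyticAt,
    h1.eventually h.analyticAt.eventually_analyticAt] with z hz hG hF
  have h4 := hF.differentiableAt.hasDerivAt.comp z hG.differentiableAt.hasDerivAt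
  have h5 : (F ∘ G) =ᶠ[𝓝 z] id := hz
  exact h4.unique ((hasDerivAt_id z).congr_of_eventuallyEq h5)

theorem IsCuspMap.deriv_ne_zero {F G : ℂ → ℂ} (h : IsCuspMap N U F G) : deriv F 0 ≠ 0 := by
  have := h.deriv_mul_deriv.self_of_nhds
  rw [h.inv_zero] at this
  exact left_ne_zero_of_mul_eq_one this

/-- Points near the cusp, parametrized by the values of `1 / U`. -/
theorem IsCuspMap.tendsto_invQParam (hN : N ≠ 0) {F G : ℂ → ℂ} (h : IsCuspMap N U F G) :
    Tendsto (fun z => invQParam N (G z)) (𝓝[≠] 0) (comap Complex.im atTop) :=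
  (invQParam_tendsto (Nat.cast_pos.2 (Nat.pos_of_ne_zero hN))).comp h.tendsto_inv

theorem IsCuspMap.eventually_qParam_invQParam (hN : N ≠ 0) {F G : ℂ → ℂ}
    (h : IsCuspMap N U F G) : ∀ᶠ z in 𝓝[≠] 0, qParam N (invQParam N (G z)) = G z := by
  filter_upwards [h.tendsto_inv.eventually self_mem_nhdsWithin] with z hz
  exact qParam_right_inv (Nat.cast_ne_zero.2 hN) hz

theorem IsCuspMap.eventually_eq_inv (hN : N ≠ 0) {F G : ℂ → ℂ} (h : IsCuspMap N U F G) :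
    ∀ᶠ z in 𝓝[≠] 0, U (invQParam N (G z)) = z⁻¹ := by
  filter_upwards [h.eventually_qParam_invQParam hN, (h.tendsto_invQParam hN).eventually
    h.mul_eq_one, eventually_nhdsWithin_of_eventually_nhds h.right_inv] with z h1 h2 h3
  rw [h1, h3] at h2
  exact eq_inv_of_mul_eq_one_right h2

end

/-! ### Rigidity of the coverings -/

/-- Removable singularities followed by Liouville's theorem. -/
theorem exists_eq_const_of_bounded_compl_finite {E : Set ℂ} (hE : E.Finite) {g : ℂ → ℂ}
    (hg : ∀ w ∉ E, DifferentiableAt ℂ g w) {C : ℝ} (hC : ∀ w ∉ E, ‖g w‖ ≤ C) :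
    ∃ β, ∀ w ∉ E, g w = β := by
  set k : ℂ → ℂ := fun w => limUnder (𝓝[≠] w) g with hk
  have hkg : ∀ w ∉ E, k w = g w := fun w hw =>
    ((hg w hw).continuousAt.tendsto.mono_left nhdsWithin_le_nhds).limUnder_eq
  have hdiff : Differentiable ℂ k := by
    intro w
    set s : Set ℂ := (E \ {w})ᶜ with hs
    have hso : s ∈ 𝓝 w := (hE.subset Set.sdiff_subset).isClosed.isOpen_compl.mem_nhds (by simp)
    have hmem : ∀ y ∈ s \ {w}, y ∉ E := fun y hy hyE => hy.1 ⟨hyE, hy.2⟩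
    have h1 := Complex.differentiableOn_update_limUnder_of_bddAbove (f := g) hso
      (fun y hy => (hg y (hmem y hy)).differentiableWithinAt)
      ⟨C, by rintro _ ⟨y, hy, rfl⟩; exact hC y (hmem y hy)⟩
    refine (h1.differentiableAt hso).congr_of_eventuallyEq ?_
    filter_upwards [hso] with y hy
    by_cases hyw : y = w
    · subst hyw; simp [k]
    · rw [Function.update_of_ne hyw, hkg y (hmem y ⟨hy, hyw⟩)]
  have hb : Bornology.IsBounded (Set.range k) := by
    refine ((hE.image k).isBounded.union (Metric.isBounded_closedBall (x := (0 : ℂ))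
      (r := C))).subset ?_
    rintro _ ⟨w, rfl⟩
    by_cases hw : w ∈ E
    · exact Or.inl ⟨w, hw, rfl⟩
    · right
      simpa [hkg w hw] using hC w hw
  exact ⟨k 0, fun w hw => by rw [← hkg w hw]; exact hdiff.apply_eq_apply_of_bounded hb w 0⟩

section

open UpperHalfPlane

variable {N : ℕ} {E E₀ : Set ℂ} {U U₀ : ℂ → ℂ}

/-- Two coverings with the same deck transformation group differ by an injective holomorphic map
of the bases. -/
theorem IsCuspCovering.exists_comp_eq (hU : IsCuspCovering N E U) (hU₀ : IsCuspCovering N E₀ U₀) :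
    ∃ ψ : ℂ → ℂ, (∀ z : ℂ, 0 < z.im → ψ (U₀ z) = U z) ∧ Set.InjOn ψ E₀ᶜ ∧
      ∀ w ∉ E₀, DifferentiableAt ℂ ψ w := by
  have hsurj := hU₀.surj
  choose! σ hσ using hsurj
  have hψ : ∀ z : ℂ, 0 < z.im → U (σ (U₀ z)) = U z := by
    intro z hz
    obtain ⟨γ, hγ, h⟩ := hU₀.exists_smul_eq ⟨z, hz⟩ (σ (U₀ z)) (hσ _ (hU₀.notMem _ hz)).symm
    rw [h, hU.smul γ hγ]
  refine ⟨fun w => U (σ w), hψ, fun w hw w' hw' h => ?_, fun w hw => ?_⟩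
  · obtain ⟨γ, hγ, h1⟩ := hU.exists_smul_eq _ _ h
    rw [← hσ w hw, ← hσ w' hw', h1, hU₀.smul γ hγ]
  · obtain ⟨τ, rfl⟩ := hU₀.surj w hw
    obtain ⟨G, hG, hGτ, hGr, -⟩ := AnalyticAt.exists_local_inverse (hU₀.analyticAt _ τ.im_pos)
      (hU₀.deriv_ne_zero _ τ.im_pos)
    have him : ∀ᶠ y in 𝓝 (U₀ τ), 0 < (G y).im := by
      have := hG.continuousAt.eventually (isOpen_upperHalf.mem_nhds (x := G (U₀ τ))
        (by rw [hGτ]; exact τ.im_pos))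
      exact this
    have h1 : DifferentiableAt ℂ (U ∘ G) (U₀ τ) := by
      refine DifferentiableAt.comp _ ?_ hG.differentiableAt
      rw [hGτ]
      exact (hU.analyticAt _ τ.im_pos).differentiableAt
    refine h1.congr_of_eventuallyEq ?_
    filter_upwards [him, hGr] with y h2 h3
    rw [Function.comp_apply, ← hψ _ h2, h3]

/-- Two coverings with the same deck transformation group and a pole at the same cusp differ by an
affine map. -/
theorem IsCuspCovering.exists_eq_mul_add (hN : N ≠ 0) (hU : IsCuspCovering N E U)
    (hU₀ : IsCuspCovering N E₀ U₀) (hE₀ : E₀.Finite) :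
    ∃ α β : ℂ, α ≠ 0 ∧ ∀ z : ℂ, 0 < z.im → U z = α * U₀ z + β := by
  obtain ⟨ψ, hψ, hψi, hψd⟩ := hU.exists_comp_eq hU₀
  obtain ⟨F, G, h⟩ := hU.exists_isCuspMap hN
  obtain ⟨F₀, G₀, h₀⟩ := hU₀.exists_isCuspMap hN
  have hpos : ∀ᶠ z : ℂ in comap Complex.im atTop, 0 < z.im :=
    tendsto_comap.eventually (eventually_gt_atTop 0)
  -- the map at infinity
  set K : ℂ → ℂ := F ∘ G₀ with hK
  have hK0 : K 0 = 0 := by simp [K, h₀.inv_zero, h.map_zero]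
  have hKan : AnalyticAt ℂ K 0 := by
    refine AnalyticAt.comp ?_ h₀.analyticAt_inv
    rw [h₀.inv_zero]
    exact h.analyticAt
  have hKd : deriv K 0 ≠ 0 := by
    have h1 : HasDerivAt F (deriv F 0) (G₀ 0) := by
      rw [h₀.inv_zero]
      exact h.analyticAt.differentiableAt.hasDerivAt
    have h2 := h1.comp 0 h₀.analyticAt_inv.differentiableAt.hasDerivAt
    rw [hK, h2.deriv]
    refine mul_ne_zero h.deriv_ne_zero ?_
    exact right_ne_zero_of_mul_eq_one h₀.deriv_mul_deriv.self_of_nhds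
  have hψK : ∀ᶠ z in 𝓝[≠] 0, ψ z⁻¹ * K z = 1 := by
    filter_upwards [h₀.eventually_qParam_invQParam hN, (h₀.tendsto_invQParam hN).eventually
      (h.mul_eq_one.and hpos), h₀.eventually_eq_inv hN] with z h1 h2 h3
    rw [h1] at h2
    rw [← h3, hψ _ h2.2, mul_comm]
    exact h2.1
  set k : ℂ → ℂ := dslope K 0 with hk
  have hkan : AnalyticAt ℂ k 0 := by
    obtain ⟨p, hp⟩ := hKan
    exact hp.has_fpower_series_dslope_fslope.analyticAt
  have hk0 : k 0 ≠ 0 := by rwa [hk, dslope_same]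
  -- Near infinity `ψ w = 1 / K (1 / w) = w * m (1 / w)`, so `ψ w - m 0 * w` tends to `m'(0)`: the
  -- pole of `ψ` is simple.
  set m : ℂ → ℂ := fun z => (k z)⁻¹ with hm
  have hman : AnalyticAt ℂ m 0 := hkan.inv hk0
  have hlim : Tendsto (fun w => ψ w - m 0 * w) (Bornology.cobounded ℂ) (𝓝 (deriv m 0)) := by
    have h1 : Tendsto (dslope m 0) (𝓝[≠] 0) (𝓝 (deriv m 0)) := by
      have : ContinuousAt (dslope m 0) 0 := continuousAt_dslope_same.2 hman.differentiableAt
      have := this.tendsto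
      rw [dslope_same] at this
      exact this.mono_left nhdsWithin_le_nhds
    refine (h1.comp tendsto_inv₀_cobounded').congr' ?_
    filter_upwards [tendsto_inv₀_cobounded'.eventually hψK, tendsto_inv₀_cobounded'.eventually
      (self_mem_nhdsWithin : ({0}ᶜ : Set ℂ) ∈ 𝓝[≠] 0)] with w h2 h3
    have h3' : w⁻¹ ≠ 0 := h3
    have hw : w ≠ 0 := fun h => h3' (by rw [h, inv_zero])
    rw [inv_inv] at h2
    have h4 : K w⁻¹ = w⁻¹ * k w⁻¹ := by
      have := sub_smul_dslope K 0 w⁻¹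
      rw [hK0, sub_zero, sub_zero, smul_eq_mul] at this
      exact this.symm
    have h5 : ψ w = w * m w⁻¹ := by
      rw [h4] at h2
      have hkw : k w⁻¹ ≠ 0 := by
        rintro h; rw [h] at h2; simp at h2
      simp only [m]
      rw [eq_mul_inv_iff_mul_eq₀ hkw]
      field_simp at h2
      simpa [one_div] using h2
    rw [Function.comp_apply, dslope_of_ne _ h3', slope_def_field, h5, sub_zero, div_inv_eq_mul]
    ring
  -- boundedness
  obtain ⟨C₁, hC₁⟩ : ∃ C, ∀ᶠ w in Bornology.cobounded ℂ, ‖ψ w - m 0 * w‖ ≤ C := by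
    refine ⟨‖deriv m 0‖ + 1, ?_⟩
    exact (hlim.norm.eventually (gt_mem_nhds (lt_add_one _))).mono fun w hw => hw.le
  rw [← comap_norm_atTop, eventually_comap] at hC₁
  obtain ⟨R₁, hR₁⟩ := eventually_atTop.1 hC₁
  -- All large values of `ψ` are already taken outside the disc of radius `R₁`. As `ψ` is injective,
  -- it is bounded by `R₂` inside, including near the punctures.
  obtain ⟨R₂, hR₂⟩ : ∃ R, ∀ v : ℂ, R ≤ ‖v‖ → ∃ z : ℂ, 0 < z.im ∧ U z = v ∧ R₁ < ‖U₀ z‖ := by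
    have hlarge : ∀ᶠ z in comap Complex.im atTop, R₁ < ‖U₀ z‖ :=
      (tendsto_norm_cobounded_atTop.comp hU₀.tendsto).eventually (eventually_gt_atTop R₁)
    have h1 := tendsto_inv₀_cobounded'.eventually (((h.tendsto_invQParam hN).eventually
      (hlarge.and hpos)).and (h.eventually_eq_inv hN))
    rw [← comap_norm_atTop, eventually_comap] at h1
    obtain ⟨R, hR⟩ := eventually_atTop.1 h1
    refine ⟨R, fun v hv => ?_⟩
    obtain ⟨⟨h2, h3⟩, h4⟩ := hR _ hv v rfl
    exact ⟨_, h3, by rw [h4, inv_inv], h2⟩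
  have hbdd : ∀ w ∉ E₀, ‖ψ w - m 0 * w‖ ≤ max C₁ (R₂ + ‖m 0‖ * R₁) := by
    intro w hw
    rcases le_or_gt R₁ ‖w‖ with h1 | h1
    · exact (hR₁ _ h1 w rfl).trans (le_max_left _ _)
    · refine le_trans ?_ (le_max_right _ _)
      have h2 : ‖ψ w‖ ≤ R₂ := by
        by_contra! h2
        obtain ⟨z, hz, hzψ, hz'⟩ := hR₂ _ h2.le
        rw [← hψ z hz] at hzψ
        rw [hψi (hU₀.notMem z hz) hw hzψ] at hz'
        exact lt_asymm h1 hz'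
      calc ‖ψ w - m 0 * w‖ ≤ ‖ψ w‖ + ‖m 0 * w‖ := norm_sub_le _ _
        _ ≤ R₂ + ‖m 0‖ * R₁ := by
            rw [norm_mul]
            gcongr
  obtain ⟨β, hβ⟩ := exists_eq_const_of_bounded_compl_finite hE₀
    (g := fun w => ψ w - m 0 * w) (fun w hw => (hψd w hw).sub (by fun_prop)) hbdd
  refine ⟨m 0, β, inv_ne_zero hk0, fun z hz => ?_⟩
  rw [← hβ _ (hU₀.notMem z hz), hψ z hz]
  ring

end

end PuncturedSphere

namespace PuncturedSphere

/-! ### The inverse of the expansion at the cusp -/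

open Function.Periodic

section

variable {N : ℕ} {U F G : ℂ → ℂ}

theorem analyticAt_dslope {f : ℂ → ℂ} {a : ℂ} (hf : AnalyticAt ℂ f a) :
    AnalyticAt ℂ (dslope f a) a := by
  obtain ⟨p, hp⟩ := hf
  exact hp.has_fpower_series_dslope_fslope.analyticAt

theorem mul_dslope_zero {f : ℂ → ℂ} (hf : f 0 = 0) (x : ℂ) : x * dslope f 0 x = f x := by
  simpa [hf] using sub_smul_dslope f 0 x

theorem IsCuspMap.exists_eq_mul_exp (h : IsCuspMap N U F G) :
    ∃ H : ℂ → ℂ, AnalyticAt ℂ H 0 ∧ H 0 = 0 ∧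
      ∀ᶠ x in 𝓝 0, G (deriv F 0 * x) = x * Complex.exp (H x) := by
  set k : ℂ → ℂ := fun x => G (deriv F 0 * x) with hk
  have hkan : AnalyticAt ℂ k 0 := by
    refine AnalyticAt.comp (g := G) (f := fun x => deriv F 0 * x) ?_ (by fun_prop)
    rw [mul_zero]
    exact h.analyticAt_inv
  have hk0 : k 0 = 0 := by simp [k, h.inv_zero]
  have hkd : deriv k 0 = 1 := by
    have h1 : HasDerivAt G (deriv G 0) (deriv F 0 * 0) := by
      rw [mul_zero]
      exact h.analyticAt_inv.differentiableAt.hasDerivAt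
    have h2 := h1.comp (0 : ℂ) ((hasDerivAt_id (0 : ℂ)).const_mul (deriv F 0))
    have h3 := h.deriv_mul_deriv.self_of_nhds
    rw [h.inv_zero] at h3
    rw [show deriv k 0 = _ from h2.deriv, mul_one, mul_comm, h3]
  have h1 : AnalyticAt ℂ (dslope k 0) 0 := analyticAt_dslope hkan
  refine ⟨fun x => Complex.log (dslope k 0 x), h1.clog ?_, ?_, ?_⟩
  · rw [dslope_same, hkd]
    exact Complex.one_mem_slitPlane
  · simp [dslope_same, hkd]
  · have hne : dslope k 0 0 ≠ 0 := by rw [dslope_same, hkd]; exact one_ne_zero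
    filter_upwards [h1.continuousAt.eventually_ne hne] with x hx
    rw [Complex.exp_log hx, mul_dslope_zero hk0]

/-- With `u q = F q / q = A + B q + ⋯`, the relation `F (G (A x)) = A x` reads `exp (H x) * u (x exp
(H x)) = A`; its derivative at `0` is `A H'(0) + B = 0`. -/
theorem IsCuspMap.deriv_dslope_eq (h : IsCuspMap N U F G) {H : ℂ → ℂ} (hH : AnalyticAt ℂ H 0)
    (hH0 : H 0 = 0) (hGH : ∀ᶠ x in 𝓝 0, G (deriv F 0 * x) = x * Complex.exp (H x)) :
    deriv (dslope F 0) 0 / deriv F 0 = -deriv H 0 := by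
  set A := deriv F 0 with hA
  have hA0 : A ≠ 0 := h.deriv_ne_zero
  set u := dslope F 0 with hu
  have huan : AnalyticAt ℂ u 0 := analyticAt_dslope h.analyticAt
  have hu0 : u 0 = A := dslope_same _ _
  have hmul : Tendsto (fun x => A * x) (𝓝 0) (𝓝 0) := by
    simpa using (continuous_const_mul A).tendsto 0
  have hev : (fun x => Complex.exp (H x) * u (x * Complex.exp (H x))) =ᶠ[𝓝 0] fun _ => A := by
    filter_upwards [hGH, hmul.eventually h.right_inv] with x h1 h2
    by_cases hx : x = 0
    · simp [hx, hH0, hu0]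
    · rw [h1, ← mul_dslope_zero h.map_zero] at h2
      have : x * (Complex.exp (H x) * u (x * Complex.exp (H x))) = x * A := by
        rw [← mul_assoc, h2, mul_comm]
      exact mul_left_cancel₀ hx this
  have hHd := hH.differentiableAt.hasDerivAt
  have h1 : HasDerivAt (fun x => Complex.exp (H x)) (Complex.exp (H 0) * deriv H 0) 0 := hHd.cexp
  have h2 := (hasDerivAt_id' (0 : ℂ)).fun_mul h1
  have h3 : HasDerivAt u (deriv u 0) ((0 : ℂ) * Complex.exp (H 0)) := by
    rw [zero_mul]
    exact huan.differentiableAt.hasDerivAt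
  have h4 := h1.fun_mul (h3.comp 0 h2)
  have h5 := h4.unique ((hasDerivAt_const (0 : ℂ) A).congr_of_eventuallyEq hev)
  simp [hH0, hu0] at h5
  field_simp
  linear_combination h5

end

section

variable {N : ℕ} {U U₀ F G F₀ G₀ : ℂ → ℂ} {α β : ℂ}

/-- In the coordinate `z = 1 / U` the relation `U = α U₀ + β` becomes `1 / U₀ = α z / (1 - β z)`. -/
theorem IsCuspMap.eq_comp_moebius (hN : N ≠ 0) (h : IsCuspMap N U F G)
    (h₀ : IsCuspMap N U₀ F₀ G₀) (hα : α ≠ 0) (hU : ∀ z : ℂ, 0 < z.im → U z = α * U₀ z + β) :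
    ∀ᶠ z in 𝓝 0, G z = G₀ (α * z / (1 - β * z)) := by
  have hpos : ∀ᶠ z : ℂ in comap Complex.im atTop, 0 < z.im :=
    tendsto_comap.eventually (eventually_gt_atTop 0)
  have h1 : ∀ᶠ z in 𝓝[≠] 0, G z = G₀ (α * z / (1 - β * z)) := by
    filter_upwards [h.eventually_qParam_invQParam hN, (h.tendsto_invQParam hN).eventually
      (h₀.mul_eq_one.and hpos), h.eventually_eq_inv hN, (h.tendsto_inv.mono_right
      nhdsWithin_le_nhds).eventually h₀.left_inv, self_mem_nhdsWithin] with z h1 h2 h3 h4 hz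
    have hz : z ≠ 0 := hz
    rw [h1] at h2
    rw [hU _ h2.2] at h3
    conv_lhs => rw [← h4]
    congr 1
    have h5 : U₀ (invQParam N (G z)) = (1 - β * z) / (α * z) := by
      field_simp
      field_simp at h3
      linear_combination h3
    rw [h5] at h2
    rw [eq_div_iff, ← mul_right_inj' (one_ne_zero (α := ℂ))]
    · have := h2.1
      field_simp at this
      linear_combination this
    · intro h0
      rw [h0] at h2
      simp at h2
  rw [eventually_nhdsWithin_iff] at h1
  filter_upwards [h1] with z hz
  by_cases h0 : z = 0
  · simp [h0, h.inv_zero, h₀.inv_zero]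
  · exact hz h0

theorem IsCuspMap.deriv_eq_div (hN : N ≠ 0) (h : IsCuspMap N U F G)
    (h₀ : IsCuspMap N U₀ F₀ G₀) (hα : α ≠ 0) (hU : ∀ z : ℂ, 0 < z.im → U z = α * U₀ z + β) :
    α * deriv F 0 = deriv F₀ 0 := by
  have h1 := h.eq_comp_moebius hN h₀ hα hU
  have h2 : HasDerivAt (fun z => α * z / (1 - β * z)) α 0 := by
    have := ((hasDerivAt_id' (0 : ℂ)).const_mul α).fun_div
      (((hasDerivAt_id' (0 : ℂ)).const_mul β).const_sub 1) (by simp)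
    simpa using this
  have h3 : HasDerivAt G₀ (deriv G₀ 0) (α * 0 / (1 - β * 0)) := by
    simpa using h₀.analyticAt_inv.differentiableAt.hasDerivAt
  have h4 := (h3.comp (0 : ℂ) h2).congr_of_eventuallyEq h1
  have h5 := h.deriv_mul_deriv.self_of_nhds
  have h6 := h₀.deriv_mul_deriv.self_of_nhds
  rw [h.inv_zero, h4.deriv] at h5
  rw [h₀.inv_zero] at h6
  linear_combination (-α * deriv F 0) * h6 + deriv F₀ 0 * h5

/-- The logarithm of `G (A x) / x`, for a covering with parameter `s` relative to a fixed one. -/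
noncomputable def shiftedLog (H : ℂ → ℂ) (s x : ℂ) : ℂ :=
  H (x / (1 - s * x)) - Complex.log (1 - s * x)

theorem hasDerivAt_div_one_sub (s : ℂ) : HasDerivAt (fun x : ℂ => x / (1 - s * x)) 1 0 := by
  have := (hasDerivAt_id' (0 : ℂ)).fun_div
    (((hasDerivAt_id' (0 : ℂ)).const_mul s).const_sub 1) (by simp)
  simpa using this

theorem analyticAt_shiftedLog {H : ℂ → ℂ} (hH : AnalyticAt ℂ H 0) (s : ℂ) :
    AnalyticAt ℂ (shiftedLog H s) 0 := by
  have h1 : AnalyticAt ℂ (fun x : ℂ => 1 - s * x) 0 := by fun_prop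
  refine AnalyticAt.sub (AnalyticAt.comp (g := H) (f := fun x => x / (1 - s * x)) ?_
    (analyticAt_id.div h1 (by simp))) (h1.clog (by simp))
  simpa using hH

theorem shiftedLog_zero {H : ℂ → ℂ} (hH : H 0 = 0) (s : ℂ) : shiftedLog H s 0 = 0 := by
  simp [shiftedLog, hH]

theorem deriv_shiftedLog {H : ℂ → ℂ} (hH : AnalyticAt ℂ H 0) (s : ℂ) :
    deriv (shiftedLog H s) 0 = deriv H 0 + s := by
  have h1 : HasDerivAt H (deriv H 0) (0 / (1 - s * 0)) := by
    simpa using hH.differentiableAt.hasDerivAt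
  have h2 := (((hasDerivAt_id (0 : ℂ)).const_mul s).const_sub 1).clog (by simp)
  have h3 := (h1.comp (0 : ℂ) (hasDerivAt_div_one_sub s)).sub h2
  rw [show deriv (shiftedLog H s) 0 = _ from h3.deriv]
  simp

/-- The inverse of the expansion of a covering at the cusp depends, up to scaling, on one parameter
only. -/
theorem IsCuspCovering.exists_forall_eq_mul_exp (hN : N ≠ 0) {E₀ : Set ℂ}
    (hU₀ : IsCuspCovering N E₀ U₀) (hE₀ : E₀.Finite) :
    ∃ H : ℂ → ℂ, AnalyticAt ℂ H 0 ∧ H 0 = 0 ∧ ∀ (E : Set ℂ) (U F G : ℂ → ℂ),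
      IsCuspCovering N E U → IsCuspMap N U F G →
        ∀ᶠ x in 𝓝 0, G (deriv F 0 * x) = x * Complex.exp
          (shiftedLog H (-deriv H 0 - deriv (dslope F 0) 0 / deriv F 0) x) := by
  obtain ⟨F₀, G₀, h₀⟩ := hU₀.exists_isCuspMap hN
  obtain ⟨H, hH, hH0, hG₀⟩ := h₀.exists_eq_mul_exp
  refine ⟨H, hH, hH0, fun E U F G hU h => ?_⟩
  obtain ⟨α, β, hα, hαβ⟩ := hU.exists_eq_mul_add hN hU₀ hE₀
  have hA := h.deriv_eq_div hN h₀ hα hαβ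
  have hA₀ := h₀.deriv_ne_zero
  set s := β * deriv F 0 with hs
  have hlim : Tendsto (fun x : ℂ => deriv F 0 * x) (𝓝 0) (𝓝 0) := by
    simpa using (continuous_const_mul (deriv F 0)).tendsto 0
  have hlim' : Tendsto (fun x : ℂ => x / (1 - s * x)) (𝓝 0) (𝓝 0) := by
    simpa using (hasDerivAt_div_one_sub s).continuousAt.tendsto
  have hne : ∀ᶠ x : ℂ in 𝓝 0, 1 - s * x ≠ 0 := by
    have : ContinuousAt (fun x : ℂ => 1 - s * x) 0 := by fun_prop
    exact this.eventually_ne (by simp)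
  have key : ∀ᶠ x in 𝓝 0, G (deriv F 0 * x) = x * Complex.exp (shiftedLog H s x) := by
    filter_upwards [hlim.eventually (h.eq_comp_moebius hN h₀ hα hαβ), hlim'.eventually hG₀, hne]
      with x h1 h2 h3
    -- Since `α A = A₀`, the Möbius map becomes `x ↦ y = x / (1 - s x)` in the normalized
    -- coordinates. Then `y exp (H y) = x exp (H y - log (1 - s x))`, which is the definition of
    -- `shiftedLog`.
    have h4 : α * (deriv F 0 * x) / (1 - β * (deriv F 0 * x)) =
        deriv F₀ 0 * (x / (1 - s * x)) := by
      rw [← hA, hs]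
      ring
    rw [h1, h4, h2, shiftedLog, Complex.exp_sub, Complex.exp_log h3]
    ring
  -- Reading off the linear coefficient gives `B / A = -(H'(0) + s)`, so `s` is determined by `B /
  -- A`.
  have h1 := h.deriv_dslope_eq (analyticAt_shiftedLog hH s) (shiftedLog_zero hH0 s) key
  rw [deriv_shiftedLog hH] at h1
  rw [h1]
  convert key using 6
  ring

end

/-! ### The metric at the cusp -/

section

open UpperHalfPlane

variable {N : ℕ} {E : Set ℂ} {U F G : ℂ → ℂ}

theorem hasDerivAt_qParam (h : ℝ) (z : ℂ) :
    HasDerivAt (qParam h) (qParam h z * (2 * Real.pi * Complex.I / h)) z := by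
  simpa only [mul_one, qParam] using!
    (((hasDerivAt_id' z).const_mul (2 * Real.pi * Complex.I)).div_const (h : ℂ)).cexp

/-- At the point `τ` with `q = G z` one has `Im τ = -(N / 2π) log |q|` and `|U'(τ)| = (2π / N) |q| /
(|G' z| |z|²)`; the factors of `N / 2π` cancel in `exp φ = 1 / (|U'| Im τ)`. -/
theorem IsCuspMap.exp_eq (hN : N ≠ 0) (hU : IsCuspCovering N E U) (h : IsCuspMap N U F G)
    (hE : E.Finite) {φ : ℂ → ℝ} (hφ : IsLiouvilleOn φ Eᶜ) (hc : HasInfiniteEnds E φ) :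
    ∀ᶠ z in 𝓝[≠] 0, Real.exp (φ z⁻¹) =
      ‖z‖ ^ 2 * (‖deriv G z‖ / (‖G z‖ * |Real.log ‖G z‖|)) := by
  have hN0 : (0 : ℝ) < N := Nat.cast_pos.2 (Nat.pos_of_ne_zero hN)
  have hpos : ∀ᶠ z : ℂ in comap Complex.im atTop, 0 < z.im :=
    tendsto_comap.eventually (eventually_gt_atTop 0)
  have hloc : ∀ᶠ z in comap Complex.im atTop, ∀ᶠ y in 𝓝 z, F (qParam N y) * U y = 1 := by
    have := h.mul_eq_one
    rw [eventually_comap] at this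
    obtain ⟨Y, hY⟩ := eventually_atTop.1 this
    filter_upwards [tendsto_comap.eventually (eventually_gt_atTop Y)] with z hz
    filter_upwards [(isOpen_lt continuous_const Complex.continuous_im).mem_nhds hz] with y hy
    exact hY _ (le_of_lt hy) y rfl
  have hlimG : Tendsto G (𝓝[≠] 0) (𝓝 0) := h.tendsto_inv.mono_right nhdsWithin_le_nhds
  filter_upwards [h.eventually_qParam_invQParam hN, (h.tendsto_invQParam hN).eventually
    (hloc.and hpos), h.eventually_eq_inv hN, hlimG.eventually h.analyticAt.eventually_analyticAt,
    eventually_nhdsWithin_of_eventually_nhds h.right_inv,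
    eventually_nhdsWithin_of_eventually_nhds h.deriv_mul_deriv, self_mem_nhdsWithin,
    h.tendsto_inv.eventually self_mem_nhdsWithin] with z h1 h2 h3 h4 h5 h6 hz hGz
  have hz : z ≠ 0 := hz
  have hGz : G z ≠ 0 := hGz
  set τ : ℂ := invQParam N (G z) with hτ
  have hτ0 : 0 < τ.im := h2.2
  have hd : HasDerivAt (fun y => F (qParam N y))
      (deriv F (G z) * (G z * (2 * Real.pi * Complex.I / N))) τ := by
    have h7 := hasDerivAt_qParam N τ
    have h8 : HasDerivAt F (deriv F (G z)) (qParam N τ) := by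
      rw [h1]; exact h4.differentiableAt.hasDerivAt
    have := h8.comp τ h7
    rw [h1] at this
    exact_mod_cast this
  have hFz : F (qParam N τ) = z := by rw [h1, h5]
  have hUd : deriv U τ = -(deriv F (G z) * (G z * (2 * Real.pi * Complex.I / N))) / z ^ 2 := by
    have h7 := hd.fun_inv (by rw [hFz]; exact hz)
    rw [hFz] at h7
    refine (h7.congr_of_eventuallyEq ?_).deriv
    filter_upwards [h2.1] with y hy
    exact eq_inv_of_mul_eq_one_right hy
  have him : τ.im = -(N / (2 * Real.pi)) * Real.log ‖G z‖ := by
    rw [hτ, im_invQParam, neg_div]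
  have hlog : Real.log ‖G z‖ < 0 := by
    rw [him] at hτ0
    by_contra! hcon
    have : 0 ≤ (N / (2 * Real.pi)) * Real.log ‖G z‖ := mul_nonneg (by positivity) hcon
    linarith
  have hmain := hU.exp_mul_norm_deriv_mul_im hE hφ hc ⟨τ, hτ0⟩
  simp only [h3, hUd, him, mk_im] at hmain
  have h9 : ‖deriv F (G z)‖ * ‖deriv G z‖ = 1 := by rw [← norm_mul, h6, norm_one]
  have h10 : ‖deriv G z‖ ≠ 0 := right_ne_zero_of_mul_eq_one h9
  have h11 : ‖deriv F (G z)‖ = ‖deriv G z‖⁻¹ := eq_inv_of_mul_eq_one_left h9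
  have hzn : ‖z‖ ≠ 0 := norm_ne_zero_iff.2 hz
  have hGn : ‖G z‖ ≠ 0 := norm_ne_zero_iff.2 hGz
  have hpi := Real.pi_pos
  have h12 : ‖(2 * Real.pi * Complex.I / N : ℂ)‖ = 2 * Real.pi / N := by
    simp [abs_of_pos hpi]
  rw [norm_div, norm_neg, norm_mul, norm_mul, h12, h11, norm_pow] at hmain
  rw [abs_of_neg hlog]
  have hlog' := hlog.ne
  field_simp at hmain ⊢
  linear_combination (-1 : ℝ) * hmain

theorem IsCuspMap.exists_hasSum (h : IsCuspMap N U F G) :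
    ∃ c : ℕ → ℂ, (∀ᶠ q in 𝓝 0, HasSum (fun n => c n * q ^ n) (F q)) ∧ c 0 = 0 ∧
      c 1 = deriv F 0 ∧ c 2 = deriv (dslope F 0) 0 := by
  obtain ⟨p, hp⟩ := h.analyticAt
  refine ⟨p.coeff, ?_, ?_, ?_, ?_⟩
  · have := hasFPowerSeriesAt_iff'.1 hp
    filter_upwards [this] with q hq
    simpa [mul_comm] using hq
  · rw [← h.map_zero, ← hp.coeff_zero 1]
    rfl
  · exact hp.deriv.symm
  · have := hp.has_fpower_series_dslope_fslope.deriv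
    rw [this]
    simp

end

end PuncturedSphere

namespace PuncturedSphere

/-! ### The terms of the expansion -/

section

/-- The coefficients `(aₖ xᵏ + conj) / (2 log |x|)` of the expansion of `Re h(x) / log |x|`. -/
noncomputable def logCoeff (a : ℕ → ℂ) (x : ℂ) (k : ℕ) : ℂ :=
  (a k * x ^ k + conj (a k * x ^ k)) / (2 * (Real.log ‖x‖ : ℝ))

/-- The terms of the expansion of `(1 + x h'(x)) / (1 + Re h(x) / log |x|)`, for
`h(x) = ∑ aₖ xᵏ`. -/
noncomputable def expTerm (a : ℕ → ℂ) (x : ℂ) : ℕ → ℂ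
  | 0 => 1
  | m + 1 => (m + 1) * (a (m + 1) * x ^ (m + 1)) -
      ∑ i : Fin (m + 1), expTerm a x i * logCoeff a x (m + 1 - i)

theorem expTerm_zero (a : ℕ → ℂ) (x : ℂ) : expTerm a x 0 = 1 := by
  rw [expTerm]

theorem expTerm_succ (a : ℕ → ℂ) (x : ℂ) (m : ℕ) :
    expTerm a x (m + 1) = (m + 1) * (a (m + 1) * x ^ (m + 1)) -
      ∑ i ∈ Finset.range (m + 1), expTerm a x i * logCoeff a x (m + 1 - i) := by
  rw [expTerm, Finset.sum_range]

theorem logCoeff_eq (a : ℕ → ℂ) (x : ℂ) (k : ℕ) :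
    logCoeff a x k = (((a k * x ^ k).re / Real.log ‖x‖ : ℝ) : ℂ) := by
  rw [logCoeff, Complex.add_conj]
  push_cast
  rw [mul_div_mul_left _ _ two_ne_zero]

theorem norm_logCoeff_le (a : ℕ → ℂ) (x : ℂ) (k : ℕ) :
    ‖logCoeff a x k‖ ≤ ‖a k‖ * ‖x‖ ^ k / |Real.log ‖x‖| := by
  rw [logCoeff_eq, Complex.norm_real, Real.norm_eq_abs, abs_div]
  gcongr
  rw [← norm_pow, ← norm_mul]
  exact Complex.abs_re_le_norm _

theorem expTerm_zero_add_one {a : ℕ → ℂ} {b : ℂ} (ha : a 1 = -b) (x : ℂ) :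
    expTerm a x 0 + expTerm a x 1 = principalPart b x := by
  rw [expTerm_succ, expTerm_zero, principalPart]
  simp [expTerm_zero, logCoeff_eq, ha]
  ring

/-- The functions of `b` and `x` which are polynomials in `b`, its conjugate, and the homogeneous
monomials of degree `m` in `x`, its conjugate and `1 / log |x|`. -/
noncomputable def gradedPart (m : ℕ) : Submodule ℂ (ℂ → ℂ → ℂ) :=
  Submodule.span ℂ {Φ | ∃ i i' s t j : ℕ, s + t = m ∧ j ≤ m ∧ Φ = fun b x =>
    b ^ i * conj b ^ i' * (x ^ s * conj x ^ t / ((Real.log ‖x‖ ^ j : ℝ) : ℂ))}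

theorem mul_mem_gradedPart {m n : ℕ} {Φ Ψ : ℂ → ℂ → ℂ} (hΦ : Φ ∈ gradedPart m)
    (hΨ : Ψ ∈ gradedPart n) : (fun b x => Φ b x * Ψ b x) ∈ gradedPart (m + n) := by
  have h := Submodule.mul_mem_mul hΦ hΨ
  rw [gradedPart, gradedPart, Submodule.span_mul_span] at h
  refine Submodule.span_mono ?_ h
  rintro _ ⟨_, ⟨i, i', s, t, j, hst, hj, rfl⟩, _, ⟨k, k', s', t', j', hst', hj', rfl⟩, rfl⟩
  refine ⟨i + k, i' + k', s + s', t + t', j + j', by omega, by omega, ?_⟩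
  funext b x
  simp only [Pi.mul_apply]
  push_cast
  simp only [div_eq_mul_inv, pow_add, mul_inv]
  ring

theorem eval_mul_pow_mem_gradedPart (p : Polynomial ℂ) (m : ℕ) :
    (fun b x : ℂ => p.eval b * x ^ m) ∈ gradedPart m := by
  have h : (fun b x : ℂ => p.eval b * x ^ m) = ∑ i ∈ p.support, p.coeff i • fun b x : ℂ =>
      b ^ i * conj b ^ 0 * (x ^ m * conj x ^ 0 / ((Real.log ‖x‖ ^ 0 : ℝ) : ℂ)) := by
    funext b x
    simp [Finset.sum_apply, Polynomial.eval_eq_sum, Polynomial.sum, Finset.sum_mul, mul_assoc]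
  rw [h]
  exact Submodule.sum_mem _ fun i _ => Submodule.smul_mem _ _
    (Submodule.subset_span ⟨i, 0, m, 0, 0, by simp, by simp, rfl⟩)

theorem logCoeff_mem_gradedPart (p : ℕ → Polynomial ℂ) {k : ℕ} (hk : k ≠ 0) :
    (fun b x => logCoeff (fun n => (p n).eval b) x k) ∈ gradedPart k := by
  have h : (fun b x => logCoeff (fun n => (p n).eval b) x k) =
      (∑ i ∈ (p k).support, ((p k).coeff i / 2) • fun b x : ℂ =>
        b ^ i * conj b ^ 0 * (x ^ k * conj x ^ 0 / ((Real.log ‖x‖ ^ 1 : ℝ) : ℂ))) +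
      ∑ i ∈ (p k).support, (conj ((p k).coeff i) / 2) • fun b x : ℂ =>
        b ^ 0 * conj b ^ i * (x ^ 0 * conj x ^ k / ((Real.log ‖x‖ ^ 1 : ℝ) : ℂ)) := by
    funext b x
    simp only [logCoeff, Polynomial.eval_eq_sum, Polynomial.sum, map_mul, map_sum, map_pow,
      Pi.add_apply, Finset.sum_apply, Pi.smul_apply, smul_eq_mul, pow_zero, pow_one, mul_one,
      one_mul, add_div, Finset.sum_mul, Finset.sum_div]
    congr 1 <;> refine Finset.sum_congr rfl fun i _ => ?_ <;> simp only [div_eq_mul_inv, mul_inv]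
      <;> ring
  rw [h]
  refine Submodule.add_mem _ (Submodule.sum_mem _ fun i _ => Submodule.smul_mem _ _
    (Submodule.subset_span ⟨i, 0, k, 0, 1, by simp, by omega, rfl⟩))
    (Submodule.sum_mem _ fun i _ => Submodule.smul_mem _ _
    (Submodule.subset_span ⟨0, i, 0, k, 1, by simp, by omega, rfl⟩))

/-- Each factor `logCoeff a x k` brings a single `1 / log |x|` together with degree `k ≥ 1`, so the
power of the logarithm never exceeds the degree. -/
theorem expTerm_mem_gradedPart (p : ℕ → Polynomial ℂ) (m : ℕ) :
    (fun b x => expTerm (fun n => (p n).eval b) x m) ∈ gradedPart m := by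
  induction m using Nat.strong_induction_on with
  | _ m ih =>
    rcases m with _ | m
    · simp only [expTerm_zero]
      exact Submodule.subset_span ⟨0, 0, 0, 0, 0, by simp, by simp, by simp⟩
    · have h : (fun b x => expTerm (fun n => (p n).eval b) x (m + 1)) =
          ((m : ℂ) + 1) • (fun b x : ℂ => (p (m + 1)).eval b * x ^ (m + 1)) -
            ∑ i ∈ Finset.range (m + 1), fun b x => expTerm (fun n => (p n).eval b) x i *
              logCoeff (fun n => (p n).eval b) x (m + 1 - i) := by
        funext b x
        simp [expTerm_succ, Finset.sum_apply]
      rw [h]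
      refine Submodule.sub_mem _ (Submodule.smul_mem _ _ (eval_mul_pow_mem_gradedPart _ _))
        (Submodule.sum_mem _ fun i hi => ?_)
      have hi := Finset.mem_range.1 hi
      have := mul_mem_gradedPart (ih i (by omega)) (logCoeff_mem_gradedPart p
        (k := m + 1 - i) (by omega))
      rwa [show i + (m + 1 - i) = m + 1 by omega] at this

theorem exists_eval_eq_of_mem_gradedPart {m : ℕ} {Φ : ℂ → ℂ → ℂ} (hΦ : Φ ∈ gradedPart m) :
    ∃ R : MvPolynomial (ExpVar m) ℂ, ∀ b x, MvPolynomial.eval (expVal m b x) R = Φ b x := by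
  induction hΦ using Submodule.span_induction with
  | mem Φ h =>
    obtain ⟨i, i', s, t, j, hst, hj, rfl⟩ := h
    refine ⟨MvPolynomial.X .𝔟 ^ i * MvPolynomial.X .𝔟bar ^ i' *
      MvPolynomial.X (.mon ⟨s, by omega⟩ ⟨j, by omega⟩), fun b x => ?_⟩
    simp only [map_mul, map_pow, MvPolynomial.eval_X, expVal]
    rw [show m - s = t by omega]
  | zero => exact ⟨0, by simp⟩
  | add Φ Ψ _ _ h₁ h₂ =>
    obtain ⟨R, hR⟩ := h₁
    obtain ⟨S, hS⟩ := h₂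
    exact ⟨R + S, fun b x => by simp [hR, hS]⟩
  | smul c Φ _ h =>
    obtain ⟨R, hR⟩ := h
    exact ⟨MvPolynomial.C c * R, fun b x => by simp [hR]⟩

end

/-! ### Convergence of the expansion -/

section

variable {a : ℕ → ℂ} {h : ℂ → ℂ}

theorem hasSum_mul_deriv (ha : ∀ᶠ x in 𝓝 0, HasSum (fun n => a n * x ^ n) (h x)) :
    ∀ᶠ x in 𝓝 0, HasSum (fun n => n * (a n * x ^ n)) (x * deriv h x) := by
  have hp : HasFPowerSeriesAt h (FormalMultilinearSeries.ofScalars ℂ a) 0 := by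
    rw [hasFPowerSeriesAt_iff']
    filter_upwards [ha] with x hx
    simpa [FormalMultilinearSeries.coeff_ofScalars, mul_comm] using hx
  obtain ⟨r, hr⟩ := hp
  have h1 := hr.fderiv
  filter_upwards [Metric.eball_mem_nhds (0 : ℂ) hr.r_pos] with x hx
  have h2 := (h1.hasSum (y := x) (by simpa using hx)).mapL (ContinuousLinearMap.apply ℂ ℂ x)
  simp only [ContinuousLinearMap.apply_apply, FormalMultilinearSeries.derivSeries_apply_diag,
    zero_add] at h2
  rw [← hasSum_nat_add_iff' 1]
  convert h2 using 1
  · funext n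
    rw [FormalMultilinearSeries.ofScalars_apply_eq, smul_eq_mul, nsmul_eq_mul]
  · simp [mul_comm]

/-- The weight `n + 1` controls the series of `h` and of `x h'(x)` at once. Halving a radius at
which the terms are bounded leaves a geometric factor to absorb it. -/
theorem exists_summable_weighted (ha : ∀ᶠ x in 𝓝 0, HasSum (fun n => a n * x ^ n) (h x)) :
    ∃ r > 0, Summable fun n : ℕ => (n + 1) * (‖a n‖ * r ^ n) := by
  obtain ⟨ε, hε, hball⟩ := Metric.eventually_nhds_iff.1 ha
  have h1 := hball (y := ((ε / 2 : ℝ) : ℂ)) (by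
    rw [dist_zero_right, Complex.norm_real, Real.norm_of_nonneg (by positivity)]; linarith)
  obtain ⟨C, hC⟩ := h1.summable.tendsto_atTop_zero.norm.bddAbove_range
  refine ⟨ε / 4, by positivity, ?_⟩
  have h2 : Summable fun n : ℕ => C * ((n + 1) * (1 / 2 : ℝ) ^ n) := by
    refine Summable.mul_left _ ?_
    have h3 := summable_pow_mul_geometric_of_norm_lt_one 1 (r := (1 / 2 : ℝ)) (by norm_num)
    have h4 := summable_geometric_of_lt_one (r := (1 / 2 : ℝ)) (by norm_num) (by norm_num)
    refine (h3.add h4).congr fun n => by ring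
  refine Summable.of_nonneg_of_le (fun n => by positivity) (fun n => ?_) h2
  have h5 : ‖a n‖ * (ε / 2) ^ n ≤ C := by
    have := hC ⟨n, rfl⟩
    simpa [abs_of_pos hε] using this
  calc ((n : ℝ) + 1) * (‖a n‖ * (ε / 4) ^ n)
      = (‖a n‖ * (ε / 2) ^ n) * ((n + 1) * (1 / 2 : ℝ) ^ n) := by
        rw [show ε / 4 = ε / 2 * (1 / 2) by ring, mul_pow]; ring
    _ ≤ C * ((n + 1) * (1 / 2 : ℝ) ^ n) := by gcongr

variable {r : ℝ} {x : ℂ}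

/-- Induction on the recursion. With `S` the weighted sum, `|log |x|| > 2 S` makes the convolution
contribute at most half of the inductive bound, and `S + (1 + S) ≤ 2 (1 + S)` closes the induction.
-/
theorem norm_expTerm_le (hr : 0 < r) (ha : Summable fun n : ℕ => (n + 1) * (‖a n‖ * r ^ n))
    (hx : 2 * (∑' n : ℕ, (n + 1) * (‖a n‖ * r ^ n)) < |Real.log ‖x‖|) (m : ℕ) :
    ‖expTerm a x m‖ ≤ 2 * (1 + ∑' n : ℕ, (n + 1) * (‖a n‖ * r ^ n)) * (‖x‖ / r) ^ m := by
  set S := ∑' n : ℕ, (n + 1) * (‖a n‖ * r ^ n) with hS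
  have hnn : ∀ n : ℕ, 0 ≤ (n + 1) * (‖a n‖ * r ^ n) := fun n => by positivity
  have hS0 : 0 ≤ S := tsum_nonneg hnn
  have hL : 0 < |Real.log ‖x‖| := by linarith
  set t := ‖x‖ / r with ht
  have ht0 : 0 ≤ t := by positivity
  have hxr : ∀ k, ‖x‖ ^ k = r ^ k * t ^ k := fun k => by
    rw [ht, ← mul_pow, mul_div_cancel₀ _ hr.ne']
  induction m using Nat.strong_induction_on with
  | _ m ih =>
    rcases m with _ | m
    · rw [expTerm_zero, norm_one]
      simp only [pow_zero]
      linarith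
    · rw [expTerm_succ]
      have h1 : ‖((m : ℂ) + 1) * (a (m + 1) * x ^ (m + 1))‖ ≤ S * t ^ (m + 1) := by
        rw [norm_mul, norm_mul, norm_pow, hxr]
        have h2 : ‖(m : ℂ) + 1‖ = m + 1 := by exact_mod_cast Complex.norm_natCast (m + 1)
        have h3 := ha.le_tsum (m + 1) fun j _ => hnn j
        push_cast at h3
        rw [h2]
        calc ((m : ℝ) + 1) * (‖a (m + 1)‖ * (r ^ (m + 1) * t ^ (m + 1)))
            = ((m + 1) * (‖a (m + 1)‖ * r ^ (m + 1))) * t ^ (m + 1) := by ring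
          _ ≤ ((m + 1 + 1) * (‖a (m + 1)‖ * r ^ (m + 1))) * t ^ (m + 1) := by
              gcongr
              linarith
          _ ≤ S * t ^ (m + 1) := by gcongr
      have h2 : ∀ i ∈ Finset.range (m + 1), ‖expTerm a x i * logCoeff a x (m + 1 - i)‖ ≤
          (‖a (m + 1 - i)‖ * r ^ (m + 1 - i)) * (2 * (1 + S) * t ^ (m + 1) / |Real.log ‖x‖|) := by
        intro i hi
        have hi := Finset.mem_range.1 hi
        rw [norm_mul]
        calc ‖expTerm a x i‖ * ‖logCoeff a x (m + 1 - i)‖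
            ≤ (2 * (1 + S) * t ^ i) * (‖a (m + 1 - i)‖ * ‖x‖ ^ (m + 1 - i) / |Real.log ‖x‖|) := by
              gcongr
              · exact ih i (by omega)
              · exact norm_logCoeff_le _ _ _
          _ = _ := by
              rw [hxr, ← pow_mul_pow_sub t (show i ≤ m + 1 by omega)]
              ring
      have h3 : ∑ i ∈ Finset.range (m + 1), ‖a (m + 1 - i)‖ * r ^ (m + 1 - i) ≤ S := by
        calc ∑ i ∈ Finset.range (m + 1), ‖a (m + 1 - i)‖ * r ^ (m + 1 - i)
            ≤ ∑ i ∈ Finset.range (m + 2), ‖a (m + 1 - i)‖ * r ^ (m + 1 - i) :=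
              Finset.sum_le_sum_of_subset_of_nonneg (Finset.range_mono (by omega))
                fun _ _ _ => by positivity
          _ = ∑ i ∈ Finset.range (m + 2), ‖a i‖ * r ^ i :=
              Finset.sum_range_reflect (fun i => ‖a i‖ * r ^ i) (m + 2)
          _ ≤ ∑ i ∈ Finset.range (m + 2), ((i : ℝ) + 1) * (‖a i‖ * r ^ i) :=
              Finset.sum_le_sum fun i _ => le_mul_of_one_le_left (by positivity) (by simp)
          _ ≤ S := ha.sum_le_tsum _ fun i _ => hnn i
      calc _ ≤ S * t ^ (m + 1) + ∑ i ∈ Finset.range (m + 1), (‖a (m + 1 - i)‖ * r ^ (m + 1 - i)) *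
              (2 * (1 + S) * t ^ (m + 1) / |Real.log ‖x‖|) :=
            (norm_sub_le _ _).trans (add_le_add h1 ((norm_sum_le _ _).trans
              (Finset.sum_le_sum h2)))
        _ ≤ S * t ^ (m + 1) + S * (2 * (1 + S) * t ^ (m + 1) / |Real.log ‖x‖|) := by
            rw [← Finset.sum_mul]
            gcongr
        _ ≤ 2 * (1 + S) * t ^ (m + 1) := by
            have h4 : S / |Real.log ‖x‖| ≤ 1 / 2 := by
              rw [div_le_iff₀ hL]; linarith
            have h5 : 0 ≤ (1 + S) * t ^ (m + 1) := by positivity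
            calc S * t ^ (m + 1) + S * (2 * (1 + S) * t ^ (m + 1) / |Real.log ‖x‖|)
                = S * t ^ (m + 1) + S / |Real.log ‖x‖| * (2 * ((1 + S) * t ^ (m + 1))) := by ring
              _ ≤ (1 + S) * t ^ (m + 1) + 1 / 2 * (2 * ((1 + S) * t ^ (m + 1))) := by
                  gcongr
                  linarith
              _ = _ := by ring

theorem summable_norm_expTerm (hr : 0 < r)
    (ha : Summable fun n : ℕ => (n + 1) * (‖a n‖ * r ^ n))
    (hx : 2 * (∑' n : ℕ, (n + 1) * (‖a n‖ * r ^ n)) < |Real.log ‖x‖|) (hxr : ‖x‖ < r) :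
    Summable fun m => ‖expTerm a x m‖ :=
  Summable.of_nonneg_of_le (fun _ => norm_nonneg _) (norm_expTerm_le hr ha hx)
    ((summable_geometric_of_lt_one (by positivity) ((div_lt_one hr).2 hxr)).mul_left _)

theorem norm_tsum_expTerm_le (hr : 0 < r)
    (ha : Summable fun n : ℕ => (n + 1) * (‖a n‖ * r ^ n))
    (hx : 2 * (∑' n : ℕ, (n + 1) * (‖a n‖ * r ^ n)) < |Real.log ‖x‖|) (hxr : ‖x‖ ≤ r / 2) (k : ℕ) :
    ‖∑' m, expTerm a x (m + k)‖ ≤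
      4 * (1 + ∑' n : ℕ, (n + 1) * (‖a n‖ * r ^ n)) / r ^ k * ‖x‖ ^ k := by
  set S := ∑' n : ℕ, (n + 1) * (‖a n‖ * r ^ n) with hS
  have hS0 : 0 ≤ S := tsum_nonneg fun n => by positivity
  have ht : ‖x‖ / r ≤ 1 / 2 := by rw [div_le_iff₀ hr]; linarith
  have hg : HasSum (fun m : ℕ => 2 * (1 + S) * (‖x‖ / r) ^ k * (1 / 2 : ℝ) ^ m)
      (2 * (1 + S) * (‖x‖ / r) ^ k * 2) := hasSum_geometric_two.mul_left _
  have h1 := tsum_of_norm_bounded hg fun m => (by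
    refine (norm_expTerm_le hr ha hx (m + k)).trans ?_
    rw [pow_add, mul_comm ((‖x‖ / r) ^ m), ← mul_assoc]
    gcongr : ‖expTerm a x (m + k)‖ ≤ _)
  refine h1.trans (le_of_eq ?_)
  rw [div_pow]
  ring

/-- The recursion for `expTerm` is exactly the Cauchy product identity, valid here by absolute
convergence. `K` is the sequence of terms of `1 + Re h(x) / log |x|`; the constant term `1` is its
only entry in degree `0` because `a 0 = 0`. -/
theorem tsum_expTerm_mul (hr : 0 < r) (ha : Summable fun n : ℕ => (n + 1) * (‖a n‖ * r ^ n))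
    (hx : 2 * (∑' n : ℕ, (n + 1) * (‖a n‖ * r ^ n)) < |Real.log ‖x‖|) (hxr : ‖x‖ < r)
    (h0 : a 0 = 0) {H D : ℂ} (hH : HasSum (fun n => a n * x ^ n) H)
    (hD : HasSum (fun n : ℕ => n * (a n * x ^ n)) D) :
    (∑' m, expTerm a x m) * (1 + ((H.re / Real.log ‖x‖ : ℝ) : ℂ)) = 1 + D := by
  set K : ℕ → ℂ := fun k => (if k = 0 then 1 else 0) + logCoeff a x k with hK
  have hlog : HasSum (logCoeff a x) ((H.re / Real.log ‖x‖ : ℝ) : ℂ) := by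
    have h1 := (Complex.hasSum_re hH).div_const (Real.log ‖x‖)
    have h2 := Complex.hasSum_ofReal.2 h1
    rwa [← funext fun k => logCoeff_eq a x k] at h2
  have hlogn : Summable fun k => ‖logCoeff a x k‖ := by
    refine Summable.of_nonneg_of_le (fun _ => norm_nonneg _) (fun k => ?_)
      (ha.div_const |Real.log ‖x‖|)
    refine (norm_logCoeff_le a x k).trans ?_
    refine div_le_div_of_nonneg_right ?_ (abs_nonneg _)
    calc ‖a k‖ * ‖x‖ ^ k ≤ ‖a k‖ * r ^ k := by gcongr
      _ ≤ (k + 1) * (‖a k‖ * r ^ k) := le_mul_of_one_le_left (by positivity) (by simp)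
  have hKs : HasSum K (1 + ((H.re / Real.log ‖x‖ : ℝ) : ℂ)) := (hasSum_ite_eq 0 1).add hlog
  have hKn : Summable fun k => ‖K k‖ := by
    refine Summable.of_nonneg_of_le (fun _ => norm_nonneg _) (fun k => norm_add_le _ _)
      (Summable.add ?_ hlogn)
    refine (hasSum_ite_eq (0 : ℕ) (1 : ℝ)).summable.congr fun k => ?_
    split_ifs <;> simp
  have hlog0 : logCoeff a x 0 = 0 := by simp [logCoeff, h0]
  rw [← hKs.tsum_eq, tsum_mul_tsum_eq_tsum_sum_antidiagonal_of_summable_norm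
    (summable_norm_expTerm hr ha hx hxr) hKn]
  have hD' : HasSum (fun n : ℕ => (if n = 0 then 1 else 0) + n * (a n * x ^ n)) (1 + D) :=
    (hasSum_ite_eq 0 1).add hD
  rw [← hD'.tsum_eq]
  refine tsum_congr fun m => ?_
  rw [Finset.Nat.sum_antidiagonal_eq_sum_range_succ fun i j => expTerm a x i * K j]
  rcases m with _ | m
  · simp [K, expTerm_zero, hlog0]
  · rw [Finset.sum_range_succ, expTerm_succ]
    have h2 : ∑ i ∈ Finset.range (m + 1), expTerm a x i * K (m + 1 - i) =
        ∑ i ∈ Finset.range (m + 1), expTerm a x i * logCoeff a x (m + 1 - i) := by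
      refine Finset.sum_congr rfl fun i hi => ?_
      have hi := Finset.mem_range.1 hi
      simp [K, show m + 1 - i ≠ 0 by omega]
    rw [h2]
    simp [K, hlog0]

end

end PuncturedSphere

/-! ### The polynomials of the expansion -/

namespace PuncturedSphere

/-- The polynomials `R` are chosen from the `p n` alone, before `b` and `h`. The condition on `p 1`
says `h'(0) = -b`, which makes the terms of degree `0` and `1` add up to the principal part. -/
theorem exists_terms_of_polynomials {p : ℕ → Polynomial ℂ} (p_zero : p 0 = 0)
    (p_one : p 1 = -Polynomial.X) :
    ∃ R : (m : ℕ) → MvPolynomial (ExpVar m) ℂ, ∀ (b : ℂ) (h : ℂ → ℂ),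
      (∀ᶠ x in 𝓝 0, HasSum (fun n => (p n).eval b * x ^ n) (h x)) →
      (∀ᶠ x in 𝓝[≠] 0, Summable (fun m => term R b x (m + 2)) ∧
        (principalPart b x + ∑' m, term R b x (m + 2)) *
          (1 + (((h x).re / Real.log ‖x‖ : ℝ) : ℂ)) = 1 + x * deriv h x) ∧
      ∀ n : ℕ, (fun x => ∑' m, term R b x (m + n + 2)) =O[𝓝[≠] 0] fun x => ‖x‖ ^ (n + 2) := by
  choose R hR using fun m => exists_eval_eq_of_mem_gradedPart (expTerm_mem_gradedPart p m)
  refine ⟨R, fun b h ha => ?_⟩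
  set a : ℕ → ℂ := fun n => (p n).eval b with haDef
  have hterm : ∀ x m, term R b x m = expTerm a x m := fun x m => hR m b x
  have ha0 : a 0 = 0 := by simp [a, p_zero]
  have ha1 : a 1 = -b := by simp [a, p_one]
  obtain ⟨r, hr, hsum⟩ := exists_summable_weighted ha
  have hlog : ∀ᶠ x : ℂ in 𝓝[≠] 0, 2 * (∑' n : ℕ, (n + 1) * (‖a n‖ * r ^ n)) < |Real.log ‖x‖| := by
    have : Tendsto (fun x : ℂ => |Real.log ‖x‖|) (𝓝[≠] 0) atTop :=
      tendsto_abs_atBot_atTop.comp (Real.tendsto_log_nhdsGT_zero.comp tendsto_norm_nhdsNE_zero)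
    exact this.eventually (eventually_gt_atTop _)
  have hsmall : ∀ᶠ x : ℂ in 𝓝[≠] 0, ‖x‖ < r / 2 := by
    refine eventually_nhdsWithin_of_eventually_nhds ?_
    filter_upwards [Metric.ball_mem_nhds (0 : ℂ) (half_pos hr)] with x hx
    simpa using hx
  refine ⟨?_, fun n => ?_⟩
  · filter_upwards [hlog, hsmall, eventually_nhdsWithin_of_eventually_nhds ha,
      eventually_nhdsWithin_of_eventually_nhds (hasSum_mul_deriv ha)] with x h1 h2 h3 h4
    have h5 : ‖x‖ < r := by linarith
    have h6 := (summable_norm_expTerm hr hsum h1 h5).of_norm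
    simp only [hterm]
    refine ⟨(summable_nat_add_iff 2).2 h6, ?_⟩
    rw [← tsum_expTerm_mul hr hsum h1 h5 ha0 h3 h4, ← expTerm_zero_add_one ha1,
      ← h6.sum_add_tsum_nat_add 2, Finset.sum_range_succ, Finset.sum_range_one]
  · refine IsBigO.of_bound (4 * (1 + ∑' n : ℕ, (n + 1) * (‖a n‖ * r ^ n)) / r ^ (n + 2)) ?_
    filter_upwards [hlog, hsmall] with x h1 h2
    simp only [hterm, norm_pow, norm_norm]
    exact norm_tsum_expTerm_le hr hsum h1 h2.le (n + 2)

/-! ### The coefficients of the inverse of the expansion at the cusp -/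

/-- The coefficients of `shiftedLog H (-a₁ - b) x`, for `H x = ∑ aₙ xⁿ`, as polynomials in `b`. -/
noncomputable def shiftedLogCoeff (a : ℕ → ℂ) (n : ℕ) : Polynomial ℂ :=
  (∑ c : Composition n, Polynomial.C (a c.length) *
    (Polynomial.C (-a 1) - Polynomial.X) ^ (n - c.length)) +
    -- The coefficient `sⁿ / n` of `-log (1 - s x)`; for `n = 0` the convention `0⁻¹ = 0` gives the
    -- correct value.
    Polynomial.C (n : ℂ)⁻¹ * (Polynomial.C (-a 1) - Polynomial.X) ^ n

theorem shiftedLogCoeff_zero {a : ℕ → ℂ} (ha : a 0 = 0) : shiftedLogCoeff a 0 = 0 := by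
  have h : ∀ c : Composition 0, c.length = 0 := fun c => Nat.le_zero.1 c.length_le
  simp [shiftedLogCoeff, h, ha]

theorem shiftedLogCoeff_one (a : ℕ → ℂ) : shiftedLogCoeff a 1 = -Polynomial.X := by
  have h : ∀ c : Composition 1, c.length = 1 := fun c =>
    le_antisymm c.length_le (c.length_pos_of_pos one_pos)
  have hcard : Fintype.card (Composition 1) = 1 := by simp [composition_card]
  simp [shiftedLogCoeff, h, hcard]
  ring

theorem hasFPowerSeriesAt_ofScalars_iff {a : ℕ → ℂ} {h : ℂ → ℂ} :
    HasFPowerSeriesAt h (FormalMultilinearSeries.ofScalars ℂ a) 0 ↔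
      ∀ᶠ x in 𝓝 0, HasSum (fun n => a n * x ^ n) (h x) := by
  simp [hasFPowerSeriesAt_iff', FormalMultilinearSeries.coeff_ofScalars, mul_comm]

/-- The inner series is `x / (1 - s x)`. A block of size `j` contributes `s ^ (j - 1)`, so a
composition of `n` contributes `s` to the power `n` minus its number of blocks: a polynomial in `s`.
-/
theorem coeff_comp_ofScalars (a : ℕ → ℂ) (s : ℂ) (n : ℕ) :
    ((FormalMultilinearSeries.ofScalars ℂ a).comp (FormalMultilinearSeries.ofScalars ℂ
      fun n => if n = 0 then 0 else s ^ (n - 1))).coeff n =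
      ∑ c : Composition n, a c.length * s ^ (n - c.length) := by
  rw [FormalMultilinearSeries.coeff, FormalMultilinearSeries.comp,
    _root_.sum_apply]
  refine Finset.sum_congr rfl fun c _ => ?_
  rw [FormalMultilinearSeries.compAlongComposition_apply,
    FormalMultilinearSeries.apply_eq_prod_smul_coeff, FormalMultilinearSeries.coeff_ofScalars,
    smul_eq_mul, mul_comm]
  congr 1
  have h1 : ∀ i : Fin c.length, (FormalMultilinearSeries.ofScalars ℂ
      fun n => if n = 0 then 0 else s ^ (n - 1)).applyComposition c 1 i =
        s ^ (c.blocksFun i - 1) := by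
    intro i
    have h2 : c.blocksFun i ≠ 0 := Nat.one_le_iff_ne_zero.1 (c.one_le_blocksFun i)
    have h3 : (FormalMultilinearSeries.ofScalars ℂ
      fun n => if n = 0 then 0 else s ^ (n - 1)).applyComposition c 1 i =
        (FormalMultilinearSeries.ofScalars ℂ
      fun n => if n = 0 then 0 else s ^ (n - 1)).coeff (c.blocksFun i) := rfl
    rw [h3, FormalMultilinearSeries.coeff_ofScalars, if_neg h2]
  have h2 : ∑ i, (c.blocksFun i - 1) = n - c.length := by
    have h3 := c.sum_blocksFun
    have h4 : ∑ i, c.blocksFun i = ∑ i, (c.blocksFun i - 1) + c.length := by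
      calc ∑ i, c.blocksFun i = ∑ i, (c.blocksFun i - 1 + 1) :=
            Finset.sum_congr rfl fun i _ => (Nat.sub_add_cancel (c.one_le_blocksFun i)).symm
        _ = _ := by rw [Finset.sum_add_distrib]; simp
    omega
  rw [Finset.prod_congr rfl fun i _ => h1 i, Finset.prod_pow_eq_pow_sum, h2]

theorem hasSum_shiftedLog {a : ℕ → ℂ} {H : ℂ → ℂ}
    (ha : ∀ᶠ x in 𝓝 0, HasSum (fun n => a n * x ^ n) (H x)) (b : ℂ) :
    ∀ᶠ x in 𝓝 0, HasSum (fun n => (shiftedLogCoeff a n).eval b * x ^ n)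
      (shiftedLog H (-a 1 - b) x) := by
  set s := -a 1 - b with hs
  have hsx : ∀ᶠ x : ℂ in 𝓝 0, ‖s * x‖ < 1 := by
    have : ContinuousAt (fun x : ℂ => ‖s * x‖) 0 := by fun_prop
    exact this.eventually_lt continuousAt_const (by simp)
  have hy : HasFPowerSeriesAt (fun x : ℂ => x / (1 - s * x)) (FormalMultilinearSeries.ofScalars ℂ
      fun n => if n = 0 then 0 else s ^ (n - 1)) 0 := by
    rw [hasFPowerSeriesAt_ofScalars_iff]
    filter_upwards [hsx] with x hx
    rw [← hasSum_nat_add_iff' 1]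
    have := (hasSum_geometric_of_norm_lt_one hx).mul_left x
    have h1 : (fun n => (if n + 1 = 0 then 0 else s ^ (n + 1 - 1)) * x ^ (n + 1)) =
        fun n => x * (s * x) ^ n := by
      funext n
      simp only [Nat.add_eq_zero_iff, one_ne_zero, and_false, if_false, Nat.add_sub_cancel]
      rw [mul_pow, pow_succ', mul_left_comm]
    rw [h1]
    simpa [div_eq_mul_inv] using this
  have hH : HasFPowerSeriesAt H (FormalMultilinearSeries.ofScalars ℂ a)
      ((fun x : ℂ => x / (1 - s * x)) 0) := by
    simpa using hasFPowerSeriesAt_ofScalars_iff.2 ha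
  have hcomp := hasFPowerSeriesAt_iff'.1 (HasFPowerSeriesAt.comp (f := fun x : ℂ => x / (1 - s * x)) hH hy)
  filter_upwards [hcomp, hsx] with x h1 h2
  have h3 := h1.add (Complex.hasSum_taylorSeries_neg_log h2)
  refine HasSum.congr_fun h3 fun n => ?_
  rw [coeff_comp_ofScalars]
  simp [shiftedLogCoeff, Polynomial.eval_finsetSum, ← hs]
  rw [mul_pow]
  ring

theorem IsCuspCovering.exists_terms {N : ℕ} (hN : N ≠ 0) {E₀ : Set ℂ} {U₀ : ℂ → ℂ}
    (hU₀ : IsCuspCovering N E₀ U₀) (hE₀ : E₀.Finite) :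
    ∃ R : (m : ℕ) → MvPolynomial (ExpVar m) ℂ, ∀ (E : Set ℂ) (U F G : ℂ → ℂ),
      IsCuspCovering N E U → IsCuspMap N U F G → ∃ h : ℂ → ℂ, AnalyticAt ℂ h 0 ∧ h 0 = 0 ∧
        (∀ᶠ x in 𝓝 0, G (deriv F 0 * x) = x * Complex.exp (h x)) ∧
        (∀ᶠ x in 𝓝[≠] 0,
          Summable (fun m => term R (deriv (dslope F 0) 0 / deriv F 0) x (m + 2)) ∧
          (principalPart (deriv (dslope F 0) 0 / deriv F 0) x +
            ∑' m, term R (deriv (dslope F 0) 0 / deriv F 0) x (m + 2)) *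
            (1 + (((h x).re / Real.log ‖x‖ : ℝ) : ℂ)) = 1 + x * deriv h x) ∧
        ∀ n : ℕ, (fun x => ∑' m, term R (deriv (dslope F 0) 0 / deriv F 0) x (m + n + 2))
          =O[𝓝[≠] 0] fun x => ‖x‖ ^ (n + 2) := by
  obtain ⟨H, hH, hH0, hG⟩ := hU₀.exists_forall_eq_mul_exp hN hE₀
  have hH' := hH
  obtain ⟨q, hq⟩ := hH'
  have ha : ∀ᶠ x in 𝓝 0, HasSum (fun n => q.coeff n * x ^ n) (H x) := by
    filter_upwards [hasFPowerSeriesAt_iff'.1 hq] with x hx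
    simpa [mul_comm] using hx
  have ha0 : q.coeff 0 = 0 := (hq.coeff_zero 1).trans hH0
  obtain ⟨R, hR⟩ := exists_terms_of_polynomials (shiftedLogCoeff_zero ha0)
    (shiftedLogCoeff_one q.coeff)
  refine ⟨R, fun E U F G hU h => ?_⟩
  have h1 := hG E U F G hU h
  rw [hq.deriv] at h1
  set b := deriv (dslope F 0) 0 / deriv F 0
  exact ⟨shiftedLog H (-q.coeff 1 - b), analyticAt_shiftedLog hH _, shiftedLog_zero hH0 _, h1,
    hR b _ (hasSum_shiftedLog ha b)⟩

/-- The density of the metric, from the logarithmic form of the inverse of the covering. -/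
theorem norm_deriv_div_eq {G h : ℂ → ℂ} {A : ℂ} (hA : A ≠ 0) (hG : AnalyticAt ℂ G 0)
    (hh : AnalyticAt ℂ h 0) (hGh : ∀ᶠ x in 𝓝 0, G (A * x) = x * Complex.exp (h x)) :
    ∀ᶠ x in 𝓝[≠] 0, ‖deriv G (A * x)‖ / (‖G (A * x)‖ * |Real.log ‖G (A * x)‖|) =
      ‖1 + x * deriv h x‖ / (‖A * x‖ * |Real.log ‖x‖ + (h x).re|) := by
  have hlim : Tendsto (fun x : ℂ => A * x) (𝓝 0) (𝓝 0) := by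
    simpa using (continuous_const_mul A).tendsto 0
  filter_upwards [eventually_nhdsWithin_of_eventually_nhds (hGh.eventually_nhds.and
    (hh.eventually_analyticAt.and (hlim.eventually hG.eventually_analyticAt))),
    self_mem_nhdsWithin] with x ⟨h1, h2, h3⟩ hx
  have hx : x ≠ 0 := hx
  have h4 := h3.differentiableAt.hasDerivAt.comp x ((hasDerivAt_id' x).const_mul A)
  have h5 := (hasDerivAt_id' x).fun_mul h2.differentiableAt.hasDerivAt.cexp
  have h6 := h4.unique (h5.congr_of_eventuallyEq h1)
  have h7 : deriv G (A * x) = Complex.exp (h x) * (1 + x * deriv h x) / A := by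
    rw [eq_div_iff hA]
    linear_combination h6
  have h8 : Real.log ‖x * Complex.exp (h x)‖ = Real.log ‖x‖ + (h x).re := by
    rw [norm_mul, Complex.norm_exp, Real.log_mul (norm_ne_zero_iff.2 hx) (Real.exp_ne_zero _),
      Real.log_exp]
  rw [h7, h1.self_of_nhds, h8, norm_div, norm_mul, norm_mul, norm_mul, Complex.norm_exp]
  have h9 : ‖A‖ ≠ 0 := norm_ne_zero_iff.2 hA
  have h10 : ‖x‖ ≠ 0 := norm_ne_zero_iff.2 hx
  have h11 := Real.exp_ne_zero (h x).re
  field_simp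

end PuncturedSphere

namespace PuncturedSphere

/-! ### Expansion of the covering and density of the metric at the cusp -/

section

variable {N : ℕ} {P : Finset (OnePoint ℂ)}
  {f : UpperHalfPlane → {x : OnePoint ℂ // x ∉ (P : Set (OnePoint ℂ))}}

theorem IsCuspMap.hasCuspExpansion (hN : N ≠ 0) (h0 : ((0 : ℂ) : OnePoint ℂ) ∈ P) {F G : ℂ → ℂ}
    (h : IsCuspMap N (invMap f) F G) {c : ℕ → ℂ}
    (hc : ∀ᶠ q in 𝓝 0, HasSum (fun n => c n * q ^ n) (F q)) :
    HasCuspExpansion N (fun τ => (f τ : OnePoint ℂ)) c := by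
  have hN0 : (0 : ℝ) < N := Nat.cast_pos.2 (Nat.pos_of_ne_zero hN)
  have h1 := (((Function.Periodic.qParam_tendsto hN0).mono_right nhdsWithin_le_nhds).eventually
    hc).and h.mul_eq_one
  have h2 : Tendsto ((↑) : UpperHalfPlane → ℂ) UpperHalfPlane.atImInfty
      (comap Complex.im atTop) := tendsto_comap_iff.2 tendsto_comap
  filter_upwards [h2.eventually h1] with τ hτ
  refine ⟨F (Function.Periodic.qParam N τ), ?_, hτ.1⟩
  have h3 : invMap f τ ≠ 0 := right_ne_zero_of_mul_eq_one hτ.2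
  have h4 := ofInv_invMap (f := f) h0 τ
  rw [UpperHalfPlane.ofComplex_apply, ofInv_of_ne_zero h3] at h4
  rw [← h4, eq_inv_of_mul_eq_one_left hτ.2]

theorem IsCuspMap.density_eq (hN : N ≠ 0) (h0 : ((0 : ℂ) : OnePoint ℂ) ∈ P)
    (hf : IsGammaCovering N (P : Set (OnePoint ℂ)) f) {F G : ℂ → ℂ}
    (h : IsCuspMap N (invMap f) F G) {g : ConformalMetric (P : Set (OnePoint ℂ))}
    (hg : g.IsCompleteKahlerEinstein) :
    ∀ᶠ z in 𝓝[≠] 0, g.ρ z = ‖deriv G z‖ / (‖G z‖ * |Real.log ‖G z‖|) := by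
  have h1 := h.exp_eq hN (hf.isCuspCovering h0) finite_setOf_ofInv_mem hg.isLiouvilleOn
    (hg.complete.hasInfiniteEnds h0)
  have h2 : ∀ᶠ z in 𝓝[≠] (0 : ℂ), ofInv z⁻¹ ∉ P := by
    have := Bornology.isBounded_def.1 (finite_setOf_ofInv_mem (P := P)).isBounded
    exact tendsto_inv₀_nhdsNE_zero.eventually this
  filter_upwards [h1, h2, self_mem_nhdsWithin] with z h1 h2 hz
  have hz : z ≠ 0 := hz
  have h3 : ofInv z⁻¹ ∉ (P : Set (OnePoint ℂ)) := by exact_mod_cast h2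
  rw [Real.exp_log (g.pos_inv _ h3), g.compat _ (inv_ne_zero hz) h3, inv_inv, norm_inv] at h1
  have h4 : ‖z‖ ≠ 0 := norm_ne_zero_iff.2 hz
  have h5 : g.ρ z * ‖z‖ ^ 2 = ‖z‖ ^ 2 * (‖deriv G z‖ / (‖G z‖ * |Real.log ‖G z‖|)) := by
    rw [← h1]
    field_simp
  rw [mul_comm] at h5
  exact mul_left_cancel₀ (pow_ne_zero 2 h4) h5

end

/-- The terms of the expansion, for the coverings with the group `Γ(N)`. -/
theorem exists_terms_of_isGammaCovering {N : ℕ} (hN : N ≠ 0) :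
    ∃ R : (m : ℕ) → MvPolynomial (ExpVar m) ℂ, ∀ (E : Set ℂ) (U F G : ℂ → ℂ), E.Finite →
      IsCuspCovering N E U → IsCuspMap N U F G → ∃ h : ℂ → ℂ, AnalyticAt ℂ h 0 ∧ h 0 = 0 ∧
        (∀ᶠ x in 𝓝 0, G (deriv F 0 * x) = x * Complex.exp (h x)) ∧
        (∀ᶠ x in 𝓝[≠] 0,
          Summable (fun m => term R (deriv (dslope F 0) 0 / deriv F 0) x (m + 2)) ∧
          (principalPart (deriv (dslope F 0) 0 / deriv F 0) x +
            ∑' m, term R (deriv (dslope F 0) 0 / deriv F 0) x (m + 2)) *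
            (1 + (((h x).re / Real.log ‖x‖ : ℝ) : ℂ)) = 1 + x * deriv h x) ∧
        ∀ n : ℕ, (fun x => ∑' m, term R (deriv (dslope F 0) 0 / deriv F 0) x (m + n + 2))
          =O[𝓝[≠] 0] fun x => ‖x‖ ^ (n + 2) := by
  -- Any covering with the group `Γ(N)` can serve as the reference that defines `R`; if there is
  -- none, the claim is vacuous. Its existence therefore need not be known.
  by_cases hex : ∃ (E₀ : Set ℂ) (U₀ : ℂ → ℂ), E₀.Finite ∧ IsCuspCovering N E₀ U₀
  · obtain ⟨E₀, U₀, hE₀, hU₀⟩ := hex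
    obtain ⟨R, hR⟩ := hU₀.exists_terms hN hE₀
    exact ⟨R, fun E U F G _ => hR E U F G⟩
  · exact ⟨0, fun E U F G hE hU => absurd ⟨E, U, hE, hU⟩ hex⟩

end PuncturedSphere

theorem corollary1p3 (N : ℕ) (hN : N ∈ ({2, 3, 4, 5} : Set ℕ)) :
    -- the polynomials `R m` depend on `N` only
    ∃ R : (m : ℕ) → MvPolynomial (PuncturedSphere.ExpVar m) ℂ,
      ∀ (P : Finset (OnePoint ℂ)), ((0 : ℂ) : OnePoint ℂ) ∈ P →
        P.card = PuncturedSphere.cuspCount N →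
      ∀ (f : UpperHalfPlane → {x : OnePoint ℂ // x ∉ (P : Set (OnePoint ℂ))}),
        PuncturedSphere.IsGammaCovering N (P : Set (OnePoint ℂ)) f →
      ∃ (A B : ℂ) (c : ℕ → ℂ),
        -- `f = A q + B q² + ∑_{m ≥ 3} cₘ qᵐ`, with `A ≠ 0`
        (PuncturedSphere.HasCuspExpansion N (fun τ => (f τ : OnePoint ℂ)) c ∧
          c 0 = 0 ∧ c 1 = A ∧ c 2 = B ∧ A ≠ 0) ∧
        ∀ (g : PuncturedSphere.ConformalMetric (P : Set (OnePoint ℂ))),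
          g.IsCompleteKahlerEinstein →
          -- the series converges to the metric near the cusp
          (∀ᶠ z in 𝓝[≠] (0 : ℂ),
            Summable (fun m : ℕ => PuncturedSphere.term R (B / A) (z / A) (m + 2)) ∧
            g.ρ z = 1 / (‖z‖ * |Real.log ‖z / A‖|) *
              ‖PuncturedSphere.principalPart (B / A) (z / A) +
                ∑' m : ℕ, PuncturedSphere.term R (B / A) (z / A) (m + 2)‖) ∧
          -- and its remainders have the expected order
          (∀ n : ℕ,
            (fun z : ℂ => ∑' m : ℕ, PuncturedSphere.term R (B / A) (z / A) (m + n + 2))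
              =O[𝓝[≠] (0 : ℂ)] fun z => ‖z‖ ^ (n + 2)) := by
  have hN0 : N ≠ 0 := by
    rintro rfl
    simp at hN
  obtain ⟨R, hR⟩ := PuncturedSphere.exists_terms_of_isGammaCovering hN0
  refine ⟨R, fun P h0 _ f hf => ?_⟩
  have hU := hf.isCuspCovering h0
  obtain ⟨F, G, hFG⟩ := hU.exists_isCuspMap hN0
  obtain ⟨c, hc, hc0, hc1, hc2⟩ := hFG.exists_hasSum
  obtain ⟨h, hh, hh0, hGh, hmain, hrem⟩ :=
    hR _ _ F G PuncturedSphere.finite_setOf_ofInv_mem hU hFG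
  have hA : deriv F 0 ≠ 0 := hFG.deriv_ne_zero
  refine ⟨deriv F 0, deriv (dslope F 0) 0, c, ⟨hFG.hasCuspExpansion hN0 h0 hc, hc0, hc1, hc2, hA⟩,
    fun g hg => ?_⟩
  set A := deriv F 0
  have hdiv : Tendsto (fun z : ℂ => z / A) (𝓝[≠] 0) (𝓝[≠] 0) := by
    refine tendsto_nhdsWithin_iff.2 ⟨?_, ?_⟩
    · have : ContinuousAt (fun z : ℂ => z / A) 0 := by fun_prop
      simpa using this.tendsto.mono_left nhdsWithin_le_nhds
    · filter_upwards [self_mem_nhdsWithin] with z hz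
      exact div_ne_zero hz hA
  refine ⟨?_, fun n => ?_⟩
  -- Together with `log |x| < -1` this keeps `log |x| + Re h(x)` away from `0`, so that the factor
  -- `1 + Re h(x) / log |x|` can be divided out.
  · have hre : ∀ᶠ x in 𝓝[≠] (0 : ℂ), |(h x).re| < 1 := by
      have : ContinuousAt (fun x => |(h x).re|) 0 :=
        (Complex.continuous_re.continuousAt.comp hh.continuousAt).abs
      exact eventually_nhdsWithin_of_eventually_nhds
        (this.eventually_lt continuousAt_const (by simp [hh0]))
    have hlog : ∀ᶠ x : ℂ in 𝓝[≠] 0, Real.log ‖x‖ < -1 :=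
      (Real.tendsto_log_nhdsGT_zero.comp tendsto_norm_nhdsNE_zero).eventually
        (eventually_lt_atBot (-1))
    filter_upwards [hdiv.eventually hmain, hFG.density_eq hN0 h0 hf hg, hdiv.eventually
      (PuncturedSphere.norm_deriv_div_eq hA hFG.analyticAt_inv hh hGh), hdiv.eventually hre,
      hdiv.eventually hlog, self_mem_nhdsWithin] with z h1 h2 h3 h4 h5 hz
    refine ⟨h1.1, ?_⟩
    have hz : ‖z‖ ≠ 0 := norm_ne_zero_iff.2 hz
    rw [mul_div_cancel₀ _ hA] at h3
    rw [h2, h3, ← h1.2, norm_mul]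
    generalize ‖PuncturedSphere.principalPart _ _ + _‖ = S
    set L := Real.log ‖z / A‖
    have h6 : ‖(1 : ℂ) + (((h (z / A)).re / L : ℝ) : ℂ)‖ = |L + (h (z / A)).re| / |L| := by
      rw [← abs_div, add_div, div_self (by linarith : L ≠ 0)]
      exact_mod_cast Complex.norm_real (1 + (h (z / A)).re / L)
    have h7 : |L + (h (z / A)).re| ≠ 0 := by
      rw [abs_ne_zero]
      have := abs_lt.1 h4
      linarith
    have h8 : |L| ≠ 0 := abs_ne_zero.2 (by linarith)
    rw [h6]
    field_simp
  · refine ((hrem n).comp_tendsto hdiv).trans ?_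
    refine IsBigO.of_bound (‖A‖⁻¹ ^ (n + 2)) (Eventually.of_forall fun z => ?_)
    simp only [Function.comp_apply, norm_pow, norm_norm]
    rw [norm_div, div_eq_inv_mul, mul_pow]
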